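/- **Conventions.** A cdga over a field $k$ of characteristic $0$ is a graded-commutative differential graded $k$-algebra with differential of degree $+1$; $\mathrm{Ho}(\mathrm{cdga}_k)$ is the localization of the category of cdga's at the quasi-isomorphisms. An $\mathbb{R}$-cbba is a bigraded $\mathbb{C}$-algebra $A$, graded-commutative with respect to the total degree, with anticommuting differentials $\partial,\bar\partial$ of bidegrees $(1,0)$ and $(0,1)$, each of square zero and satisfying the Leibniz rule, and with an antilinear multiplicative unital involution $\sigma$ such that $\sigma A^{p,q}=A^{q,p}$ and $\sigma(\partial+\bar\partial)\sigma=\partial+\bar\partial$. A (real) morphism is a map of unital algebras compatible with all of this; it is a pluripotential quasi-isomorphism if it induces isomorphisms in Bott-Chern cohomology $H_{BC}=(\ker\partial\cap\ker\bar\partial)/\operatorname{im}\partial\bar\partial$ and Aeppli cohomology $H_A=\ker\partial\bar\partial/(\operatorname{im}\partial+\operatorname{im}\bar\partial)$. $A$ has the $\partial\bar\partial$-property if the map from $H_{BC}(A)$ to the de Rham cohomology of $A$ is injective. $A$ is strongly formal if it is connected by a chain of (real) pluripotential quasi-isomorphisms to an $\mathbb{R}$-cbba with $\partial=\bar\partial=0$.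 Write $\mathrm{to}(A)^{\sigma}$ for the real cdga of $\sigma$-fixed elements with total grading and differential $\partial+\bar\partial$. A cbba with rational structure is a triple $(A_{\mathbb Q},A_{\mathbb C},\varphi)$ of a rational cdga, an $\mathbb{R}$-cbba and an isomorphism $\varphi:A_{\mathbb Q}\otimes\mathbb R\cong \mathrm{to}(A_{\mathbb C})^{\sigma}$ in $\mathrm{Ho}(\mathrm{cdga}_{\mathbb R})$. A morphism is a pair $(f_{\mathbb Q},f_{\mathbb C})$ of a cdga morphism and a real cbba morphism compatible with the isomorphisms in $\mathrm{Ho}(\mathrm{cdga}_{\mathbb R})$; it is a quasi-isomorphism if $f_{\mathbb C}$ is a pluripotential quasi-isomorphism. If $A_{\mathbb C}$ has the $\partial\bar\partial$-property, the triple is called strongly formal over $\mathbb Q$ if it is connected by a chain of quasi-isomorphisms to its cohomology $(H(A_{\mathbb Q}),H_{BC}(A_{\mathbb C}),H(\varphi))$ with trivial differentials. **The algebras.** For a field $k$ of characteristic $0$ let $H_k$ be the graded algebra $H^*(\mathbb{CP}^3\#\mathbb{CP}^3\#(S^2\times S^4);k)$, i.e. the commutative algebra with basis $1$ (degree $0$),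 $\bar\alpha,\bar x,\bar y$ (degree $2$), $\bar\beta,\bar x^2,\bar y^2$ (degree $4$) and $\bar\alpha\bar\beta=\bar x^3=\bar y^3$ (degree $6$), all other products of basis elements of positive degree being zero. Put $H=H_{\mathbb Q}$, $A_{\mathbb Q}=(H,0)$ and $A_{\mathbb C}=(H\otimes\mathbb C,0,0)$ with $H^{2j}\otimes\mathbb C$ in bidegree $(j,j)$ and with $\sigma$ the conjugation of coefficients, so that $\mathrm{to}(A_{\mathbb C})^{\sigma}=H\otimes\mathbb R$. Consider a rational cdga $M$, a quasi-isomorphism $\phi:M\to (H,0)$ and elements $\alpha,x,y\in M^2$, $a,b,c,e\in M^3$, $\beta,p_1,\dots,p_4\in M^4$ with $$d\alpha=dx=dy=d\beta=0,\quad da=\alpha^2,\ db=x\alpha,\ dc=y\alpha,\ de=xy,$$ $$dp_1=xa-\alpha b,\quad dp_2=ya-\alpha c,\quad dp_3=yb-\alpha e,\quad dp_4=xc-\alpha e,$$ and $\phi(\alpha)=\bar\alpha$, $\phi(x)=\bar x$, $\phi(y)=\bar y$, $\phi(\beta)=\bar\beta$, $\phi(p_i)=0$ (the generators of degree at most $4$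 of the minimal model of $H$ are of this form). For $\lambda\in\mathbb R$, let $\psi_\lambda:M\otimes\mathbb R\to H\otimes\mathbb R=\mathrm{to}(A_{\mathbb C})^{\sigma}$ denote a cdga morphism with $$\psi_\lambda(\alpha)=\bar\alpha,\ \psi_\lambda(x)=\bar x,\ \psi_\lambda(y)=\bar y,\ \psi_\lambda(\beta)=\bar\beta,\ \psi_\lambda(p_1)=-\lambda\bar y^2,\ \psi_\lambda(p_2)=-\lambda\bar x^2,\ \psi_\lambda(p_3)=\psi_\lambda(p_4)=\lambda\bar\beta .$$ **Theorem C.** (1) There are $M$, $\phi$ and elements as above such that a morphism $\psi_\lambda$ exists for every $\lambda\in\mathbb R$. (2) For all $M$, $\phi$ and elements as above, every $\lambda\in\mathbb R$ and every such $\psi_\lambda$: the maps $\phi\otimes\mathrm{Id}_{\mathbb R}$ and $\psi_\lambda$ are quasi-isomorphisms, so that the roof $H\otimes\mathbb R\xleftarrow{\phi\otimes\mathrm{Id}}M\otimes\mathbb R\xrightarrow{\psi_\lambda}\mathrm{to}(A_{\mathbb C})^{\sigma}$ represents an isomorphism $\varepsilon_\lambda$ in $\mathrm{Ho}(\mathrm{cdga}_{\mathbb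 R})$ and $A_\lambda=(A_{\mathbb Q},A_{\mathbb C},\varepsilon_\lambda)$ is a cbba with rational structure; its complex part $A_{\mathbb C}$ has the $\partial\bar\partial$-property and is strongly formal; and if $\lambda$ is irrational, then $A_\lambda$ is not strongly formal over $\mathbb Q$. (3) In particular, for cbba's with rational structure $(A_{\mathbb Q},A_{\mathbb C},\varphi)$ such that $A_{\mathbb C}$ has the $\partial\bar\partial$-property, strong formality of $A_{\mathbb C}$ does not imply strong formality over $\mathbb Q$. -/

import Mathlib

open CategoryTheory DirectSum
open scoped TensorProduct

noncomputable section

section Graded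

variable {ι R M : Type*} [DecidableEq ι] [CommRing R] [AddCommGroup M] [Module R M]
  {𝒜 : ι → Submodule R M}

open Classical in
/-- The projection of an internally graded module onto the sum of the components with index
in `s`. -/
def gproj (h : DirectSum.IsInternal 𝒜) (s : Set ι) : M →ₗ[R] M :=
  (DirectSum.toModule R ι M fun i => if i ∈ s then (𝒜 i).subtype else 0) ∘ₗ
    (LinearEquiv.ofBijective (DirectSum.coeLinearMap 𝒜) h).symm.toLinearMap

open Classical in
theorem gproj_of_mem (h : DirectSum.IsInternal 𝒜) (s : Set ι) {i : ι} {x : M} (hx : x ∈ 𝒜 i) :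
    gproj h s x = if i ∈ s then x else 0 := by
  have : (LinearEquiv.ofBijective (DirectSum.coeLinearMap 𝒜) h).symm x
      = DirectSum.lof R ι (fun i => 𝒜 i) i ⟨x, hx⟩ := by
    rw [LinearEquiv.symm_apply_eq]
    exact (DirectSum.coeLinearMap_lof 𝒜 i ⟨x, hx⟩).symm
  unfold gproj
  rw [LinearMap.comp_apply, LinearEquiv.coe_coe, this, DirectSum.toModule_lof]
  split_ifs <;> simp

theorem graded_induction (h : DirectSum.IsInternal 𝒜) {p : M → Prop} (x : M)
    (hmem : ∀ i, ∀ x ∈ 𝒜 i, p x) (h0 : p 0) (hadd : ∀ x y, p x → p y → p (x + y)) : p x :=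
  Submodule.iSup_induction 𝒜 (motive := p)
    (by rw [h.submodule_iSup_eq_top]; trivial) hmem h0 hadd

theorem gproj_mem (h : DirectSum.IsInternal 𝒜) (i : ι) (x : M) : gproj h {i} x ∈ 𝒜 i := by
  classical
  refine graded_induction h (p := fun x => gproj h {i} x ∈ 𝒜 i) x ?_ (by simp) ?_
  · intro j y hy
    rw [gproj_of_mem h _ hy]
    split_ifs with hj
    · rw [Set.mem_singleton_iff] at hj; exact hj ▸ hy
    · exact zero_mem _
  · intro a b ha hb
    rw [map_add]; exact add_mem ha hb

/-- Additive maps that shift or permute the components commute with the projections. -/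
theorem gproj_comm (h : DirectSum.IsInternal 𝒜) (f : M →+ M) (e : ι → ι)
    (hf : ∀ i, ∀ x ∈ 𝒜 i, f x ∈ 𝒜 (e i)) (s t : Set ι) (hst : ∀ i, e i ∈ t ↔ i ∈ s) (x : M) :
    gproj h t (f x) = f (gproj h s x) := by
  classical
  refine graded_induction h (p := fun x => gproj h t (f x) = f (gproj h s x)) x ?_ (by simp) ?_
  · intro i y hy
    rw [gproj_of_mem h _ hy, gproj_of_mem h _ (hf i y hy)]
    by_cases hi : i ∈ s
    · rw [if_pos hi, if_pos ((hst i).2 hi)]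
    · rw [if_neg hi, if_neg (fun h' => hi ((hst i).1 h')), map_zero]
  · intro a b ha hb
    simp only [map_add, ha, hb]

/-- An element is the sum of its components. -/
theorem mem_iSup_inf (h : DirectSum.IsInternal 𝒜) (S : Submodule R M) (x : M)
    (hx : ∀ i, gproj h {i} x ∈ S) : x ∈ ⨆ i, 𝒜 i ⊓ S := by
  classical
  have key : ∀ x : M, ∃ t : Finset ι, x = ∑ i ∈ t, gproj h {i} x := by
    intro x
    refine ⟨((LinearEquiv.ofBijective (DirectSum.coeLinearMap 𝒜) h).symm x).support, ?_⟩
    set v := (LinearEquiv.ofBijective (DirectSum.coeLinearMap 𝒜) h).symm x with hv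
    have hxv : x = DirectSum.coeLinearMap 𝒜 v := by
      have := (LinearEquiv.ofBijective (DirectSum.coeLinearMap 𝒜) h).apply_symm_apply x
      rw [← hv] at this
      exact this.symm
    have hcomp : ∀ i, gproj h {i} x = v i := by
      intro i
      have hs : x = ∑ j ∈ v.support, (v j : M) := by
        conv_lhs => rw [hxv]
        rw [DirectSum.coeLinearMap_eq_dfinsuppSum, DFinsupp.sum]
      conv_lhs => rw [hs]
      rw [map_sum, Finset.sum_congr rfl (fun j _ => gproj_of_mem h {i} (v j).2)]
      simp only [Set.mem_singleton_iff]
      rw [Finset.sum_ite_eq' v.support i (fun j => (v j : M))]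
      split_ifs with hi
      · rfl
      · rw [DFinsupp.notMem_support_iff.1 hi]; rfl
    conv_lhs => rw [hxv]
    rw [DirectSum.coeLinearMap_eq_dfinsuppSum, DFinsupp.sum]
    exact Finset.sum_congr rfl fun i _ => (hcomp i).symm
  obtain ⟨t, ht⟩ := key x
  rw [ht]
  exact Submodule.sum_mem _ fun i _ =>
    Submodule.mem_iSup_of_mem i ⟨gproj_mem h i x, hx i⟩

/-- A family of submodules that spans and has a system of projections is a grading. -/
theorem isInternal_of_proj (π : ι → M →ₗ[R] M) (hself : ∀ i, ∀ x ∈ 𝒜 i, π i x = x)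
    (hne : ∀ i j, i ≠ j → ∀ x ∈ 𝒜 j, π i x = 0) (hspan : ∀ x, x ∈ ⨆ i, 𝒜 i) :
    DirectSum.IsInternal 𝒜 := by
  refine DirectSum.isInternal_submodule_of_iSupIndep_of_iSup_eq_top ?_
    (by rw [eq_top_iff]; exact fun x _ => hspan x)
  intro i
  rw [Submodule.disjoint_def]
  intro x hx hx'
  have h0 : (⨆ j, ⨆ (_ : j ≠ i), 𝒜 j) ≤ LinearMap.ker (π i) :=
    iSup₂_le fun j hj y hy => hne i j hj.symm y hy
  rw [← hself i x hx]
  exact h0 hx'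

/-- Sums of components over the fibres of a map of index sets form a grading. -/
theorem isInternal_coarsen {κ : Type*} [DecidableEq κ] (h : DirectSum.IsInternal 𝒜) (f : ι → κ) :
    DirectSum.IsInternal (fun k : κ => ⨆ i : {i // f i = k}, 𝒜 i.1) := by
  classical
  refine isInternal_of_proj (fun k => gproj h {i | f i = k}) ?_ ?_ ?_
  · intro k x hx
    refine Submodule.iSup_induction _ (motive := fun x => gproj h {i | f i = k} x = x) hx
      ?_ (by simp) ?_
    · intro i y hy
      rw [gproj_of_mem h _ hy, if_pos]
      exact i.2
    · intro a b ha hb; simp only [map_add, ha, hb]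
  · intro k l hkl x hx
    refine Submodule.iSup_induction _ (motive := fun x => gproj h {i | f i = k} x = 0) hx
      ?_ (by simp) ?_
    · intro i y hy
      rw [gproj_of_mem h _ hy, if_neg]
      intro h'
      exact hkl (h'.symm.trans i.2)
    · intro a b ha hb; simp only [map_add, ha, hb, add_zero]
  · intro x
    refine graded_induction h (p := fun x => x ∈ ⨆ k, ⨆ i : {i // f i = k}, 𝒜 i.1) x ?_
      (zero_mem _) (fun a b => add_mem)
    intro i y hy
    exact Submodule.mem_iSup_of_mem (f i) (Submodule.mem_iSup_of_mem ⟨i, rfl⟩ hy)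

/-- A subquotient of a graded module by homogeneous submodules is graded. -/
theorem isInternal_subquotient (h : DirectSum.IsInternal 𝒜) {P N : Type*} [AddCommGroup P]
    [Module R P] [AddCommGroup N] [Module R N] (i : P →ₗ[R] M) (q : P →ₗ[R] N)
    (hi : Function.Injective i) (hq : Function.Surjective q)
    (hP : ∀ n x, ∃ y, i y = gproj h {n} (i x))
    (hQ : ∀ n x y, q x = 0 → i y = gproj h {n} (i x) → q y = 0) :
    DirectSum.IsInternal (fun n => ((𝒜 n).comap i).map q) := by
  classical
  have hP' : ∀ n x, gproj h {n} (i x) ∈ LinearMap.range i := fun n x => hP n x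
  let e := LinearEquiv.ofInjective i hi
  let ρ : ι → P →ₗ[R] P := fun n => e.symm.toLinearMap ∘ₗ
    LinearMap.codRestrict (LinearMap.range i) (gproj h {n} ∘ₗ i) (hP' n)
  have hρ : ∀ n x, i (ρ n x) = gproj h {n} (i x) := by
    intro n x
    have := congrArg Subtype.val (e.apply_symm_apply
      (LinearMap.codRestrict (LinearMap.range i) (gproj h {n} ∘ₗ i) (hP' n) x))
    exact this
  let E := LinearMap.quotKerEquivOfSurjective q hq
  have hk : ∀ n, LinearMap.ker q ≤ LinearMap.ker (q ∘ₗ ρ n) := by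
    intro n x hx
    exact hQ n x _ hx (hρ n x)
  let π : ι → N →ₗ[R] N := fun n => (LinearMap.ker q).liftQ (q ∘ₗ ρ n) (hk n) ∘ₗ E.symm.toLinearMap
  have hπ : ∀ n x, π n (q x) = q (ρ n x) := by
    intro n x
    have : E.symm (q x) = (LinearMap.ker q).mkQ x := by
      rw [LinearEquiv.symm_apply_eq]; rfl
    simp only [π, LinearMap.comp_apply, LinearEquiv.coe_coe, this]
    rfl
  refine isInternal_of_proj π ?_ ?_ ?_
  · rintro n _ ⟨x, hx, rfl⟩
    rw [hπ]
    congr 1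
    apply hi
    rw [hρ, gproj_of_mem h _ hx, if_pos (Set.mem_singleton n)]
  · rintro n m hnm _ ⟨x, hx, rfl⟩
    rw [hπ]
    have : ρ n x = 0 := by
      apply hi
      rw [hρ, gproj_of_mem h _ hx, if_neg (fun h' => hnm h'.symm), map_zero]
    rw [this, map_zero]
  · intro z
    obtain ⟨x, rfl⟩ := hq z
    have hx : i x ∈ ⨆ n, 𝒜 n ⊓ LinearMap.range i := mem_iSup_inf h _ _ (fun n => hP' n x)
    have : ∀ y ∈ ⨆ n, 𝒜 n ⊓ LinearMap.range i, ∀ x, i x = y →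
        q x ∈ ⨆ n, ((𝒜 n).comap i).map q := by
      intro y hy
      have hy' : ∃ x, i x = y ∧ q x ∈ ⨆ n, ((𝒜 n).comap i).map q := by
        refine Submodule.iSup_induction _ (motive := fun y => ∃ x, i x = y ∧
          q x ∈ ⨆ n, ((𝒜 n).comap i).map q) hy ?_ ⟨0, by simp, by simp⟩ ?_
        · rintro n _ ⟨hy1, x, rfl⟩
          exact ⟨x, rfl, Submodule.mem_iSup_of_mem n ⟨x, hy1, rfl⟩⟩
        · rintro _ _ ⟨a, rfl, ha⟩ ⟨b, rfl, hb⟩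
          exact ⟨a + b, by simp, by rw [map_add]; exact add_mem ha hb⟩
      obtain ⟨x', hx', h'⟩ := hy'
      intro x hx
      rwa [hi (hx.trans hx'.symm)]
    exact this _ hx x rfl

end Graded

/-! ### Commutative differential graded algebras -/

/-- A commutative differential graded algebra over `k` (cohomologically graded by `ℤ`). -/
structure CDGA (k : Type) [Field k] : Type 1 where
  carrier : Type
  [ring : Ring carrier]
  [algebra : Algebra k carrier]
  /-- the homogeneous components -/
  gr : ℤ → Submodule k carrier
  isInternal : DirectSum.IsInternal gr
  one_mem : (1 : carrier) ∈ gr 0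
  mul_mem : ∀ {m n : ℤ} {a b : carrier}, a ∈ gr m → b ∈ gr n → a * b ∈ gr (m + n)
  comm : ∀ {m n : ℤ} {a b : carrier}, a ∈ gr m → b ∈ gr n →
    a * b = ((m * n).negOnePow : ℤ) • (b * a)
  /-- the differential -/
  d : carrier →ₗ[k] carrier
  d_mem : ∀ {n : ℤ} {a : carrier}, a ∈ gr n → d a ∈ gr (n + 1)
  d_d : ∀ a, d (d a) = 0
  leibniz : ∀ {m : ℤ} {a : carrier}, a ∈ gr m → ∀ b,
    d (a * b) = d a * b + (m.negOnePow : ℤ) • (a * d b)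

namespace CDGA

attribute [instance] CDGA.ring CDGA.algebra

variable {k : Type} [Field k]

/-- A morphism of cdga's. -/
@[ext]
structure Hom (A B : CDGA k) where
  toAlgHom : A.carrier →ₐ[k] B.carrier
  map_mem : ∀ {n : ℤ} {a : A.carrier}, a ∈ A.gr n → toAlgHom a ∈ B.gr n
  map_d : ∀ a, toAlgHom (A.d a) = B.d (toAlgHom a)

instance : Category (CDGA k) where
  Hom := Hom
  id A := ⟨AlgHom.id k A.carrier, fun h => h, fun _ => rfl⟩
  comp f g := ⟨g.toAlgHom.comp f.toAlgHom, fun h => g.map_mem (f.map_mem h), fun a => by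
    simp only [AlgHom.comp_apply, f.map_d, g.map_d]⟩

variable (A : CDGA k)

theorem d_one : A.d 1 = 0 := by
  have h := A.leibniz A.one_mem 1
  simpa using h

theorem gproj_d (n : ℤ) (a : A.carrier) :
    gproj A.isInternal {n + 1} (A.d a) = A.d (gproj A.isInternal {n} a) :=
  gproj_comm A.isInternal A.d.toAddMonoidHom (fun n => n + 1) (fun _ _ h => A.d_mem h) {n} {n + 1}
    (fun i => by simp) a

theorem closed_induction {p : A.carrier → Prop} {z : A.carrier} (hz : A.d z = 0) (h0 : p 0)
    (hadd : ∀ x y, p x → p y → p (x + y)) (hmem : ∀ n, ∀ x ∈ A.gr n, A.d x = 0 → p x) : p z := by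
  have : z ∈ ⨆ n, A.gr n ⊓ LinearMap.ker A.d := by
    refine mem_iSup_inf A.isInternal _ z fun n => ?_
    rw [LinearMap.mem_ker, ← A.gproj_d, hz, map_zero]
  exact Submodule.iSup_induction _ (motive := p) this (fun n x hx => hmem n x hx.1 hx.2) h0 hadd

/-- The subalgebra `ker d` of cocycles. -/
def cocycles : Subalgebra k A.carrier where
  carrier := {a | A.d a = 0}
  mul_mem' := by
    intro a b ha hb
    refine A.closed_induction (p := fun a => A.d (a * b) = 0) ha (by simp) ?_ ?_
    · intro x y hx hy; rw [add_mul, map_add, hx, hy, add_zero]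
    · intro n x hx hx'
      have hb' : A.d b = 0 := hb
      simp [A.leibniz hx, hx', hb']
  add_mem' := by
    intro a b (ha : A.d a = 0) (hb : A.d b = 0)
    show A.d (a + b) = 0
    rw [map_add, ha, hb, add_zero]
  algebraMap_mem' := by
    intro r
    show A.d (algebraMap k A.carrier r) = 0
    rw [Algebra.algebraMap_eq_smul_one, map_smul, A.d_one, smul_zero]

theorem d_cocycle (z : A.cocycles) : A.d z = 0 := z.2

/-- The ideal `im d` of coboundaries in the algebra of cocycles. -/
def coboundaries : Ideal A.cocycles where
  carrier := {z | ∃ a, A.d a = z}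
  zero_mem' := ⟨0, by simp⟩
  add_mem' := by
    rintro x y ⟨a, ha⟩ ⟨b, hb⟩
    exact ⟨a + b, by simp [ha, hb]⟩
  smul_mem' := by
    rintro w z ⟨a, ha⟩
    show ∃ b, A.d b = (w : A.carrier) * z
    rw [← ha]
    refine A.closed_induction (p := fun w => ∃ b, A.d b = w * A.d a) w.2 ⟨0, by simp⟩ ?_ ?_
    · rintro x y ⟨b, hb⟩ ⟨c, hc⟩
      exact ⟨b + c, by rw [map_add, hb, hc, add_mul]⟩
    · intro n x hx hx'
      refine ⟨(n.negOnePow : ℤ) • (x * a), ?_⟩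
      rw [map_zsmul, A.leibniz hx, hx', zero_mul, zero_add, smul_smul]
      simp

instance : A.coboundaries.IsTwoSided where
  mul_mem_of_left := by
    rintro z w ⟨a, ha⟩
    refine ⟨a * w, ?_⟩
    show A.d (a * w) = (z : A.carrier) * w
    rw [← ha]
    refine graded_induction A.isInternal (p := fun a => A.d (a * w) = A.d a * w) a ?_ (by simp) ?_
    · intro n x hx
      rw [A.leibniz hx, A.d_cocycle w, mul_zero, smul_zero, add_zero]
    · intro x y hx hy
      rw [add_mul, map_add, hx, hy, map_add, add_mul]

/-- The cohomology class of a cocycle. -/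
def cls : A.cocycles →ₐ[k] A.cocycles ⧸ A.coboundaries :=
  Ideal.Quotient.mkₐ k A.coboundaries

theorem cls_surjective : Function.Surjective A.cls := Ideal.Quotient.mkₐ_surjective k _

theorem cls_eq_zero (z : A.cocycles) : A.cls z = 0 ↔ ∃ a, A.d a = z :=
  Ideal.Quotient.eq_zero_iff_mem

/-- The cohomology `H(A) = ker d / im d`, as a cdga with trivial differential. -/
def cohomology : CDGA k where
  carrier := A.cocycles ⧸ A.coboundaries
  gr n := ((A.gr n).comap A.cocycles.val.toLinearMap).map A.cls.toLinearMap
  isInternal := by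
    refine isInternal_subquotient A.isInternal _ _ Subtype.val_injective A.cls_surjective ?_ ?_
    · intro n z
      refine ⟨⟨gproj A.isInternal {n} z, ?_⟩, rfl⟩
      show A.d _ = 0
      rw [← A.gproj_d, A.d_cocycle, map_zero]
    · intro n x y hx hy
      obtain ⟨a, ha⟩ := (A.cls_eq_zero x).1 hx
      refine (A.cls_eq_zero y).2 ⟨gproj A.isInternal {n - 1} a, ?_⟩
      rw [← A.gproj_d, ha, sub_add_cancel]
      exact hy.symm
  one_mem := ⟨1, A.one_mem, map_one A.cls⟩
  mul_mem := by
    rintro m n _ _ ⟨x, hx, rfl⟩ ⟨y, hy, rfl⟩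
    exact ⟨x * y, A.mul_mem hx hy, map_mul A.cls x y⟩
  comm := by
    rintro m n _ _ ⟨x, hx, rfl⟩ ⟨y, hy, rfl⟩
    have : x * y = ((m * n).negOnePow : ℤ) • (y * x) := Subtype.ext (by
      simpa using A.comm hx hy)
    show A.cls x * A.cls y = _ • (A.cls y * A.cls x)
    rw [← map_mul, this, map_zsmul, map_mul]
  d := 0
  d_mem _ := zero_mem _
  d_d _ := rfl
  leibniz _ _ := by simp

variable {A}

/-- The map induced by a morphism on cocycles. -/
def Hom.mapCocycles {B : CDGA k} (f : Hom A B) : A.cocycles →ₐ[k] B.cocycles :=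
  (f.toAlgHom.comp A.cocycles.val).codRestrict B.cocycles (fun z => by
    show B.d (f.toAlgHom z) = 0
    rw [← f.map_d, A.d_cocycle, map_zero])

/-- The map induced by a morphism on cohomology. -/
def Hom.mapCohomology {B : CDGA k} (f : Hom A B) :
    A.cocycles ⧸ A.coboundaries →ₐ[k] B.cocycles ⧸ B.coboundaries :=
  Ideal.Quotient.liftₐ A.coboundaries (B.cls.comp f.mapCocycles) (by
    rintro z ⟨a, ha⟩
    refine (B.cls_eq_zero _).2 ⟨f.toAlgHom a, ?_⟩
    rw [← f.map_d, ha]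
    rfl)

theorem Hom.mapCohomology_cls {B : CDGA k} (f : Hom A B) (z : A.cocycles) :
    f.mapCohomology (A.cls z) = B.cls (f.mapCocycles z) := rfl

theorem mapCohomology_id (x : A.cocycles ⧸ A.coboundaries) :
    Hom.mapCohomology (𝟙 A) x = x := by
  obtain ⟨z, rfl⟩ := A.cls_surjective x
  rfl

theorem mapCohomology_comp {B C : CDGA k} (f : A ⟶ B) (g : B ⟶ C)
    (x : A.cocycles ⧸ A.coboundaries) :
    Hom.mapCohomology (f ≫ g) x = Hom.mapCohomology g (Hom.mapCohomology f x) := by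
  obtain ⟨z, rfl⟩ := A.cls_surjective x
  rfl

variable (k) in
/-- Cohomology as a functor to vector spaces. -/
def cohFunctor : CDGA k ⥤ ModuleCat k where
  obj A := ModuleCat.of k (A.cocycles ⧸ A.coboundaries)
  map f := ModuleCat.ofHom (Hom.mapCohomology f).toLinearMap
  map_id _ := ModuleCat.hom_ext (LinearMap.ext mapCohomology_id)
  map_comp f g := ModuleCat.hom_ext (LinearMap.ext (mapCohomology_comp f g))

variable (k) in
/-- Quasi-isomorphisms of cdga's. -/
def quasiIso : MorphismProperty (CDGA k) :=
  fun _ _ f => Function.Bijective (Hom.mapCohomology f)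

variable (k) in
/-- The homotopy category `Ho(cdga_k)`: the localization at the quasi-isomorphisms. -/
abbrev Ho : Type 1 := (quasiIso k).Localization

variable (k) in
theorem cohFunctor_inverts : (quasiIso k).IsInvertedBy (cohFunctor k) := by
  intro A B f hf
  exact (LinearEquiv.ofBijective (Hom.mapCohomology f).toLinearMap hf).toModuleIso.isIso_hom

variable (k) in
/-- Cohomology as a functor on the homotopy category. -/
def hoCoh : Ho k ⥤ ModuleCat k :=
  Localization.Construction.lift (cohFunctor k) (cohFunctor_inverts k)

/-- The isomorphism in the homotopy category given by a quasi-isomorphism. -/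
def hoIso {B : CDGA k} (f : A ⟶ B) (hf : quasiIso k f) :
    (quasiIso k).Q.obj A ≅ (quasiIso k).Q.obj B :=
  Localization.Construction.wIso f hf


/-! Extension of scalars. -/

section BaseChange

variable (K : Type) [Field K] [Algebra k K]

theorem baseChange_induction {M : Type} [AddCommGroup M] [Module k M] {S : Submodule k M}
    {p : K ⊗[k] M → Prop} {x : K ⊗[k] M} (hx : x ∈ S.baseChange K) (h0 : p 0)
    (hadd : ∀ x y, p x → p y → p (x + y)) (hmem : ∀ (c : K), ∀ m ∈ S, p (c ⊗ₜ m)) : p x := by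
  obtain ⟨y, rfl⟩ := hx
  induction y with
  | zero => rw [map_zero]; exact h0
  | add a b ha hb => rw [map_add]; exact hadd _ _ ha hb
  | tmul c m => exact hmem c m m.2

theorem tmul_mem_baseChange {M : Type} [AddCommGroup M] [Module k M] {S : Submodule k M}
    (c : K) {m : M} (hm : m ∈ S) : c ⊗ₜ[k] m ∈ S.baseChange K :=
  Submodule.tmul_mem_baseChange_of_mem c hm

theorem isInternal_baseChange {M : Type} [AddCommGroup M] [Module k M] {𝒜 : ℤ → Submodule k M}
    (h : DirectSum.IsInternal 𝒜) : DirectSum.IsInternal (fun n => (𝒜 n).baseChange K) := by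
  refine isInternal_of_proj (fun n => (gproj h {n}).baseChange K) ?_ ?_ ?_
  · intro n x hx
    refine baseChange_induction K (p := fun x => (gproj h {n}).baseChange K x = x) hx (by simp)
      (fun a b ha hb => by simp only [map_add, ha, hb]) ?_
    intro c m hm
    rw [LinearMap.baseChange_tmul, gproj_of_mem h _ hm, if_pos (Set.mem_singleton n)]
  · intro n l hnl x hx
    refine baseChange_induction K (p := fun x => (gproj h {n}).baseChange K x = 0) hx (by simp)
      (fun a b ha hb => by simp only [map_add, ha, hb, add_zero]) ?_
    intro c m hm
    rw [LinearMap.baseChange_tmul, gproj_of_mem h _ hm, if_neg (fun h' => hnl h'.symm),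
      TensorProduct.tmul_zero]
  · intro x
    induction x with
    | zero => exact zero_mem _
    | add a b ha hb => exact add_mem ha hb
    | tmul c m =>
      refine graded_induction h (p := fun m => c ⊗ₜ[k] m ∈ ⨆ n, (𝒜 n).baseChange K) m ?_
        (by simp) (fun a b ha hb => by rw [TensorProduct.tmul_add]; exact add_mem ha hb)
      intro n y hy
      exact Submodule.mem_iSup_of_mem n (tmul_mem_baseChange K c hy)

/-- The cdga `K ⊗ A` over `K`. -/
def extend (A : CDGA k) : CDGA K where
  carrier := K ⊗[k] A.carrier
  gr n := (A.gr n).baseChange K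
  isInternal := isInternal_baseChange K A.isInternal
  one_mem := tmul_mem_baseChange K 1 A.one_mem
  mul_mem := by
    intro m n a b ha hb
    refine baseChange_induction K (p := fun a => a * b ∈ (A.gr (m + n)).baseChange K) ha (by simp)
      (fun x y hx hy => by rw [add_mul]; exact add_mem hx hy) ?_
    intro c x hx
    refine baseChange_induction K (p := fun b => c ⊗ₜ[k] x * b ∈ (A.gr (m + n)).baseChange K) hb
      (by simp) (fun x y hx hy => by rw [mul_add]; exact add_mem hx hy) ?_
    intro c' y hy
    rw [Algebra.TensorProduct.tmul_mul_tmul]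
    exact tmul_mem_baseChange K _ (A.mul_mem hx hy)
  comm := by
    intro m n a b ha hb
    refine baseChange_induction K (p := fun a => a * b = ((m * n).negOnePow : ℤ) • (b * a)) ha
      (by simp) (fun x y hx hy => by rw [add_mul, mul_add, hx, hy, smul_add]) ?_
    intro c x hx
    refine baseChange_induction K
      (p := fun b => c ⊗ₜ[k] x * b = ((m * n).negOnePow : ℤ) • (b * c ⊗ₜ[k] x)) hb
      (by simp) (fun x y hx hy => by rw [add_mul, mul_add, hx, hy, smul_add]) ?_
    intro c' y hy
    rw [Algebra.TensorProduct.tmul_mul_tmul, Algebra.TensorProduct.tmul_mul_tmul, A.comm hx hy,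
      mul_comm c c', ← TensorProduct.tmul_smul]
  d := A.d.baseChange K
  d_mem := by
    intro n a ha
    refine baseChange_induction K (p := fun a => A.d.baseChange K a ∈ (A.gr (n + 1)).baseChange K)
      ha (by simp) (fun x y hx hy => by rw [map_add]; exact add_mem hx hy) ?_
    intro c x hx
    rw [LinearMap.baseChange_tmul]
    exact tmul_mem_baseChange K _ (A.d_mem hx)
  d_d := by
    intro a
    induction a with
    | zero => simp
    | add x y hx hy => rw [map_add, map_add, hx, hy, add_zero]
    | tmul c x => rw [LinearMap.baseChange_tmul, LinearMap.baseChange_tmul, A.d_d,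
        TensorProduct.tmul_zero]
  leibniz := by
    intro m a ha b
    refine baseChange_induction K (p := fun a => A.d.baseChange K (a * b) =
      A.d.baseChange K a * b + (m.negOnePow : ℤ) • (a * A.d.baseChange K b)) ha (by simp) ?_ ?_
    · intro x y hx hy
      rw [add_mul, map_add, map_add, hx, hy, add_mul, add_mul, smul_add]
      abel
    · intro c x hx
      induction b with
      | zero => simp
      | add y z hy hz =>
        rw [mul_add, map_add, map_add, hy, hz, mul_add, mul_add, smul_add]
        abel
      | tmul c' y =>
        simp only [Algebra.TensorProduct.tmul_mul_tmul, LinearMap.baseChange_tmul, A.leibniz hx,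
          TensorProduct.tmul_add, TensorProduct.tmul_smul]

/-- Extension of scalars on morphisms. -/
def extendMap {A B : CDGA k} (f : A ⟶ B) : A.extend K ⟶ B.extend K where
  toAlgHom := Algebra.TensorProduct.map (AlgHom.id K K) (Hom.toAlgHom f)
  map_mem := by
    intro n a ha
    refine baseChange_induction K (p := fun a => Algebra.TensorProduct.map (AlgHom.id K K)
      (Hom.toAlgHom f) a ∈ (B.gr n).baseChange K) ha (by simp)
      (fun x y hx hy => by rw [map_add]; exact add_mem hx hy) ?_
    intro c x hx
    exact tmul_mem_baseChange K _ (Hom.map_mem f hx)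
  map_d := by
    intro (a : K ⊗[k] A.carrier)
    show Algebra.TensorProduct.map (AlgHom.id K K) (Hom.toAlgHom f) (A.d.baseChange K a) =
      B.d.baseChange K (Algebra.TensorProduct.map (AlgHom.id K K) (Hom.toAlgHom f) a)
    induction a with
    | zero => simp
    | add x y hx hy => simp only [map_add, hx, hy]
    | tmul c x =>
      simp only [LinearMap.baseChange_tmul, Algebra.TensorProduct.map_tmul, Hom.map_d]

end BaseChange

end CDGA

/-! ### Commutative bigraded bidifferential algebras with real structure -/

/-- A commutative bigraded bidifferential algebra (cbba) over `ℂ` with a real structure. -/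
structure RCBBA : Type 1 where
  carrier : Type
  [ring : Ring carrier]
  [algebra : Algebra ℂ carrier]
  /-- the component of bidegree `(p, q)` -/
  gr : ℤ × ℤ → Submodule ℂ carrier
  isInternal : DirectSum.IsInternal gr
  one_mem : (1 : carrier) ∈ gr (0, 0)
  mul_mem : ∀ {i j : ℤ × ℤ} {a b : carrier}, a ∈ gr i → b ∈ gr j → a * b ∈ gr (i + j)
  comm : ∀ {i j : ℤ × ℤ} {a b : carrier}, a ∈ gr i → b ∈ gr j →
    a * b = (((i.1 + i.2) * (j.1 + j.2)).negOnePow : ℤ) • (b * a)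
  /-- the differential `∂` -/
  del : carrier →ₗ[ℂ] carrier
  /-- the differential `∂̄` -/
  delbar : carrier →ₗ[ℂ] carrier
  del_mem : ∀ {p q : ℤ} {a : carrier}, a ∈ gr (p, q) → del a ∈ gr (p + 1, q)
  delbar_mem : ∀ {p q : ℤ} {a : carrier}, a ∈ gr (p, q) → delbar a ∈ gr (p, q + 1)
  del_del : ∀ a, del (del a) = 0
  delbar_delbar : ∀ a, delbar (delbar a) = 0
  del_delbar : ∀ a, del (delbar a) + delbar (del a) = 0
  del_leibniz : ∀ {i : ℤ × ℤ} {a : carrier}, a ∈ gr i → ∀ b,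
    del (a * b) = del a * b + ((i.1 + i.2).negOnePow : ℤ) • (a * del b)
  delbar_leibniz : ∀ {i : ℤ × ℤ} {a : carrier}, a ∈ gr i → ∀ b,
    delbar (a * b) = delbar a * b + ((i.1 + i.2).negOnePow : ℤ) • (a * delbar b)
  /-- the antilinear involution -/
  conj : carrier →ₛₗ[starRingEnd ℂ] carrier
  conj_conj : ∀ a, conj (conj a) = a
  conj_one : conj 1 = 1
  conj_mul : ∀ a b, conj (a * b) = conj a * conj b
  conj_mem : ∀ {p q : ℤ} {a : carrier}, a ∈ gr (p, q) → conj a ∈ gr (q, p)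
  conj_d : ∀ a, conj (del (conj a) + delbar (conj a)) = del a + delbar a

namespace RCBBA

attribute [instance] RCBBA.ring RCBBA.algebra

/-- A real morphism of cbba's. -/
@[ext]
structure Hom (A B : RCBBA) where
  toAlgHom : A.carrier →ₐ[ℂ] B.carrier
  map_mem : ∀ {i : ℤ × ℤ} {a : A.carrier}, a ∈ A.gr i → toAlgHom a ∈ B.gr i
  map_del : ∀ a, toAlgHom (A.del a) = B.del (toAlgHom a)
  map_delbar : ∀ a, toAlgHom (A.delbar a) = B.delbar (toAlgHom a)
  map_conj : ∀ a, toAlgHom (A.conj a) = B.conj (toAlgHom a)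

instance : Category RCBBA where
  Hom := Hom
  id A := ⟨AlgHom.id ℂ A.carrier, fun h => h, fun _ => rfl, fun _ => rfl, fun _ => rfl⟩
  comp f g := ⟨g.toAlgHom.comp f.toAlgHom, fun h => g.map_mem (f.map_mem h),
    fun a => by simp only [AlgHom.comp_apply, f.map_del, g.map_del],
    fun a => by simp only [AlgHom.comp_apply, f.map_delbar, g.map_delbar],
    fun a => by simp only [AlgHom.comp_apply, f.map_conj, g.map_conj]⟩

variable (A : RCBBA)

theorem gproj_del (p q : ℤ) (a : A.carrier) :
    gproj A.isInternal {(p + 1, q)} (A.del a) = A.del (gproj A.isInternal {(p, q)} a) :=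
  gproj_comm A.isInternal A.del.toAddMonoidHom (fun i => (i.1 + 1, i.2)) (fun _ _ h => A.del_mem h)
    {(p, q)} {(p + 1, q)} (fun i => by simp [Prod.ext_iff]) a

theorem gproj_delbar (p q : ℤ) (a : A.carrier) :
    gproj A.isInternal {(p, q + 1)} (A.delbar a) = A.delbar (gproj A.isInternal {(p, q)} a) :=
  gproj_comm A.isInternal A.delbar.toAddMonoidHom (fun i => (i.1, i.2 + 1))
    (fun _ _ h => A.delbar_mem h) {(p, q)} {(p, q + 1)} (fun i => by simp [Prod.ext_iff]) a

/-- Conjugation exchanges the two differentials. -/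
theorem conj_del (a : A.carrier) : A.conj (A.del a) = A.delbar (A.conj a) := by
  refine graded_induction A.isInternal (p := fun a => A.conj (A.del a) = A.delbar (A.conj a)) a
    ?_ (by simp) (fun x y hx hy => by simp only [map_add, hx, hy])
  rintro ⟨p, q⟩ x hx
  have h := A.conj_d (A.conj x)
  rw [A.conj_conj, map_add] at h
  have h1 := A.conj_mem (A.del_mem hx)
  have h2 := A.conj_mem (A.delbar_mem hx)
  have h3 := A.del_mem (A.conj_mem hx)
  have h4 := A.delbar_mem (A.conj_mem hx)
  have h5 := congrArg (gproj A.isInternal {(q, p + 1)}) h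
  rw [map_add, map_add, gproj_of_mem _ _ h1, gproj_of_mem _ _ h2, gproj_of_mem _ _ h3,
    gproj_of_mem _ _ h4] at h5
  simpa using h5

theorem conj_delbar (a : A.carrier) : A.conj (A.delbar a) = A.del (A.conj a) := by
  have h := A.conj_del (A.conj a)
  rw [A.conj_conj] at h
  rw [← h, A.conj_conj]

theorem del_one : A.del 1 = 0 := by
  simpa using A.del_leibniz A.one_mem 1

theorem delbar_one : A.delbar 1 = 0 := by
  simpa using A.delbar_leibniz A.one_mem 1

theorem closed_induction {p : A.carrier → Prop} {z : A.carrier} (hz : A.del z = 0)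
    (hz' : A.delbar z = 0) (h0 : p 0) (hadd : ∀ x y, p x → p y → p (x + y))
    (hmem : ∀ i, ∀ x ∈ A.gr i, A.del x = 0 → A.delbar x = 0 → p x) : p z := by
  have : z ∈ ⨆ n, A.gr n ⊓ (LinearMap.ker A.del ⊓ LinearMap.ker A.delbar) := by
    refine mem_iSup_inf A.isInternal _ z fun n => ⟨?_, ?_⟩
    · rw [SetLike.mem_coe, LinearMap.mem_ker, ← A.gproj_del, hz, map_zero]
    · rw [SetLike.mem_coe, LinearMap.mem_ker, ← A.gproj_delbar, hz', map_zero]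
  exact Submodule.iSup_induction _ (motive := p) this
    (fun n x hx => hmem n x hx.1 hx.2.1 hx.2.2) h0 hadd

/-- The subalgebra `ker ∂ ∩ ker ∂̄`. -/
def cocycles : Subalgebra ℂ A.carrier where
  carrier := {a | A.del a = 0 ∧ A.delbar a = 0}
  mul_mem' := by
    rintro a b ⟨ha, ha'⟩ ⟨hb, hb'⟩
    refine A.closed_induction (p := fun a => A.del (a * b) = 0 ∧ A.delbar (a * b) = 0) ha ha'
      (by simp) ?_ ?_
    · rintro x y ⟨hx, hx'⟩ ⟨hy, hy'⟩
      rw [add_mul, map_add, map_add, hx, hy, hx', hy']; simp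
    · intro n x hx h1 h2
      simp [A.del_leibniz hx, A.delbar_leibniz hx, h1, h2, hb, hb']
  add_mem' := by
    rintro a b ⟨ha, ha'⟩ ⟨hb, hb'⟩
    show A.del (a + b) = 0 ∧ A.delbar (a + b) = 0
    rw [map_add, map_add, ha, ha', hb, hb']; simp
  algebraMap_mem' := by
    intro r
    show A.del (algebraMap ℂ A.carrier r) = 0 ∧ A.delbar (algebraMap ℂ A.carrier r) = 0
    rw [Algebra.algebraMap_eq_smul_one, map_smul, map_smul, A.del_one, A.delbar_one]; simp

theorem del_cocycle (z : A.cocycles) : A.del z = 0 := z.2.1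

theorem delbar_cocycle (z : A.cocycles) : A.delbar z = 0 := z.2.2

/-- The ideal `im ∂∂̄` in the algebra `ker ∂ ∩ ker ∂̄`. -/
def coboundaries : Ideal A.cocycles where
  carrier := {z | ∃ a, A.del (A.delbar a) = z}
  zero_mem' := ⟨0, by simp⟩
  add_mem' := by
    rintro x y ⟨a, ha⟩ ⟨b, hb⟩
    exact ⟨a + b, by simp [ha, hb]⟩
  smul_mem' := by
    rintro w z ⟨a, ha⟩
    show ∃ b, A.del (A.delbar b) = (w : A.carrier) * z
    rw [← ha]
    refine A.closed_induction (p := fun w => ∃ b, A.del (A.delbar b) = w * A.del (A.delbar a))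
      w.2.1 w.2.2 ⟨0, by simp⟩ ?_ ?_
    · rintro x y ⟨b, hb⟩ ⟨c, hc⟩
      exact ⟨b + c, by rw [map_add, map_add, hb, hc, add_mul]⟩
    · intro n x hx h1 h2
      refine ⟨x * a, ?_⟩
      rw [A.delbar_leibniz hx, h2, zero_mul, zero_add, map_zsmul, A.del_leibniz hx, h1, zero_mul,
        zero_add, smul_smul]
      simp

instance : A.coboundaries.IsTwoSided where
  mul_mem_of_left := by
    rintro z w ⟨a, ha⟩
    refine ⟨a * w, ?_⟩
    show A.del (A.delbar (a * w)) = (z : A.carrier) * w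
    rw [← ha]
    refine graded_induction A.isInternal
      (p := fun a => A.del (A.delbar (a * w)) = A.del (A.delbar a) * w) a ?_ (by simp) ?_
    · rintro ⟨p, q⟩ x hx
      rw [A.delbar_leibniz hx, A.delbar_cocycle w, mul_zero, smul_zero, add_zero,
        A.del_leibniz (A.delbar_mem hx), A.del_cocycle w, mul_zero, smul_zero, add_zero]
    · intro x y hx hy
      simp only [add_mul, map_add, hx, hy]

/-- The Bott-Chern class of a `∂`- and `∂̄`-closed element. -/
def cls : A.cocycles →ₐ[ℂ] A.cocycles ⧸ A.coboundaries :=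
  Ideal.Quotient.mkₐ ℂ A.coboundaries

theorem cls_surjective : Function.Surjective A.cls := Ideal.Quotient.mkₐ_surjective ℂ _

theorem cls_eq_zero (z : A.cocycles) : A.cls z = 0 ↔ ∃ a, A.del (A.delbar a) = z :=
  Ideal.Quotient.eq_zero_iff_mem

/-- Conjugation on `ker ∂ ∩ ker ∂̄`. -/
def conjCocycle (z : A.cocycles) : A.cocycles :=
  ⟨A.conj z, by
    show A.del (A.conj z) = 0 ∧ A.delbar (A.conj z) = 0
    rw [← A.conj_del, ← A.conj_delbar, A.del_cocycle, A.delbar_cocycle]; simp⟩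

/-- Conjugation on Bott-Chern cohomology. -/
def conjBC : (A.cocycles ⧸ A.coboundaries) →ₛₗ[starRingEnd ℂ] (A.cocycles ⧸ A.coboundaries) where
  toFun := Quotient.lift (fun z => A.cls (A.conjCocycle z)) (by
    intro x y hxy
    have h : A.cls (x - y) = 0 := by
      rw [map_sub, sub_eq_zero]; exact Quotient.sound hxy
    obtain ⟨a, ha⟩ := (A.cls_eq_zero _).1 h
    show A.cls (A.conjCocycle x) = A.cls (A.conjCocycle y)
    rw [← sub_eq_zero, ← map_sub]
    refine (A.cls_eq_zero _).2 ⟨-A.conj a, ?_⟩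
    have h1 := congrArg A.conj ha
    rw [A.conj_del, A.conj_delbar] at h1
    have h2 := A.del_delbar (A.conj a)
    rw [map_neg, map_neg, eq_comm]
    rw [eq_comm, eq_neg_of_add_eq_zero_right h2] at h1
    rw [← h1]
    show A.conj x - A.conj y = A.conj ((x : A.carrier) - y)
    rw [map_sub])
  map_add' := by
    intro x y
    obtain ⟨x, rfl⟩ := A.cls_surjective x
    obtain ⟨y, rfl⟩ := A.cls_surjective y
    show A.cls (A.conjCocycle (x + y)) = A.cls (A.conjCocycle x) + A.cls (A.conjCocycle y)
    rw [← map_add]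
    congr 1
    exact Subtype.ext (map_add A.conj (x : A.carrier) y)
  map_smul' := by
    intro c x
    obtain ⟨x, rfl⟩ := A.cls_surjective x
    show A.cls (A.conjCocycle (c • x)) = (starRingEnd ℂ c) • A.cls (A.conjCocycle x)
    rw [← map_smul]
    congr 1
    exact Subtype.ext (A.conj.map_smulₛₗ c (x : A.carrier))

theorem conjBC_cls (z : A.cocycles) : A.conjBC (A.cls z) = A.cls (A.conjCocycle z) := rfl

/-- The Bott-Chern cohomology `H_BC(A) = (ker ∂ ∩ ker ∂̄) / im ∂∂̄`, as a cbba with real structure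
and with trivial differentials. -/
def bottChern : RCBBA where
  carrier := A.cocycles ⧸ A.coboundaries
  gr i := ((A.gr i).comap A.cocycles.val.toLinearMap).map A.cls.toLinearMap
  isInternal := by
    refine isInternal_subquotient A.isInternal _ _ Subtype.val_injective A.cls_surjective ?_ ?_
    · rintro ⟨p, q⟩ z
      refine ⟨⟨gproj A.isInternal {(p, q)} z, ?_⟩, rfl⟩
      show A.del _ = 0 ∧ A.delbar _ = 0
      rw [← A.gproj_del, ← A.gproj_delbar, A.del_cocycle, A.delbar_cocycle]; simp
    · rintro ⟨p, q⟩ x y hx hy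
      obtain ⟨a, ha⟩ := (A.cls_eq_zero x).1 hx
      refine (A.cls_eq_zero y).2 ⟨gproj A.isInternal {(p - 1, q - 1)} a, ?_⟩
      rw [← A.gproj_delbar, ← A.gproj_del, ha, sub_add_cancel, sub_add_cancel]
      exact hy.symm
  one_mem := ⟨1, A.one_mem, map_one A.cls⟩
  mul_mem := by
    rintro i j _ _ ⟨x, hx, rfl⟩ ⟨y, hy, rfl⟩
    exact ⟨x * y, A.mul_mem hx hy, map_mul A.cls x y⟩
  comm := by
    rintro i j _ _ ⟨x, hx, rfl⟩ ⟨y, hy, rfl⟩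
    have : x * y = (((i.1 + i.2) * (j.1 + j.2)).negOnePow : ℤ) • (y * x) := Subtype.ext (by
      simpa using A.comm hx hy)
    show A.cls x * A.cls y = _ • (A.cls y * A.cls x)
    rw [← map_mul, this, map_zsmul, map_mul]
  del := 0
  delbar := 0
  del_mem _ := zero_mem _
  delbar_mem _ := zero_mem _
  del_del _ := rfl
  delbar_delbar _ := rfl
  del_delbar _ := by simp
  del_leibniz _ _ := by simp
  delbar_leibniz _ _ := by simp
  conj := A.conjBC
  conj_conj := by
    intro x
    obtain ⟨x, rfl⟩ := A.cls_surjective x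
    rw [A.conjBC_cls, A.conjBC_cls]
    congr 1
    exact Subtype.ext (A.conj_conj x)
  conj_one := by
    rw [← map_one A.cls, A.conjBC_cls]
    congr 1
    exact Subtype.ext A.conj_one
  conj_mul := by
    intro x y
    obtain ⟨x, rfl⟩ := A.cls_surjective x
    obtain ⟨y, rfl⟩ := A.cls_surjective y
    rw [← map_mul, A.conjBC_cls, A.conjBC_cls, A.conjBC_cls, ← map_mul]
    congr 1
    exact Subtype.ext (A.conj_mul x y)
  conj_mem := by
    rintro p q _ ⟨x, hx, rfl⟩
    exact ⟨A.conjCocycle x, A.conj_mem hx, rfl⟩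
  conj_d _ := by simp

/-- The submodule `ker ∂∂̄`. -/
def aeppliCocycles : Submodule ℂ A.carrier := LinearMap.ker (A.del ∘ₗ A.delbar)

/-- The Aeppli cohomology `H_A(A) = ker ∂∂̄ / (im ∂ + im ∂̄)`. -/
abbrev Aeppli : Type :=
  A.aeppliCocycles ⧸
    (LinearMap.range A.del ⊔ LinearMap.range A.delbar).comap A.aeppliCocycles.subtype

variable {A}

/-- The map induced by a morphism on `ker ∂ ∩ ker ∂̄`. -/
def Hom.mapCocycles {B : RCBBA} (f : Hom A B) : A.cocycles →ₐ[ℂ] B.cocycles :=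
  (f.toAlgHom.comp A.cocycles.val).codRestrict B.cocycles (fun z => by
    show B.del (f.toAlgHom z) = 0 ∧ B.delbar (f.toAlgHom z) = 0
    rw [← f.map_del, ← f.map_delbar, A.del_cocycle, A.delbar_cocycle]; simp)

/-- The map `H_BC(f)`. -/
def Hom.mapBC {B : RCBBA} (f : Hom A B) :
    A.cocycles ⧸ A.coboundaries →ₐ[ℂ] B.cocycles ⧸ B.coboundaries :=
  Ideal.Quotient.liftₐ A.coboundaries (B.cls.comp f.mapCocycles) (by
    rintro z ⟨a, ha⟩
    refine (B.cls_eq_zero _).2 ⟨f.toAlgHom a, ?_⟩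
    rw [← f.map_delbar, ← f.map_del, ha]
    rfl)

/-- The map `H_A(f)`. -/
def Hom.mapAeppli {B : RCBBA} (f : Hom A B) : A.Aeppli →ₗ[ℂ] B.Aeppli :=
  Submodule.mapQ _ _
    (f.toAlgHom.toLinearMap.restrict (p := A.aeppliCocycles) (q := B.aeppliCocycles) (by
      intro a (ha : A.del (A.delbar a) = 0)
      show B.del (B.delbar (f.toAlgHom a)) = 0
      rw [← f.map_delbar, ← f.map_del, ha, map_zero]))
    (by
      rintro ⟨a, ha'⟩ (ha : a ∈ LinearMap.range A.del ⊔ LinearMap.range A.delbar)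
      show f.toAlgHom a ∈ LinearMap.range B.del ⊔ LinearMap.range B.delbar
      obtain ⟨_, ⟨x, rfl⟩, _, ⟨y, rfl⟩, rfl⟩ := Submodule.mem_sup.1 ha
      rw [map_add, f.map_del, f.map_delbar]
      exact Submodule.add_mem_sup ⟨_, rfl⟩ ⟨_, rfl⟩)

/-- Pluripotential quasi-isomorphisms. -/
def IsPluriQuasiIso {B : RCBBA} (f : A ⟶ B) : Prop :=
  Function.Bijective (Hom.mapBC f) ∧ Function.Bijective (Hom.mapAeppli f)

variable (A)

/-- The `∂∂̄`-property: the map from Bott-Chern cohomology to de Rham cohomology is injective. -/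
def DdbarProperty : Prop :=
  ∀ z : A.cocycles, (∃ a, A.del a + A.delbar a = z) → A.cls z = 0

/-- Strong formality (over `ℝ`): the algebra is connected by a chain of real pluripotential
quasi-isomorphisms to one with trivial differentials. -/
def StronglyFormal : Prop :=
  ∃ B : RCBBA, B.del = 0 ∧ B.delbar = 0 ∧
    Relation.EqvGen (fun X Y : RCBBA => ∃ f : X ⟶ Y, IsPluriQuasiIso f) A B

/-- The real subalgebra of fixed points of the involution. -/
def realPoints : Subalgebra ℝ A.carrier where
  carrier := {a | A.conj a = a}
  mul_mem' := by
    intro a b (ha : A.conj a = a) (hb : A.conj b = b)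
    show A.conj (a * b) = a * b
    rw [A.conj_mul, ha, hb]
  add_mem' := by
    intro a b (ha : A.conj a = a) (hb : A.conj b = b)
    show A.conj (a + b) = a + b
    rw [map_add, ha, hb]
  algebraMap_mem' := by
    intro r
    show A.conj (algebraMap ℝ A.carrier r) = algebraMap ℝ A.carrier r
    rw [Algebra.algebraMap_eq_smul_one, ← Complex.coe_smul, A.conj.map_smulₛₗ, A.conj_one,
      Complex.conj_ofReal]

theorem conj_real (a : A.realPoints) : A.conj a = a := a.2

/-- The component of total degree `n`. -/
def totalGr (n : ℤ) : Submodule ℂ A.carrier :=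
  ⨆ i : {i : ℤ × ℤ // i.1 + i.2 = n}, A.gr i.1

theorem mem_totalGr {i : ℤ × ℤ} {a : A.carrier} (h : a ∈ A.gr i) : a ∈ A.totalGr (i.1 + i.2) :=
  Submodule.mem_iSup_of_mem (p := fun j : {j : ℤ × ℤ // j.1 + j.2 = i.1 + i.2} => A.gr j.1)
    ⟨i, rfl⟩ h

theorem totalGr_induction {n : ℤ} {p : A.carrier → Prop} {x : A.carrier} (hx : x ∈ A.totalGr n)
    (h0 : p 0) (hadd : ∀ x y, p x → p y → p (x + y))
    (hmem : ∀ i : ℤ × ℤ, i.1 + i.2 = n → ∀ x ∈ A.gr i, p x) : p x :=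
  Submodule.iSup_induction _ (motive := p) hx (fun i x hx => hmem i.1 i.2 x hx) h0 hadd

theorem isInternal_totalGr : DirectSum.IsInternal A.totalGr :=
  isInternal_coarsen A.isInternal (fun i => i.1 + i.2)

theorem conj_totalGr {n : ℤ} {a : A.carrier} (ha : a ∈ A.totalGr n) : A.conj a ∈ A.totalGr n := by
  refine A.totalGr_induction (p := fun a => A.conj a ∈ A.totalGr n) ha (by simp)
    (fun x y hx hy => by rw [map_add]; exact add_mem hx hy) ?_
  rintro ⟨p, q⟩ rfl x hx
  have := A.mem_totalGr (A.conj_mem hx)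
  rwa [add_comm] at this

/-- The total differential `∂ + ∂̄` on the fixed points of the involution. -/
def realD : A.realPoints →ₗ[ℝ] A.realPoints :=
  ((A.del + A.delbar).restrictScalars ℝ).restrict (p := Subalgebra.toSubmodule A.realPoints)
    (q := Subalgebra.toSubmodule A.realPoints) (by
    intro a (ha : A.conj a = a)
    show A.conj (A.del a + A.delbar a) = A.del a + A.delbar a
    rw [map_add, A.conj_del, A.conj_delbar, ha, add_comm])

theorem coe_realD (a : A.realPoints) : (A.realD a : A.carrier) = A.del a + A.delbar a := rfl

/-- The cdga `to(A)^{σ = Id}` over `ℝ`: the fixed points of the involution in the total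
complex. -/
def toReal : CDGA ℝ where
  carrier := A.realPoints
  gr n := ((A.totalGr n).restrictScalars ℝ).comap A.realPoints.val.toLinearMap
  isInternal := by
    have hint : DirectSum.IsInternal (fun n => (A.totalGr n).restrictScalars ℝ) :=
      A.isInternal_totalGr
    have h := isInternal_subquotient hint A.realPoints.val.toLinearMap
      LinearMap.id Subtype.val_injective Function.surjective_id (by
        intro n x
        refine ⟨⟨gproj hint {n} x, ?_⟩, rfl⟩
        have := gproj_comm hint A.conj.toAddMonoidHom id (fun _ _ => A.conj_totalGr) {n} {n}
          (fun _ => Iff.rfl) x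
        show A.conj (gproj hint {n} x) = gproj hint {n} x
        refine this.symm.trans ?_
        exact congrArg _ (A.conj_real x)) (by
        intro n x y (hx : x = 0) hy
        refine Subtype.val_injective (hy.trans ?_)
        rw [hx]; simp)
    simpa only [Submodule.map_id] using h
  one_mem := A.mem_totalGr A.one_mem
  mul_mem := by
    intro m n a b (ha : (a : A.carrier) ∈ A.totalGr m) (hb : (b : A.carrier) ∈ A.totalGr n)
    show (a : A.carrier) * b ∈ A.totalGr (m + n)
    refine A.totalGr_induction (p := fun a => a * (b : A.carrier) ∈ A.totalGr (m + n)) ha (by simp)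
      (fun x y hx hy => by rw [add_mul]; exact add_mem hx hy) ?_
    rintro i rfl x hx
    refine A.totalGr_induction (p := fun b => x * b ∈ A.totalGr (i.1 + i.2 + n)) hb (by simp)
      (fun x y hx hy => by rw [mul_add]; exact add_mem hx hy) ?_
    rintro j rfl y hy
    have := A.mem_totalGr (A.mul_mem hx hy)
    rwa [Prod.fst_add, Prod.snd_add, add_add_add_comm] at this
  comm := by
    intro m n a b (ha : (a : A.carrier) ∈ A.totalGr m) (hb : (b : A.carrier) ∈ A.totalGr n)
    apply Subtype.ext
    show (a : A.carrier) * b = ((m * n).negOnePow : ℤ) • ((b : A.carrier) * a)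
    refine A.totalGr_induction (p := fun a => a * (b : A.carrier) =
      ((m * n).negOnePow : ℤ) • ((b : A.carrier) * a)) ha (by simp)
      (fun x y hx hy => by rw [add_mul, mul_add, hx, hy, smul_add]) ?_
    rintro i rfl x hx
    refine A.totalGr_induction (p := fun b => x * b =
      (((i.1 + i.2) * n).negOnePow : ℤ) • (b * x)) hb (by simp)
      (fun y z hy hz => by rw [add_mul y z x, mul_add x y z, hy, hz, smul_add]) ?_
    rintro j rfl y hy
    exact A.comm hx hy
  d := A.realD
  d_mem := by
    intro n a (ha : (a : A.carrier) ∈ A.totalGr n)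
    show A.del a + A.delbar a ∈ A.totalGr (n + 1)
    refine A.totalGr_induction (p := fun a => A.del a + A.delbar a ∈ A.totalGr (n + 1)) ha (by simp)
      (fun x y hx hy => by
        rw [map_add, map_add, add_add_add_comm]; exact add_mem hx hy) ?_
    rintro ⟨p, q⟩ rfl x hx
    have h1 := A.mem_totalGr (A.del_mem hx)
    have h2 := A.mem_totalGr (A.delbar_mem hx)
    simp only at h1 h2 ⊢
    rw [add_right_comm] at h1
    rw [← add_assoc] at h2
    exact add_mem h1 h2
  d_d := by
    intro a
    apply Subtype.ext
    rw [A.coe_realD, A.coe_realD]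
    simp only [map_add, A.del_del, A.delbar_delbar, zero_add, add_zero]
    exact A.del_delbar a
  leibniz := by
    intro m a (ha : (a : A.carrier) ∈ A.totalGr m) b
    apply Subtype.ext
    show A.del ((a : A.carrier) * b) + A.delbar ((a : A.carrier) * b) =
      (A.del a + A.delbar a) * b + (m.negOnePow : ℤ) • ((a : A.carrier) * (A.del b + A.delbar b))
    refine A.totalGr_induction (p := fun a => A.del (a * (b : A.carrier)) +
      A.delbar (a * (b : A.carrier)) = (A.del a + A.delbar a) * b +
        (m.negOnePow : ℤ) • (a * (A.del b + A.delbar b))) ha (by simp) ?_ ?_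
    · intro x y hx hy
      rw [add_mul, map_add, map_add, add_add_add_comm, hx, hy]
      simp only [map_add, add_mul, smul_add]
      abel
    · rintro i rfl x hx
      rw [A.del_leibniz hx, A.delbar_leibniz hx, add_mul, mul_add, smul_add]
      abel

variable {A}

/-- The effect of `to(-)^{σ = Id}` on morphisms. -/
def toRealMap {B : RCBBA} (f : A ⟶ B) : A.toReal ⟶ B.toReal where
  toAlgHom := (((Hom.toAlgHom f).restrictScalars ℝ).comp A.realPoints.val).codRestrict
    B.realPoints (fun (a : A.realPoints) => by
      show B.conj (Hom.toAlgHom f a) = Hom.toAlgHom f a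
      rw [← Hom.map_conj, A.conj_real])
  map_mem := by
    intro n (a : A.realPoints) (ha : (a : A.carrier) ∈ A.totalGr n)
    show Hom.toAlgHom f a ∈ B.totalGr n
    refine A.totalGr_induction (p := fun a => Hom.toAlgHom f a ∈ B.totalGr n) ha (by simp)
      (fun x y hx hy => by rw [map_add]; exact add_mem hx hy) ?_
    rintro i rfl x hx
    exact B.mem_totalGr (Hom.map_mem f hx)
  map_d := by
    intro (a : A.realPoints)
    apply Subtype.ext
    show Hom.toAlgHom f (A.del (a : A.carrier) + A.delbar (a : A.carrier)) =
      B.del (Hom.toAlgHom f (a : A.carrier)) + B.delbar (Hom.toAlgHom f (a : A.carrier))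
    rw [map_add, Hom.map_del, Hom.map_delbar]

end RCBBA

/-! ### Cbba's with rational structure -/

/-- A cbba with rational structure. -/
structure RatCBBA : Type 1 where
  Q : CDGA ℚ
  C : RCBBA
  φ : (CDGA.quasiIso ℝ).Q.obj (Q.extend ℝ) ≅ (CDGA.quasiIso ℝ).Q.obj C.toReal

namespace RatCBBA

/-- A morphism of cbba's with rational structure; the square commutes in `Ho(cdga_ℝ)`. -/
structure Hom (S T : RatCBBA) where
  homQ : S.Q ⟶ T.Q
  homC : S.C ⟶ T.C
  comm : (CDGA.quasiIso ℝ).Q.map (CDGA.extendMap ℝ homQ) ≫ T.φ.hom =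
    S.φ.hom ≫ (CDGA.quasiIso ℝ).Q.map (RCBBA.toRealMap homC)

/-- Quasi-isomorphisms of cbba's with rational structure. -/
def Hom.IsQuasiIso {S T : RatCBBA} (f : Hom S T) : Prop := RCBBA.IsPluriQuasiIso f.homC

variable (T : RatCBBA)

/-- The map `H(A_ℚ ⊗ ℝ) → H(to(A_ℂ)^{σ = Id})` induced by `φ`. -/
def cohMap : ((T.Q.extend ℝ).cocycles ⧸ (T.Q.extend ℝ).coboundaries) →ₗ[ℝ]
    (T.C.toReal.cocycles ⧸ T.C.toReal.coboundaries) :=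
  ((CDGA.hoCoh ℝ).map T.φ.hom).hom

/-- The cocycle `1 ⊗ z` of `A_ℚ ⊗ ℝ`. -/
def extendCocycle (z : T.Q.cocycles) : (T.Q.extend ℝ).cocycles :=
  ⟨(1 : ℝ) ⊗ₜ[ℚ] (z : T.Q.carrier), by
    show T.Q.d.baseChange ℝ _ = 0
    rw [LinearMap.baseChange_tmul, T.Q.d_cocycle, TensorProduct.tmul_zero]⟩

/-- A real element that is `∂`- and `∂̄`-closed, as a cocycle of `to(A_ℂ)^{σ = Id}`. -/
def realCocycle (w : T.C.cocycles) (hw : T.C.conj w = w) : T.C.toReal.cocycles :=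
  ⟨(⟨w, hw⟩ : T.C.realPoints), by
    show T.C.realD ⟨w, hw⟩ = 0
    apply Subtype.ext
    rw [T.C.coe_realD]
    show T.C.del w + T.C.delbar w = 0
    rw [T.C.del_cocycle, T.C.delbar_cocycle, add_zero]⟩

/-- `h` is the map `H(φ)`, where Bott-Chern classes are identified with de Rham classes: the class
`1 ⊗ [z]` goes to a Bott-Chern class `[w]`, with `w` real, whose de Rham class is the image of
`[1 ⊗ z]` under the map induced by `φ`. -/
def IsCohomologyOfPhi (h : T.Q.cohomology.extend ℝ ≅ T.C.bottChern.toReal) : Prop :=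
  ∀ z : T.Q.cocycles, ∃ (w : T.C.cocycles) (hw : T.C.conj w = w),
    T.C.bottChern.realPoints.val (CDGA.Hom.toAlgHom h.hom ((1 : ℝ) ⊗ₜ[ℚ] T.Q.cls z)) = T.C.cls w ∧
    T.cohMap ((T.Q.extend ℝ).cls (T.extendCocycle z)) = T.C.toReal.cls (T.realCocycle w hw)

/-- The cohomology `(H(A_ℚ), H_BC(A_ℂ), h)`, with trivial differentials. -/
def cohomology (h : T.Q.cohomology.extend ℝ ≅ T.C.bottChern.toReal) : RatCBBA where
  Q := T.Q.cohomology
  C := T.C.bottChern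
  φ := (CDGA.quasiIso ℝ).Q.mapIso h

/-- Strong formality over `ℚ` (for `A_ℂ` with the `∂∂̄`-property): there is a chain of
quasi-isomorphisms to the cohomology `(H(A_ℚ), H_BC(A_ℂ), H(φ))`. -/
def StronglyFormalOverQ : Prop :=
  ∃ h : T.Q.cohomology.extend ℝ ≅ T.C.bottChern.toReal, T.IsCohomologyOfPhi h ∧
    Relation.EqvGen (fun X Y : RatCBBA => ∃ f : Hom X Y, f.IsQuasiIso) T (T.cohomology h)

end RatCBBA

/-! ### The cohomology algebra of `ℂP³ # ℂP³ # (S² × S⁴)` -/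

/-- The graded `k`-algebra `H*(ℂP³ # ℂP³ # (S² × S⁴); k)`, with basis `1` in degree `0`,
`α, x, y` in degree `2`, `β, x², y²` in degree `4` and `αβ = x³ = y³` in degree `6`; all other
products of basis elements of positive degree vanish. An element is given by its coordinates. -/
@[ext]
structure SumAlg (k : Type) where
  c1 : k
  cα : k
  cx : k
  cy : k
  cβ : k
  cxx : k
  cyy : k
  ct : k

namespace SumAlg

variable {k : Type} [Field k]

instance : Zero (SumAlg k) := ⟨⟨0, 0, 0, 0, 0, 0, 0, 0⟩⟩
instance : One (SumAlg k) := ⟨⟨1, 0, 0, 0, 0, 0, 0, 0⟩⟩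
instance : Add (SumAlg k) := ⟨fun u v => ⟨u.c1 + v.c1, u.cα + v.cα, u.cx + v.cx, u.cy + v.cy,
  u.cβ + v.cβ, u.cxx + v.cxx, u.cyy + v.cyy, u.ct + v.ct⟩⟩
instance : Neg (SumAlg k) :=
  ⟨fun u => ⟨-u.c1, -u.cα, -u.cx, -u.cy, -u.cβ, -u.cxx, -u.cyy, -u.ct⟩⟩
instance : SMul k (SumAlg k) := ⟨fun r u => ⟨r * u.c1, r * u.cα, r * u.cx, r * u.cy,
  r * u.cβ, r * u.cxx, r * u.cyy, r * u.ct⟩⟩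
instance : Mul (SumAlg k) := ⟨fun u v =>
  { c1 := u.c1 * v.c1
    cα := u.c1 * v.cα + u.cα * v.c1
    cx := u.c1 * v.cx + u.cx * v.c1
    cy := u.c1 * v.cy + u.cy * v.c1
    cβ := u.c1 * v.cβ + u.cβ * v.c1
    cxx := u.c1 * v.cxx + u.cxx * v.c1 + u.cx * v.cx
    cyy := u.c1 * v.cyy + u.cyy * v.c1 + u.cy * v.cy
    ct := u.c1 * v.ct + u.ct * v.c1 + (u.cα * v.cβ + u.cβ * v.cα) +
      (u.cx * v.cxx + u.cxx * v.cx) + (u.cy * v.cyy + u.cyy * v.cy) }⟩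

section
variable (u v : SumAlg k) (r : k)
@[simp] theorem zero_c1 : (0 : SumAlg k).c1 = 0 := rfl
@[simp] theorem zero_cα : (0 : SumAlg k).cα = 0 := rfl
@[simp] theorem zero_cx : (0 : SumAlg k).cx = 0 := rfl
@[simp] theorem zero_cy : (0 : SumAlg k).cy = 0 := rfl
@[simp] theorem zero_cβ : (0 : SumAlg k).cβ = 0 := rfl
@[simp] theorem zero_cxx : (0 : SumAlg k).cxx = 0 := rfl
@[simp] theorem zero_cyy : (0 : SumAlg k).cyy = 0 := rfl
@[simp] theorem zero_ct : (0 : SumAlg k).ct = 0 := rfl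
@[simp] theorem one_c1 : (1 : SumAlg k).c1 = 1 := rfl
@[simp] theorem one_cα : (1 : SumAlg k).cα = 0 := rfl
@[simp] theorem one_cx : (1 : SumAlg k).cx = 0 := rfl
@[simp] theorem one_cy : (1 : SumAlg k).cy = 0 := rfl
@[simp] theorem one_cβ : (1 : SumAlg k).cβ = 0 := rfl
@[simp] theorem one_cxx : (1 : SumAlg k).cxx = 0 := rfl
@[simp] theorem one_cyy : (1 : SumAlg k).cyy = 0 := rfl
@[simp] theorem one_ct : (1 : SumAlg k).ct = 0 := rfl
@[simp] theorem add_c1 : (u + v).c1 = u.c1 + v.c1 := rfl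
@[simp] theorem add_cα : (u + v).cα = u.cα + v.cα := rfl
@[simp] theorem add_cx : (u + v).cx = u.cx + v.cx := rfl
@[simp] theorem add_cy : (u + v).cy = u.cy + v.cy := rfl
@[simp] theorem add_cβ : (u + v).cβ = u.cβ + v.cβ := rfl
@[simp] theorem add_cxx : (u + v).cxx = u.cxx + v.cxx := rfl
@[simp] theorem add_cyy : (u + v).cyy = u.cyy + v.cyy := rfl
@[simp] theorem add_ct : (u + v).ct = u.ct + v.ct := rfl
@[simp] theorem neg_c1 : (-u).c1 = -u.c1 := rfl
@[simp] theorem neg_cα : (-u).cα = -u.cα := rfl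
@[simp] theorem neg_cx : (-u).cx = -u.cx := rfl
@[simp] theorem neg_cy : (-u).cy = -u.cy := rfl
@[simp] theorem neg_cβ : (-u).cβ = -u.cβ := rfl
@[simp] theorem neg_cxx : (-u).cxx = -u.cxx := rfl
@[simp] theorem neg_cyy : (-u).cyy = -u.cyy := rfl
@[simp] theorem neg_ct : (-u).ct = -u.ct := rfl
@[simp] theorem smul_c1 : (r • u).c1 = r * u.c1 := rfl
@[simp] theorem smul_cα : (r • u).cα = r * u.cα := rfl
@[simp] theorem smul_cx : (r • u).cx = r * u.cx := rfl
@[simp] theorem smul_cy : (r • u).cy = r * u.cy := rfl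
@[simp] theorem smul_cβ : (r • u).cβ = r * u.cβ := rfl
@[simp] theorem smul_cxx : (r • u).cxx = r * u.cxx := rfl
@[simp] theorem smul_cyy : (r • u).cyy = r * u.cyy := rfl
@[simp] theorem smul_ct : (r • u).ct = r * u.ct := rfl
@[simp] theorem mul_c1 : (u * v).c1 = u.c1 * v.c1 := rfl
@[simp] theorem mul_cα : (u * v).cα = u.c1 * v.cα + u.cα * v.c1 := rfl
@[simp] theorem mul_cx : (u * v).cx = u.c1 * v.cx + u.cx * v.c1 := rfl
@[simp] theorem mul_cy : (u * v).cy = u.c1 * v.cy + u.cy * v.c1 := rfl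
@[simp] theorem mul_cβ : (u * v).cβ = u.c1 * v.cβ + u.cβ * v.c1 := rfl
@[simp] theorem mul_cxx : (u * v).cxx = u.c1 * v.cxx + u.cxx * v.c1 + u.cx * v.cx := rfl
@[simp] theorem mul_cyy : (u * v).cyy = u.c1 * v.cyy + u.cyy * v.c1 + u.cy * v.cy := rfl
@[simp] theorem mul_ct : (u * v).ct = u.c1 * v.ct + u.ct * v.c1 + (u.cα * v.cβ + u.cβ * v.cα) +
    (u.cx * v.cxx + u.cxx * v.cx) + (u.cy * v.cyy + u.cyy * v.cy) := rfl
end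

instance : CommRing (SumAlg k) where
  add_assoc _ _ _ := by ext <;> simp <;> ring
  zero_add _ := by ext <;> simp
  add_zero _ := by ext <;> simp
  add_comm _ _ := by ext <;> simp <;> ring
  left_distrib _ _ _ := by ext <;> simp <;> ring
  right_distrib _ _ _ := by ext <;> simp <;> ring
  zero_mul _ := by ext <;> simp
  mul_zero _ := by ext <;> simp
  mul_assoc _ _ _ := by ext <;> simp <;> ring
  one_mul _ := by ext <;> simp
  mul_one _ := by ext <;> simp
  mul_comm _ _ := by ext <;> simp <;> ring
  neg_add_cancel _ := by ext <;> simp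
  nsmul := nsmulRec
  zsmul := zsmulRec

instance : Module k (SumAlg k) where
  one_smul _ := by ext <;> simp
  mul_smul _ _ _ := by ext <;> simp <;> ring
  smul_zero _ := by ext <;> simp
  smul_add _ _ _ := by ext <;> simp <;> ring
  add_smul _ _ _ := by ext <;> simp <;> ring
  zero_smul _ := by ext <;> simp

instance : Algebra k (SumAlg k) := Algebra.ofModule
  (fun _ _ _ => by ext <;> simp <;> ring) (fun _ _ _ => by ext <;> simp <;> ring)

/-- The class `α` of degree `2`, coming from `S²`. -/
def gα : SumAlg k := ⟨0, 1, 0, 0, 0, 0, 0, 0⟩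
/-- The class `x` of degree `2`, coming from the first `ℂP³`. -/
def gx : SumAlg k := ⟨0, 0, 1, 0, 0, 0, 0, 0⟩
/-- The class `y` of degree `2`, coming from the second `ℂP³`. -/
def gy : SumAlg k := ⟨0, 0, 0, 1, 0, 0, 0, 0⟩
/-- The class `β` of degree `4`, coming from `S⁴`. -/
def gβ : SumAlg k := ⟨0, 0, 0, 0, 1, 0, 0, 0⟩

/-- The component of index `i`, when the part of cohomological degree `2n` has index `w n`. -/
def gr {ι : Type} (w : ℤ → ι) (i : ι) : Submodule k (SumAlg k) where
  carrier := {u | (i ≠ w 0 → u.c1 = 0) ∧ (i ≠ w 1 → u.cα = 0 ∧ u.cx = 0 ∧ u.cy = 0) ∧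
    (i ≠ w 2 → u.cβ = 0 ∧ u.cxx = 0 ∧ u.cyy = 0) ∧ (i ≠ w 3 → u.ct = 0)}
  zero_mem' := by simp
  add_mem' := by
    rintro u v ⟨h0, h1, h2, h3⟩ ⟨h0', h1', h2', h3'⟩
    refine ⟨fun h => ?_, fun h => ?_, fun h => ?_, fun h => ?_⟩
    · simp [h0 h, h0' h]
    · simp [h1 h, h1' h]
    · simp [h2 h, h2' h]
    · simp [h3 h, h3' h]
  smul_mem' := by
    rintro r u ⟨h0, h1, h2, h3⟩
    refine ⟨fun h => ?_, fun h => ?_, fun h => ?_, fun h => ?_⟩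
    · simp [h0 h]
    · simp [h1 h]
    · simp [h2 h]
    · simp [h3 h]

open Classical in
/-- The projection to the component of index `i`. -/
def proj {ι : Type} (w : ℤ → ι) (i : ι) : SumAlg k →ₗ[k] SumAlg k where
  toFun u :=
    { c1 := if i = w 0 then u.c1 else 0
      cα := if i = w 1 then u.cα else 0
      cx := if i = w 1 then u.cx else 0
      cy := if i = w 1 then u.cy else 0
      cβ := if i = w 2 then u.cβ else 0
      cxx := if i = w 2 then u.cxx else 0
      cyy := if i = w 2 then u.cyy else 0
      ct := if i = w 3 then u.ct else 0 }
  map_add' u v := by ext <;> simp <;> split_ifs <;> simp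
  map_smul' r u := by ext <;> simp

theorem isInternal_gr {ι : Type} [DecidableEq ι] (w : ℤ → ι) :
    DirectSum.IsInternal (gr (k := k) w) := by
  refine isInternal_of_proj (proj w) ?_ ?_ ?_
  · rintro i u ⟨h0, h1, h2, h3⟩
    ext <;> simp only [proj, LinearMap.coe_mk, AddHom.coe_mk] <;> split_ifs with h
    · rfl
    · exact (h0 h).symm
    · rfl
    · exact (h1 h).1.symm
    · rfl
    · exact (h1 h).2.1.symm
    · rfl
    · exact (h1 h).2.2.symm
    · rfl
    · exact (h2 h).1.symm
    · rfl
    · exact (h2 h).2.1.symm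
    · rfl
    · exact (h2 h).2.2.symm
    · rfl
    · exact (h3 h).symm
  · rintro i j hij u ⟨h0, h1, h2, h3⟩
    ext <;> simp only [proj, LinearMap.coe_mk, AddHom.coe_mk] <;> split_ifs with h <;>
      first
        | rfl
        | exact h0 (fun h' => hij (h.trans h'.symm))
        | exact h3 (fun h' => hij (h.trans h'.symm))
        | exact (h1 (fun h' => hij (h.trans h'.symm))).1
        | exact (h1 (fun h' => hij (h.trans h'.symm))).2.1
        | exact (h1 (fun h' => hij (h.trans h'.symm))).2.2
        | exact (h2 (fun h' => hij (h.trans h'.symm))).1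
        | exact (h2 (fun h' => hij (h.trans h'.symm))).2.1
        | exact (h2 (fun h' => hij (h.trans h'.symm))).2.2
  · intro u
    have hdec : u = (⟨u.c1, 0, 0, 0, 0, 0, 0, 0⟩ : SumAlg k) + ⟨0, u.cα, u.cx, u.cy, 0, 0, 0, 0⟩ +
        ⟨0, 0, 0, 0, u.cβ, u.cxx, u.cyy, 0⟩ + ⟨0, 0, 0, 0, 0, 0, 0, u.ct⟩ := by
      ext <;> simp
    rw [hdec]
    refine add_mem (add_mem (add_mem ?_ ?_) ?_) ?_
    · exact Submodule.mem_iSup_of_mem (w 0) (by simp [gr])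
    · exact Submodule.mem_iSup_of_mem (w 1) (by simp [gr])
    · exact Submodule.mem_iSup_of_mem (w 2) (by simp [gr])
    · exact Submodule.mem_iSup_of_mem (w 3) (by simp [gr])

theorem mul_aux {ι : Type} [Add ι] {i j s t r : ι} {a b : k} (ha : i ≠ s → a = 0)
    (hb : j ≠ t → b = 0) (hr : s + t = r) (h : i + j ≠ r) : a * b = 0 := by
  by_cases h1 : i = s
  · by_cases h2 : j = t
    · exact absurd (by rw [h1, h2, hr]) h
    · rw [hb h2, mul_zero]
  · rw [ha h1, zero_mul]

theorem mul_mem_gr {ι : Type} [Add ι] {w : ℤ → ι} (hw : ∀ m n, w m + w n = w (m + n))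
    {i j : ι} {u v : SumAlg k} (hu : u ∈ gr w i) (hv : v ∈ gr w j) : u * v ∈ gr w (i + j) := by
  obtain ⟨h0, h1, h2, h3⟩ := hu
  obtain ⟨k0, k1, k2, k3⟩ := hv
  refine ⟨fun h => ?_, fun h => ⟨?_, ?_, ?_⟩, fun h => ⟨?_, ?_, ?_⟩, fun h => ?_⟩
  · rw [mul_c1, mul_aux h0 k0 (hw 0 0) h]
  · rw [mul_cα, mul_aux h0 (fun h => (k1 h).1) (hw 0 1) h,
      mul_aux (fun h => (h1 h).1) k0 (hw 1 0) h, add_zero]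
  · rw [mul_cx, mul_aux h0 (fun h => (k1 h).2.1) (hw 0 1) h,
      mul_aux (fun h => (h1 h).2.1) k0 (hw 1 0) h, add_zero]
  · rw [mul_cy, mul_aux h0 (fun h => (k1 h).2.2) (hw 0 1) h,
      mul_aux (fun h => (h1 h).2.2) k0 (hw 1 0) h, add_zero]
  · rw [mul_cβ, mul_aux h0 (fun h => (k2 h).1) (hw 0 2) h,
      mul_aux (fun h => (h2 h).1) k0 (hw 2 0) h, add_zero]
  · rw [mul_cxx, mul_aux h0 (fun h => (k2 h).2.1) (hw 0 2) h,
      mul_aux (fun h => (h2 h).2.1) k0 (hw 2 0) h,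
      mul_aux (fun h => (h1 h).2.1) (fun h => (k1 h).2.1) (hw 1 1) h, add_zero, add_zero]
  · rw [mul_cyy, mul_aux h0 (fun h => (k2 h).2.2) (hw 0 2) h,
      mul_aux (fun h => (h2 h).2.2) k0 (hw 2 0) h,
      mul_aux (fun h => (h1 h).2.2) (fun h => (k1 h).2.2) (hw 1 1) h, add_zero, add_zero]
  · rw [mul_ct, mul_aux h0 k3 (hw 0 3) h, mul_aux h3 k0 (hw 3 0) h,
      mul_aux (fun h => (h1 h).1) (fun h => (k2 h).1) (hw 1 2) h,
      mul_aux (fun h => (h2 h).1) (fun h => (k1 h).1) (hw 2 1) h,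
      mul_aux (fun h => (h1 h).2.1) (fun h => (k2 h).2.1) (hw 1 2) h,
      mul_aux (fun h => (h2 h).2.1) (fun h => (k1 h).2.1) (hw 2 1) h,
      mul_aux (fun h => (h1 h).2.2) (fun h => (k2 h).2.2) (hw 1 2) h,
      mul_aux (fun h => (h2 h).2.2) (fun h => (k1 h).2.2) (hw 2 1) h]
    simp

theorem eq_zero_of_mem_gr {ι : Type} {w : ℤ → ι} {i : ι} (hi : ∀ n, i ≠ w n) {u : SumAlg k}
    (hu : u ∈ gr w i) : u = 0 := by
  obtain ⟨h0, h1, h2, h3⟩ := hu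
  ext
  · exact h0 (hi 0)
  · exact (h1 (hi 1)).1
  · exact (h1 (hi 1)).2.1
  · exact (h1 (hi 1)).2.2
  · exact (h2 (hi 2)).1
  · exact (h2 (hi 2)).2.1
  · exact (h2 (hi 2)).2.2
  · exact h3 (hi 3)

theorem comm_gr {ι : Type} {w : ℤ → ι} {i : ι} {u : SumAlg k} (hu : u ∈ gr w i) {s : ℤ} (t : ℤ)
    (hs : ∀ n, i = w n → Even s) (v : SumAlg k) : u * v = ((s * t).negOnePow : ℤ) • (v * u) := by
  by_cases h : ∃ n, i = w n
  · obtain ⟨n, hn⟩ := h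
    rw [Int.negOnePow_even _ ((hs n hn).mul_right t), mul_comm v u]
    simp
  · rw [eq_zero_of_mem_gr (fun n hn => h ⟨n, hn⟩) hu]
    simp

/-- Coordinatewise complex conjugation on `H ⊗ ℂ`. -/
def conj : SumAlg ℂ →ₛₗ[starRingEnd ℂ] SumAlg ℂ where
  toFun u := ⟨starRingEnd ℂ u.c1, starRingEnd ℂ u.cα, starRingEnd ℂ u.cx, starRingEnd ℂ u.cy,
    starRingEnd ℂ u.cβ, starRingEnd ℂ u.cxx, starRingEnd ℂ u.cyy, starRingEnd ℂ u.ct⟩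
  map_add' u v := by ext1 <;> simp
  map_smul' r u := by ext1 <;> simp

end SumAlg

/-- The rational cdga `A_ℚ = (H, 0)`. -/
def algQ : CDGA ℚ where
  carrier := SumAlg ℚ
  gr := SumAlg.gr (fun n => 2 * n)
  isInternal := SumAlg.isInternal_gr _
  one_mem := by simp [SumAlg.gr]
  mul_mem := SumAlg.mul_mem_gr (fun m n => (mul_add 2 m n).symm)
  comm := fun {m n a b} ha _ => SumAlg.comm_gr ha n (fun l hl => ⟨l, by rw [hl]; ring⟩) b
  d := 0
  d_mem _ := zero_mem _
  d_d _ := rfl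
  leibniz _ _ := by simp

/-- The cbba `A_ℂ = (H ⊗ ℂ, 0, 0)` with real structure, where `H²ᵏ ⊗ ℂ` has type `(k, k)`. -/
def algC : RCBBA where
  carrier := SumAlg ℂ
  gr := SumAlg.gr (fun n => (n, n))
  isInternal := SumAlg.isInternal_gr _
  one_mem := by simp [SumAlg.gr]
  mul_mem := SumAlg.mul_mem_gr (fun _ _ => rfl)
  comm := fun {_ _ _ b} ha _ => SumAlg.comm_gr ha _ (fun l hl => ⟨l, by rw [hl]⟩) b
  del := 0
  delbar := 0
  del_mem _ := zero_mem _
  delbar_mem _ := zero_mem _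
  del_del _ := rfl
  delbar_delbar _ := rfl
  del_delbar _ := by simp
  del_leibniz _ _ := by simp
  delbar_leibniz _ _ := by simp
  conj := SumAlg.conj
  conj_conj _ := by ext1 <;> simp [SumAlg.conj]
  conj_one := by ext1 <;> simp [SumAlg.conj]
  conj_mul _ _ := by ext1 <;> simp [SumAlg.conj]
  conj_mem := by
    rintro p q u ⟨h0, h1, h2, h3⟩
    have hs : ∀ n : ℤ, ((q, p) : ℤ × ℤ) ≠ (n, n) → ((p, q) : ℤ × ℤ) ≠ (n, n) := by
      intro n h h'
      simp only [Prod.mk.injEq] at h'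
      exact h (by rw [h'.1, h'.2])
    refine ⟨fun h => ?_, fun h => ?_, fun h => ?_, fun h => ?_⟩
    · simp [SumAlg.conj, h0 (hs _ h)]
    · simp [SumAlg.conj, h1 (hs _ h)]
    · simp [SumAlg.conj, h2 (hs _ h)]
    · simp [SumAlg.conj, h3 (hs _ h)]
  conj_d _ := by simp

/-! ### The family `A_λ` -/

/-- Elements of a model `φ : M → (H, 0)` of `H` with the differentials and the images in `H` of the
generators of degree at most `4` of the minimal model. (The elements `a, b, c, e` of degree `3` are
mapped to `0`, because `H³ = 0`.) -/
structure ModelGenerators (M : CDGA ℚ) (φ : M ⟶ algQ) where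
  (α x y a b c e β p₁ p₂ p₃ p₄ : M.carrier)
  α_mem : α ∈ M.gr 2
  x_mem : x ∈ M.gr 2
  y_mem : y ∈ M.gr 2
  a_mem : a ∈ M.gr 3
  b_mem : b ∈ M.gr 3
  c_mem : c ∈ M.gr 3
  e_mem : e ∈ M.gr 3
  β_mem : β ∈ M.gr 4
  p₁_mem : p₁ ∈ M.gr 4
  p₂_mem : p₂ ∈ M.gr 4
  p₃_mem : p₃ ∈ M.gr 4
  p₄_mem : p₄ ∈ M.gr 4
  d_α : M.d α = 0
  d_x : M.d x = 0
  d_y : M.d y = 0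
  d_a : M.d a = α * α
  d_b : M.d b = x * α
  d_c : M.d c = y * α
  d_e : M.d e = x * y
  d_β : M.d β = 0
  d_p₁ : M.d p₁ = x * a - α * b
  d_p₂ : M.d p₂ = y * a - α * c
  d_p₃ : M.d p₃ = y * b - α * e
  d_p₄ : M.d p₄ = x * c - α * e
  φ_α : CDGA.Hom.toAlgHom φ α = SumAlg.gα
  φ_x : CDGA.Hom.toAlgHom φ x = SumAlg.gx
  φ_y : CDGA.Hom.toAlgHom φ y = SumAlg.gy
  φ_β : CDGA.Hom.toAlgHom φ β = SumAlg.gβ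
  φ_p₁ : CDGA.Hom.toAlgHom φ p₁ = (0 : SumAlg ℚ)
  φ_p₂ : CDGA.Hom.toAlgHom φ p₂ = (0 : SumAlg ℚ)
  φ_p₃ : CDGA.Hom.toAlgHom φ p₃ = (0 : SumAlg ℚ)
  φ_p₄ : CDGA.Hom.toAlgHom φ p₄ = (0 : SumAlg ℚ)

/-- The value of `ψ : M ⊗ ℝ → to(A_ℂ)^{σ = Id} = H ⊗ ℝ` on `1 ⊗ m`, as an element of `H ⊗ ℂ`. -/
def psiValue {M : CDGA ℚ} (ψ : M.extend ℝ ⟶ algC.toReal) (m : M.carrier) : SumAlg ℂ :=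
  algC.realPoints.val (CDGA.Hom.toAlgHom ψ ((1 : ℝ) ⊗ₜ[ℚ] m))

/-- `ψ` is `φ + λξ` on the generators of degree at most `4`, where `ξ` vanishes on `α, x, y, β` and
`a, b, c, e`, and `ξ(p₁) = -y²`, `ξ(p₂) = -x²`, `ξ(p₃) = ξ(p₄) = β`. -/
structure ModelGenerators.IsPsi {M : CDGA ℚ} {φ : M ⟶ algQ} (g : ModelGenerators M φ) (l : ℝ)
    (ψ : M.extend ℝ ⟶ algC.toReal) : Prop where
  ψ_α : psiValue ψ g.α = SumAlg.gα
  ψ_x : psiValue ψ g.x = SumAlg.gx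
  ψ_y : psiValue ψ g.y = SumAlg.gy
  ψ_β : psiValue ψ g.β = SumAlg.gβ
  ψ_p₁ : psiValue ψ g.p₁ = -((l : ℂ) • (SumAlg.gy * SumAlg.gy))
  ψ_p₂ : psiValue ψ g.p₂ = -((l : ℂ) • (SumAlg.gx * SumAlg.gx))
  ψ_p₃ : psiValue ψ g.p₃ = (l : ℂ) • SumAlg.gβ
  ψ_p₄ : psiValue ψ g.p₄ = (l : ℂ) • SumAlg.gβ

/-- The cbba with rational structure `(H, H ⊗ ℂ, ε)`, where `ε` is represented by the roof
`H ⊗ ℝ ← M ⊗ ℝ → to(H ⊗ ℂ)^{σ = Id}` of `φ ⊗ ℝ` and `ψ`. -/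
def roofTriple {M : CDGA ℚ} (φ : M ⟶ algQ) (ψ : M.extend ℝ ⟶ algC.toReal)
    (hφ : CDGA.quasiIso ℝ (CDGA.extendMap ℝ φ)) (hψ : CDGA.quasiIso ℝ ψ) : RatCBBA where
  Q := algQ
  C := algC
  φ := (CDGA.hoIso (CDGA.extendMap ℝ φ) hφ).symm ≪≫ CDGA.hoIso ψ hψ

end

/-!
The obstruction to strong formality over `ℚ` is a refinement of the triple Massey product
`⟨α, x, y⟩`. A `CDGA.MasseySystem` records all choices made in forming such a product, including a
primitive `p` of the Massey cocycle `yb - αe`; homotopies of systems are given by `CDGA.Gauge`.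
Quasi-isomorphisms induce bijections of homotopy classes of systems
(`CDGA.MasseySystem.exists_lift`, `CDGA.MasseySystem.equiv_of_map_equiv`), so these classes form a
functor `CDGA.hoMassey` on the homotopy category, and the comparison isomorphism of a cbba with
rational structure transports rational systems to systems of the complex part.

If the complex part has the `∂∂̄`-property, the operator `dᶜ` singles out systems there: the
canonical ones, whose cocycles are `dᶜ`-closed and whose primitives are `dᶜ`-exact. By the
`ddᶜ`-lemma there is one for given classes of the cocycles as soon as there is any system
(`RCBBA.exists_isCanonical`), it is unique up to homotopy (`RCBBA.IsCanonical.equiv`), and real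
morphisms preserve canonical systems. Hence the condition that the classes of every rational
system are those of a rational system which is carried to a canonical one
(`RatCBBA.HasRationalCanonicalSystems`) is invariant under quasi-isomorphisms of cbba's with
rational structure. It holds for cohomology, where all primitives can be taken to be zero.

It fails for `A_λ` with `λ` irrational. The canonical system of `H ⊗ ℂ` on `(α, x, y)` has `p = 0`.
A rational system on `(α, x, y)` has some `t ∈ H⁴` as its last component; in `M` it lifts to a
system with last component `p₃` plus a lift of `t`, which `ψ_λ` maps to `λβ + t`. A homotopy in
`H ⊗ ℝ` does not change the coefficient of `β`, because `β` is indecomposable and the differential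
is zero. So a homotopy to the canonical system would give `λ = -t_β`, with `t_β` the rational
coefficient of `β` in `t`.

For the existence of `M` and of all `ψ_λ` the minimal model is replaced by the quotient
`sumModel`, of dimension `26`, in which `ψ_λ = φ + λξ` can be written down.
-/

noncomputable section

/-! ### Cocycles and quasi-isomorphisms of cdga's -/

namespace CDGA

variable {k : Type} [Field k] {A B : CDGA k}

theorem mul_comm_of_even {n : ℤ} (hn : Even n) {a : A.carrier} (ha : a ∈ A.gr n)
    (b : A.carrier) : a * b = b * a := by
  refine graded_induction A.isInternal (p := fun b => a * b = b * a) b ?_ (by simp)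
    (fun x y hx hy => by rw [mul_add, add_mul, hx, hy])
  intro m x hx
  rw [A.comm ha hx, Int.negOnePow_even _ (hn.mul_right m)]
  simp

theorem mul_comm_of_odd {m n : ℤ} (hm : Odd m) (hn : Odd n) {a b : A.carrier} (ha : a ∈ A.gr m)
    (hb : b ∈ A.gr n) : a * b = -(b * a) := by
  rw [A.comm ha hb, Int.negOnePow_odd _ (hm.mul hn)]
  simp

theorem leibniz_of_even {n : ℤ} (hn : Even n) {a : A.carrier} (ha : a ∈ A.gr n)
    (b : A.carrier) : A.d (a * b) = A.d a * b + a * A.d b := by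
  rw [A.leibniz ha, Int.negOnePow_even _ hn]
  simp

theorem leibniz_of_odd {n : ℤ} (hn : Odd n) {a : A.carrier} (ha : a ∈ A.gr n)
    (b : A.carrier) : A.d (a * b) = A.d a * b - a * A.d b := by
  rw [A.leibniz ha, Int.negOnePow_odd _ hn]
  simp [sub_eq_add_neg]

theorem mul_mem' {m n l : ℤ} (h : m + n = l) {a b : A.carrier} (ha : a ∈ A.gr m)
    (hb : b ∈ A.gr n) : a * b ∈ A.gr l := h ▸ A.mul_mem ha hb

theorem d_mem' {m n : ℤ} (h : m + 1 = n) {a : A.carrier} (ha : a ∈ A.gr m) :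
    A.d a ∈ A.gr n := h ▸ A.d_mem ha

theorem gproj_of_mem_self {n : ℤ} {a : A.carrier} (ha : a ∈ A.gr n) :
    gproj A.isInternal {n} a = a := by
  rw [gproj_of_mem A.isInternal _ ha, if_pos (Set.mem_singleton n)]

theorem exists_homogeneous_primitive {m n : ℤ} (h : n + 1 = m) {a : A.carrier}
    (ha : A.d a ∈ A.gr m) : ∃ a' ∈ A.gr n, A.d a' = A.d a := by
  subst h
  refine ⟨gproj A.isInternal {n} a, gproj_mem A.isInternal n a, ?_⟩
  rw [← A.gproj_d, gproj_of_mem_self ha]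

/-- A quasi-isomorphism in terms of elements. -/
theorem quasiIso_iff (f : A ⟶ B) : quasiIso k f ↔
    (∀ z, A.d z = 0 → (∃ y, B.d y = Hom.toAlgHom f z) → ∃ a, A.d a = z) ∧
    (∀ w, B.d w = 0 → ∃ z, A.d z = 0 ∧ ∃ y, B.d y = Hom.toAlgHom f z - w) := by
  constructor
  · rintro ⟨hi, hs⟩
    constructor
    · rintro z hz ⟨y, hy⟩
      refine (A.cls_eq_zero ⟨z, hz⟩).1 (hi ?_)
      rw [map_zero, Hom.mapCohomology_cls]
      exact (B.cls_eq_zero _).2 ⟨y, hy⟩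
    · intro w hw
      obtain ⟨c, hc⟩ := hs (B.cls ⟨w, hw⟩)
      obtain ⟨z, rfl⟩ := A.cls_surjective c
      refine ⟨z, z.2, ?_⟩
      rw [Hom.mapCohomology_cls, ← sub_eq_zero, ← map_sub] at hc
      exact (B.cls_eq_zero _).1 hc
  · rintro ⟨h1, h2⟩
    constructor
    · rw [injective_iff_map_eq_zero]
      intro c hc
      obtain ⟨z, rfl⟩ := A.cls_surjective c
      rw [Hom.mapCohomology_cls] at hc
      exact (A.cls_eq_zero _).2 (h1 z z.2 ((B.cls_eq_zero _).1 hc))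
    · intro c
      obtain ⟨w, rfl⟩ := B.cls_surjective c
      obtain ⟨z, hz, y, hy⟩ := h2 w w.2
      refine ⟨A.cls ⟨z, hz⟩, ?_⟩
      rw [Hom.mapCohomology_cls, ← sub_eq_zero, ← map_sub]
      exact (B.cls_eq_zero _).2 ⟨y, hy⟩

/-- Relative lifting along a quasi-isomorphism `f`: if `f z` has the primitive `t`, then `z` has a
primitive whose image is `t` up to a coboundary. -/
theorem exists_lift_primitive {f : A ⟶ B} (hf : quasiIso k f) {l n m : ℤ} (hl : l + 1 = n)
    (hm : n + 1 = m) {z : A.carrier} (hz : z ∈ A.gr m) (hdz : A.d z = 0) {t : B.carrier}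
    (ht : t ∈ B.gr n) (hdt : B.d t = Hom.toAlgHom f z) :
    ∃ a ∈ A.gr n, A.d a = z ∧ ∃ v ∈ B.gr l, Hom.toAlgHom f a = t + B.d v := by
  obtain ⟨h1, h2⟩ := (quasiIso_iff f).1 hf
  obtain ⟨a₀, ha₀⟩ := h1 z hdz ⟨t, hdt⟩
  obtain ⟨a₁, ha₁, h₁⟩ := exists_homogeneous_primitive (a := a₀) hm (by rwa [ha₀])
  rw [ha₀] at h₁
  obtain ⟨c, hc, y, hy⟩ := h2 (Hom.toAlgHom f a₁ - t) (by
    rw [map_sub, ← Hom.map_d, h₁, hdt, sub_self])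
  -- the component of degree `n` of the correction `c`
  have hcn : A.d (gproj A.isInternal {n} c) = 0 := by rw [← A.gproj_d, hc, map_zero]
  have hfc : Hom.toAlgHom f (gproj A.isInternal {n} c) =
      gproj B.isInternal {n} (Hom.toAlgHom f c) := by
    refine graded_induction A.isInternal (p := fun c => Hom.toAlgHom f (gproj A.isInternal {n} c) =
      gproj B.isInternal {n} (Hom.toAlgHom f c)) c ?_ (by simp)
      (fun x y hx hy => by simp only [map_add, hx, hy])
    intro i x hx
    rw [gproj_of_mem _ _ hx, gproj_of_mem _ _ (Hom.map_mem f hx)]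
    split_ifs <;> simp
  refine ⟨a₁ - gproj A.isInternal {n} c, sub_mem ha₁ (gproj_mem _ _ _), by
    rw [map_sub, hcn, h₁, sub_zero], -gproj B.isInternal {l} y, neg_mem (gproj_mem _ _ _), ?_⟩
  rw [map_neg, ← B.gproj_d, hl, hy, map_sub, map_sub, map_sub, hfc,
    gproj_of_mem_self (Hom.map_mem f ha₁), gproj_of_mem_self ht]
  abel

/-! ### Quasi-isomorphisms and extension of scalars -/

section BaseChange

variable (K : Type) [Field K] [Algebra k K]

/-- A linear form on `K` contracts `K ⊗ A` to `A`. -/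
def contract (l : K →ₗ[k] k) (A : CDGA k) : K ⊗[k] A.carrier →ₗ[k] A.carrier :=
  (TensorProduct.lid k A.carrier).toLinearMap ∘ₗ TensorProduct.map l LinearMap.id

theorem contract_tmul (l : K →ₗ[k] k) (c : K) (a : A.carrier) :
    contract K l A (c ⊗ₜ[k] a) = l c • a := by
  simp [contract]

theorem contract_d (l : K →ₗ[k] k) (a : K ⊗[k] A.carrier) :
    contract K l A (A.d.baseChange K a) = A.d (contract K l A a) := by
  induction a with
  | zero => simp
  | add x y hx hy => simp only [map_add, hx, hy]
  | tmul c a => rw [LinearMap.baseChange_tmul, contract_tmul, contract_tmul, map_smul]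

theorem contract_extendMap (l : K →ₗ[k] k) (f : A ⟶ B) (a : K ⊗[k] A.carrier) :
    contract K l B (Algebra.TensorProduct.map (AlgHom.id K K) (Hom.toAlgHom f) a) =
      Hom.toAlgHom f (contract K l A a) := by
  induction a with
  | zero => simp
  | add x y hx hy => simp only [map_add, hx, hy]
  | tmul c a => rw [Algebra.TensorProduct.map_tmul, contract_tmul, contract_tmul, map_smul]; rfl

/-- An element of `K ⊗ A` is determined by its contractions with the coordinate forms of a basis. -/
theorem exists_contractions (A : CDGA k) (a : K ⊗[k] A.carrier) :
    ∃ s : Finset (Module.Basis.ofVectorSpaceIndex k K),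
      a = ∑ i ∈ s, ((Module.Basis.ofVectorSpace k K i) ⊗ₜ[k]
        contract K ((Module.Basis.ofVectorSpace k K).coord i) A a : K ⊗[k] A.carrier) := by
  classical
  set b := Module.Basis.ofVectorSpace k K
  obtain ⟨c, hc⟩ := (TensorProduct.equivFinsuppOfBasisLeft (N := A.carrier) b).symm.surjective a
  rw [TensorProduct.equivFinsuppOfBasisLeft_symm_apply] at hc
  have hco : ∀ i, contract K (b.coord i) A a = c i := by
    intro i
    rw [← hc, Finsupp.sum, map_sum]
    simp only [contract_tmul, Module.Basis.coord_apply, Module.Basis.repr_self,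
      Finsupp.single_apply]
    simp
    intro h; exact h.symm
  refine ⟨c.support, ?_⟩
  simp only [hco]
  exact hc.symm

/-- `f` is a quasi-isomorphism if and only if `K ⊗ f` is one. -/
theorem quasiIso_extendMap_iff (f : A ⟶ B) :
    quasiIso K (extendMap K f) ↔ quasiIso k f := by
  classical
  have key : quasiIso K (extendMap K f) ↔
      (∀ z : K ⊗[k] A.carrier, A.d.baseChange K z = 0 →
        (∃ y : K ⊗[k] B.carrier, B.d.baseChange K y =
          Algebra.TensorProduct.map (AlgHom.id K K) (Hom.toAlgHom f) z) →
        ∃ a : K ⊗[k] A.carrier, A.d.baseChange K a = z) ∧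
      (∀ w : K ⊗[k] B.carrier, B.d.baseChange K w = 0 →
        ∃ z : K ⊗[k] A.carrier, A.d.baseChange K z = 0 ∧ ∃ y : K ⊗[k] B.carrier,
          B.d.baseChange K y =
            Algebra.TensorProduct.map (AlgHom.id K K) (Hom.toAlgHom f) z - w) :=
    quasiIso_iff (extendMap K f)
  rw [key, quasiIso_iff]
  constructor
  · rintro ⟨h1, h2⟩
    -- a linear retraction of `k → K`
    obtain ⟨l, hl⟩ : ∃ l : K →ₗ[k] k, l 1 = 1 := by
      obtain ⟨l, hl⟩ := LinearMap.exists_leftInverse_of_injective (Algebra.linearMap k K)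
        (LinearMap.ker_eq_bot.2 (algebraMap k K).injective)
      exact ⟨l, by simpa using congrArg (fun g => g 1) hl⟩
    constructor
    · rintro z hz ⟨y, hy⟩
      obtain ⟨a, ha⟩ := h1 (1 ⊗ₜ z) (by
        rw [LinearMap.baseChange_tmul, hz, TensorProduct.tmul_zero])
        ⟨1 ⊗ₜ y, by
          rw [LinearMap.baseChange_tmul, hy, Algebra.TensorProduct.map_tmul]; rfl⟩
      refine ⟨contract K l A a, ?_⟩
      rw [← contract_d, ha, contract_tmul, hl, one_smul]
    · intro w hw
      obtain ⟨z, hz, y, hy⟩ := h2 (1 ⊗ₜ w) (by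
        rw [LinearMap.baseChange_tmul, hw, TensorProduct.tmul_zero])
      refine ⟨contract K l A z, by rw [← contract_d, hz, map_zero], contract K l B y, ?_⟩
      rw [← contract_d, hy, map_sub, contract_extendMap, contract_tmul, hl, one_smul]
  · rintro ⟨h1, h2⟩
    set b := Module.Basis.ofVectorSpace k K
    constructor
    · rintro z hz ⟨y, hy⟩
      obtain ⟨s, hs⟩ := exists_contractions K A z
      have h (i) : ∃ a, A.d a = contract K (b.coord i) A z :=
        h1 _ (by rw [← contract_d, hz, map_zero])
          ⟨contract K (b.coord i) B y, by rw [← contract_d, hy, contract_extendMap]⟩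
      choose a ha using h
      refine ⟨∑ i ∈ s, b i ⊗ₜ[k] a i, ?_⟩
      rw [hs, map_sum]
      refine Finset.sum_congr rfl fun i _ => ?_
      rw [LinearMap.baseChange_tmul, ha]
    · intro w hw
      obtain ⟨s, hs⟩ := exists_contractions K B w
      have h (i) := h2 (contract K (b.coord i) B w) (by rw [← contract_d, hw, map_zero])
      choose z hz y hy using h
      refine ⟨∑ i ∈ s, b i ⊗ₜ[k] z i, ?_, ∑ i ∈ s, b i ⊗ₜ[k] y i, ?_⟩
      · rw [map_sum]
        refine Finset.sum_eq_zero fun i _ => ?_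
        rw [LinearMap.baseChange_tmul, hz, TensorProduct.tmul_zero]
      · conv_rhs => rw [hs]
        rw [map_sum, map_sum, ← Finset.sum_sub_distrib]
        refine Finset.sum_congr rfl fun i _ => ?_
        rw [LinearMap.baseChange_tmul, hy, Algebra.TensorProduct.map_tmul,
          TensorProduct.tmul_sub]
        rfl

end BaseChange

end CDGA
end

noncomputable section

/-! ### Massey systems and their homotopies -/

namespace CDGA

variable {k K : Type} [Field k] [Field K]

theorem mem_center_of_even {A : CDGA k} {n : ℤ} (hn : Even n) {a : A.carrier} (ha : a ∈ A.gr n) :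
    a ∈ Subring.center A.carrier :=
  Subring.mem_center_iff.2 fun b => (mul_comm_of_even hn ha b).symm

/-- A homomorphism of differential graded rings between cdga's over possibly different fields. It
covers both morphisms of cdga's and the map `A → K ⊗ A`. -/
structure DGRingHom (A : CDGA k) (B : CDGA K) where
  toRingHom : A.carrier →+* B.carrier
  map_mem : ∀ {n : ℤ} {a : A.carrier}, a ∈ A.gr n → toRingHom a ∈ B.gr n
  map_d : ∀ a, toRingHom (A.d a) = B.d (toRingHom a)

/-- A morphism of cdga's as a homomorphism of differential graded rings. -/
def Hom.toDG {A B : CDGA k} (f : A ⟶ B) : DGRingHom A B where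
  toRingHom := (Hom.toAlgHom f).toRingHom
  map_mem := Hom.map_mem f
  map_d := Hom.map_d f

/-- The homomorphism `A → K ⊗ A`. -/
def toExtend (K : Type) [Field K] [Algebra k K] (A : CDGA k) : DGRingHom A (A.extend K) where
  toRingHom := (Algebra.TensorProduct.includeRight : A.carrier →ₐ[k] K ⊗[k] A.carrier).toRingHom
  map_mem h := tmul_mem_baseChange K 1 h
  map_d _ := (LinearMap.baseChange_tmul _ _ _).symm

/-- A null system for the triple Massey product `⟨α, x, y⟩`: cocycles `α, x, y` of degree `2`,
primitives `b` and `e` of `xα` and `xy`, and a primitive `p` of the resulting Massey cocycle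
`yb - αe`. -/
@[ext]
structure MasseySystem (A : CDGA k) where
  (α x y b e p : A.carrier)
  α_mem : α ∈ A.gr 2
  x_mem : x ∈ A.gr 2
  y_mem : y ∈ A.gr 2
  b_mem : b ∈ A.gr 3
  e_mem : e ∈ A.gr 3
  p_mem : p ∈ A.gr 4
  d_α : A.d α = 0
  d_x : A.d x = 0
  d_y : A.d y = 0
  d_b : A.d b = x * α
  d_e : A.d e = x * y
  d_p : A.d p = y * b - α * e

/-- The parameters of a homotopy between Massey systems: how to move `α, x, y` (by `dr, ds, du`),
`b, e` (by `v, w`) and `p` (by `q`). -/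
@[ext]
structure Gauge (A : CDGA k) where
  (r s u v w q : A.carrier)
  r_mem : r ∈ A.gr 1
  s_mem : s ∈ A.gr 1
  u_mem : u ∈ A.gr 1
  v_mem : v ∈ A.gr 2
  w_mem : w ∈ A.gr 2
  q_mem : q ∈ A.gr 3

section RingIdentities

variable {R : Type} [Ring R] {α x y r' s' u' : R}

/-- Rewrites products with central left factors as scalar multiplications. -/
theorem center_smul (c : Subring.center R) (a : R) : (c : R) * a = c • a := rfl

/-- The ring identity behind the differential of `b` and `e` along a homotopy. -/
theorem act_b_identity (hα : α ∈ Subring.center R) (hx : x ∈ Subring.center R)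
    (hr : r' ∈ Subring.center R) (hs : s' ∈ Subring.center R) :
    x * α + x * r' + α * s' + r' * s' = (x + s') * (α + r') := by
  lift α to Subring.center R using hα
  lift x to Subring.center R using hx
  lift r' to Subring.center R using hr
  lift s' to Subring.center R using hs
  norm_cast
  ring

/-- The ring identity behind the differential of `p` along a homotopy. Primes stand for
differentials, which are central for elements of odd degree. -/
theorem act_p_identity (hα : α ∈ Subring.center R) (hx : x ∈ Subring.center R)
    (hy : y ∈ Subring.center R) (hr : r' ∈ Subring.center R) (hu : u' ∈ Subring.center R)
    (b e r s u v' w' : R) :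
    (y * b - α * e) + ((x * y) * r - e * r') - ((x * α) * u - b * u') - x * (r' * u - r * u') +
      (y + u') * v' - (α + r') * w' =
    (y + u') * (b + x * r + α * s + r' * s + v') -
      (α + r') * (e + x * u + y * s + u' * s + w') := by
  rw [Subring.mem_center_iff.1 hr, Subring.mem_center_iff.1 hu, Subring.mem_center_iff.1 hu]
  lift α to Subring.center R using hα
  lift x to Subring.center R using hx
  lift y to Subring.center R using hy
  lift r' to Subring.center R using hr
  lift u' to Subring.center R using hu
  simp only [← Subring.coe_add, ← Subring.coe_mul]
  simp only [center_smul]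
  module

end RingIdentities

namespace MasseySystem

variable {A : CDGA k}

/-- The last component at the end of a homotopy is again a primitive of the Massey cocycle. -/
theorem act_d_p (S : MasseySystem A) (h : Gauge A) :
    A.d (S.p + S.e * h.r - S.b * h.u - S.x * (h.r * h.u) + (S.y + A.d h.u) * h.v -
      (S.α + A.d h.r) * h.w + A.d h.q) =
    (S.y + A.d h.u) * (S.b + S.x * h.r + S.α * h.s + A.d h.r * h.s + A.d h.v) -
      (S.α + A.d h.r) * (S.e + S.x * h.u + S.y * h.s + A.d h.u * h.s + A.d h.w) := by
  have hy : S.y + A.d h.u ∈ A.gr 2 := add_mem S.y_mem (d_mem' (by norm_num) h.u_mem)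
  have hα : S.α + A.d h.r ∈ A.gr 2 := add_mem S.α_mem (d_mem' (by norm_num) h.r_mem)
  simp only [map_add, map_sub, A.d_d, leibniz_of_even even_two hy, leibniz_of_even even_two hα,
    leibniz_of_even even_two S.x_mem, leibniz_of_odd (by decide : Odd (3 : ℤ)) S.e_mem,
    leibniz_of_odd (by decide : Odd (3 : ℤ)) S.b_mem, leibniz_of_odd odd_one h.r_mem, S.d_α,
    S.d_x, S.d_y, S.d_b, S.d_e, S.d_p, zero_mul, zero_add, add_zero]
  exact act_p_identity (mem_center_of_even even_two S.α_mem) (mem_center_of_even even_two S.x_mem)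
    (mem_center_of_even even_two S.y_mem)
    (mem_center_of_even even_two (d_mem' (by norm_num) h.r_mem))
    (mem_center_of_even even_two (d_mem' (by norm_num) h.u_mem)) _ _ _ _ _ _ _

/-- The Massey system at the end of the homotopy with the given parameters. -/
def act (S : MasseySystem A) (h : Gauge A) : MasseySystem A where
  α := S.α + A.d h.r
  x := S.x + A.d h.s
  y := S.y + A.d h.u
  b := S.b + S.x * h.r + S.α * h.s + A.d h.r * h.s + A.d h.v
  e := S.e + S.x * h.u + S.y * h.s + A.d h.u * h.s + A.d h.w
  p := S.p + S.e * h.r - S.b * h.u - S.x * (h.r * h.u) + (S.y + A.d h.u) * h.v -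
    (S.α + A.d h.r) * h.w + A.d h.q
  α_mem := add_mem S.α_mem (d_mem' (by norm_num) h.r_mem)
  x_mem := add_mem S.x_mem (d_mem' (by norm_num) h.s_mem)
  y_mem := add_mem S.y_mem (d_mem' (by norm_num) h.u_mem)
  b_mem := add_mem (add_mem (add_mem (add_mem S.b_mem (mul_mem' (by norm_num) S.x_mem h.r_mem))
    (mul_mem' (by norm_num) S.α_mem h.s_mem))
    (mul_mem' (by norm_num) (d_mem' rfl h.r_mem) h.s_mem)) (d_mem' (by norm_num) h.v_mem)
  e_mem := add_mem (add_mem (add_mem (add_mem S.e_mem (mul_mem' (by norm_num) S.x_mem h.u_mem))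
    (mul_mem' (by norm_num) S.y_mem h.s_mem))
    (mul_mem' (by norm_num) (d_mem' rfl h.u_mem) h.s_mem)) (d_mem' (by norm_num) h.w_mem)
  p_mem := add_mem (sub_mem (add_mem (sub_mem (sub_mem (add_mem S.p_mem
    (mul_mem' (by norm_num) S.e_mem h.r_mem)) (mul_mem' (by norm_num) S.b_mem h.u_mem))
    (mul_mem' (by norm_num) S.x_mem (A.mul_mem h.r_mem h.u_mem)))
    (mul_mem' (by norm_num) (add_mem S.y_mem (d_mem' (by norm_num) h.u_mem)) h.v_mem))
    (mul_mem' (by norm_num) (add_mem S.α_mem (d_mem' (by norm_num) h.r_mem)) h.w_mem))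
    (d_mem' (by norm_num) h.q_mem)
  d_α := by rw [map_add, S.d_α, A.d_d, add_zero]
  d_x := by rw [map_add, S.d_x, A.d_d, add_zero]
  d_y := by rw [map_add, S.d_y, A.d_d, add_zero]
  d_b := by
    simp only [map_add, leibniz_of_even even_two S.x_mem, leibniz_of_even even_two S.α_mem,
      leibniz_of_even even_two (d_mem' (by norm_num) h.r_mem), A.d_d, S.d_x, S.d_α, S.d_b,
      zero_mul, zero_add, add_zero]
    exact act_b_identity (mem_center_of_even even_two S.α_mem)
      (mem_center_of_even even_two S.x_mem)
      (mem_center_of_even even_two (d_mem' (by norm_num) h.r_mem))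
      (mem_center_of_even even_two (d_mem' (by norm_num) h.s_mem))
  d_e := by
    simp only [map_add, leibniz_of_even even_two S.x_mem, leibniz_of_even even_two S.y_mem,
      leibniz_of_even even_two (d_mem' (by norm_num) h.u_mem), A.d_d, S.d_x, S.d_y, S.d_e,
      zero_mul, zero_add, add_zero]
    exact act_b_identity (mem_center_of_even even_two S.y_mem)
      (mem_center_of_even even_two S.x_mem)
      (mem_center_of_even even_two (d_mem' (by norm_num) h.u_mem))
      (mem_center_of_even even_two (d_mem' (by norm_num) h.s_mem))
  d_p := S.act_d_p h

end MasseySystem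

end CDGA
end

noncomputable section

/-! ### Concatenation and lifting of homotopies -/

namespace CDGA

variable {k K : Type} [Field k] [Field K]

section RingIdentities

variable {R : Type} [Ring R] {α x y r₁' s₁' u₁' r₂' u₂' : R}

/-- The ring identity behind `act_act` for `b` and `e`; primes stand for differentials. -/
theorem comp_b_identity (hα : α ∈ Subring.center R) (hx : x ∈ Subring.center R)
    (hr₁ : r₁' ∈ Subring.center R) (hs₁ : s₁' ∈ Subring.center R)
    (hr₂ : r₂' ∈ Subring.center R) (b r₁ s₁ v₁' r₂ s₂ v₂' : R) :
    b + x * r₁ + α * s₁ + r₁' * s₁ + v₁' + (x + s₁') * r₂ + (α + r₁') * s₂ + r₂' * s₂ + v₂' =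
    b + x * (r₁ + r₂) + α * (s₁ + s₂) + (r₁' + r₂') * (s₁ + s₂) +
      (v₁' + v₂' + (s₁' * r₂ - s₁ * r₂')) := by
  rw [Subring.mem_center_iff.1 hr₂]
  lift α to Subring.center R using hα
  lift x to Subring.center R using hx
  lift r₁' to Subring.center R using hr₁
  lift s₁' to Subring.center R using hs₁
  lift r₂' to Subring.center R using hr₂
  simp only [← Subring.coe_add]
  simp only [center_smul]
  module

/-- The ring identity behind `act_act` for `p`; primes stand for differentials. -/
theorem comp_p_identity (hα : α ∈ Subring.center R) (hx : x ∈ Subring.center R)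
    (hy : y ∈ Subring.center R)
    (hr₁ : r₁' ∈ Subring.center R) (hs₁ : s₁' ∈ Subring.center R) (hu₁ : u₁' ∈ Subring.center R)
    (hr₂ : r₂' ∈ Subring.center R) (hu₂ : u₂' ∈ Subring.center R)
    (b e p r₁ s₁ u₁ v₁ w₁ v₁' w₁' q₁' r₂ u₂ v₂ w₂ q₂' : R) (hur : u₁ * r₂ = -(r₂ * u₁)) :
    (p + e * r₁ - b * u₁ - x * (r₁ * u₁) + (y + u₁') * v₁ - (α + r₁') * w₁ + q₁') +
      (e + x * u₁ + y * s₁ + u₁' * s₁ + w₁') * r₂ - (b + x * r₁ + α * s₁ + r₁' * s₁ + v₁') * u₂ -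
      (x + s₁') * (r₂ * u₂) + (y + u₁' + u₂') * v₂ - (α + r₁' + r₂') * w₂ + q₂' =
    p + e * (r₁ + r₂) - b * (u₁ + u₂) - x * ((r₁ + r₂) * (u₁ + u₂)) +
      (y + (u₁' + u₂')) * (v₁ + v₂ + s₁ * r₂) - (α + (r₁' + r₂')) * (w₁ + w₂ + s₁ * u₂) +
      (q₁' + q₂' - (v₁' * u₂ + v₁ * u₂') + (w₁' * r₂ + w₁ * r₂') -
        (s₁' * (r₂ * u₂) - s₁ * (r₂' * u₂ - r₂ * u₂'))) := by
  rw [Subring.mem_center_iff.1 hr₂ w₁, Subring.mem_center_iff.1 hu₂ v₁,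
    Subring.mem_center_iff.1 hu₂ r₂]
  lift α to Subring.center R using hα
  lift x to Subring.center R using hx
  lift y to Subring.center R using hy
  lift r₁' to Subring.center R using hr₁
  lift s₁' to Subring.center R using hs₁
  lift u₁' to Subring.center R using hu₁
  lift r₂' to Subring.center R using hr₂
  lift u₂' to Subring.center R using hu₂
  simp only [← Subring.coe_add]
  simp only [center_smul, add_mul, mul_add, mul_sub, smul_mul_assoc, mul_smul_comm, hur]
  module

end RingIdentities

namespace Gauge

variable {A : CDGA k}

/-- Concatenation of homotopies. -/
def comp (h₁ h₂ : Gauge A) : Gauge A where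
  r := h₁.r + h₂.r
  s := h₁.s + h₂.s
  u := h₁.u + h₂.u
  v := h₁.v + h₂.v + h₁.s * h₂.r
  w := h₁.w + h₂.w + h₁.s * h₂.u
  q := h₁.q + h₂.q - h₁.v * h₂.u + h₁.w * h₂.r - h₁.s * (h₂.r * h₂.u)
  r_mem := add_mem h₁.r_mem h₂.r_mem
  s_mem := add_mem h₁.s_mem h₂.s_mem
  u_mem := add_mem h₁.u_mem h₂.u_mem
  v_mem := add_mem (add_mem h₁.v_mem h₂.v_mem) (mul_mem' (by norm_num) h₁.s_mem h₂.r_mem)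
  w_mem := add_mem (add_mem h₁.w_mem h₂.w_mem) (mul_mem' (by norm_num) h₁.s_mem h₂.u_mem)
  q_mem := sub_mem (add_mem (sub_mem (add_mem h₁.q_mem h₂.q_mem)
    (mul_mem' (by norm_num) h₁.v_mem h₂.u_mem)) (mul_mem' (by norm_num) h₁.w_mem h₂.r_mem))
    (mul_mem' (by norm_num) h₁.s_mem (A.mul_mem h₂.r_mem h₂.u_mem))

/-- The constant homotopy. -/
def zero (A : CDGA k) : Gauge A where
  r := 0
  s := 0
  u := 0
  v := 0
  w := 0
  q := 0
  r_mem := zero_mem _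
  s_mem := zero_mem _
  u_mem := zero_mem _
  v_mem := zero_mem _
  w_mem := zero_mem _
  q_mem := zero_mem _

/-- The inverse homotopy. -/
def inv (h : Gauge A) : Gauge A where
  r := -h.r
  s := -h.s
  u := -h.u
  v := -h.v + h.s * h.r
  w := -h.w + h.s * h.u
  q := -h.q - h.v * h.u + h.w * h.r + h.s * (h.r * h.u)
  r_mem := neg_mem h.r_mem
  s_mem := neg_mem h.s_mem
  u_mem := neg_mem h.u_mem
  v_mem := add_mem (neg_mem h.v_mem) (mul_mem' (by norm_num) h.s_mem h.r_mem)
  w_mem := add_mem (neg_mem h.w_mem) (mul_mem' (by norm_num) h.s_mem h.u_mem)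
  q_mem := add_mem (add_mem (sub_mem (neg_mem h.q_mem)
    (mul_mem' (by norm_num) h.v_mem h.u_mem)) (mul_mem' (by norm_num) h.w_mem h.r_mem))
    (mul_mem' (by norm_num) h.s_mem (A.mul_mem h.r_mem h.u_mem))

theorem comp_inv (h : Gauge A) : h.comp h.inv = zero A := by
  ext <;> simp only [comp, inv, zero, mul_neg, neg_mul, neg_neg] <;> abel

end Gauge

namespace MasseySystem

variable {A : CDGA k} {B : CDGA K}

theorem act_zero (S : MasseySystem A) : S.act (Gauge.zero A) = S := by
  ext <;> simp [act, Gauge.zero]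

theorem act_act (S : MasseySystem A) (h₁ h₂ : Gauge A) :
    (S.act h₁).act h₂ = S.act (h₁.comp h₂) := by
  have hdr (h : Gauge A) := mem_center_of_even even_two (d_mem' (by norm_num) h.r_mem)
  have hds (h : Gauge A) := mem_center_of_even even_two (d_mem' (by norm_num) h.s_mem)
  have hdu (h : Gauge A) := mem_center_of_even even_two (d_mem' (by norm_num) h.u_mem)
  have hα := mem_center_of_even even_two S.α_mem
  have hx := mem_center_of_even even_two S.x_mem
  have hy := mem_center_of_even even_two S.y_mem
  ext
  · simp only [act, Gauge.comp, map_add, add_assoc]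
  · simp only [act, Gauge.comp, map_add, add_assoc]
  · simp only [act, Gauge.comp, map_add, add_assoc]
  · simp only [act, Gauge.comp, map_add, leibniz_of_odd odd_one h₁.s_mem]
    exact comp_b_identity hα hx (hdr _) (hds _) (hdr _) _ _ _ _ _ _ _
  · simp only [act, Gauge.comp, map_add, leibniz_of_odd odd_one h₁.s_mem]
    exact comp_b_identity hy hx (hdu _) (hds _) (hdu _) _ _ _ _ _ _ _
  · simp only [act, Gauge.comp, map_add, map_sub, leibniz_of_odd odd_one h₁.s_mem,
      leibniz_of_odd odd_one h₂.r_mem, leibniz_of_even even_two h₁.v_mem,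
      leibniz_of_even even_two h₁.w_mem]
    exact comp_p_identity hα hx hy (hdr _) (hds _) (hdu _) (hdr _) (hdu _) _ _ _ _ _ _ _ _ _ _ _
      _ _ _ _ _ (mul_comm_of_odd odd_one odd_one h₁.u_mem h₂.r_mem)

/-- Two Massey systems are homotopic if a homotopy connects them. -/
instance homotopic (A : CDGA k) : Setoid (MasseySystem A) where
  r S T := ∃ h, S.act h = T
  iseqv := by
    refine ⟨fun S => ⟨Gauge.zero A, S.act_zero⟩, ?_, ?_⟩
    · rintro S _ ⟨h, rfl⟩
      exact ⟨h.inv, by rw [act_act, Gauge.comp_inv, act_zero]⟩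
    · rintro S _ _ ⟨h₁, rfl⟩ ⟨h₂, rfl⟩
      exact ⟨h₁.comp h₂, by rw [act_act]⟩

/-- The image of a Massey system. -/
def map (g : DGRingHom A B) (S : MasseySystem A) : MasseySystem B where
  α := g.toRingHom S.α
  x := g.toRingHom S.x
  y := g.toRingHom S.y
  b := g.toRingHom S.b
  e := g.toRingHom S.e
  p := g.toRingHom S.p
  α_mem := g.map_mem S.α_mem
  x_mem := g.map_mem S.x_mem
  y_mem := g.map_mem S.y_mem
  b_mem := g.map_mem S.b_mem
  e_mem := g.map_mem S.e_mem
  p_mem := g.map_mem S.p_mem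
  d_α := by rw [← g.map_d, S.d_α, map_zero]
  d_x := by rw [← g.map_d, S.d_x, map_zero]
  d_y := by rw [← g.map_d, S.d_y, map_zero]
  d_b := by rw [← g.map_d, S.d_b, map_mul]
  d_e := by rw [← g.map_d, S.d_e, map_mul]
  d_p := by rw [← g.map_d, S.d_p, map_sub, map_mul, map_mul]

/-- The image of a homotopy. -/
def _root_.CDGA.Gauge.map (g : DGRingHom A B) (h : Gauge A) : Gauge B where
  r := g.toRingHom h.r
  s := g.toRingHom h.s
  u := g.toRingHom h.u
  v := g.toRingHom h.v
  w := g.toRingHom h.w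
  q := g.toRingHom h.q
  r_mem := g.map_mem h.r_mem
  s_mem := g.map_mem h.s_mem
  u_mem := g.map_mem h.u_mem
  v_mem := g.map_mem h.v_mem
  w_mem := g.map_mem h.w_mem
  q_mem := g.map_mem h.q_mem

theorem map_act (g : DGRingHom A B) (S : MasseySystem A) (h : Gauge A) :
    (S.act h).map g = (S.map g).act (h.map g) := by
  ext <;> simp only [act, map, Gauge.map, map_add, map_sub, map_mul, g.map_d]

theorem map_equiv (g : DGRingHom A B) {S T : MasseySystem A} (h : S ≈ T) : S.map g ≈ T.map g := by
  obtain ⟨h, rfl⟩ := h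
  exact ⟨h.map g, (map_act g S h).symm⟩

/-- Every Massey system lifts along a quasi-isomorphism, up to homotopy. -/
theorem exists_lift {A B : CDGA k} {f : A ⟶ B} (hf : quasiIso k f) (T : MasseySystem B) :
    ∃ S : MasseySystem A, T ≈ S.map (Hom.toDG f) := by
  obtain ⟨α, hα, hdα, r, hr, hfα⟩ := exists_lift_primitive hf (l := 1) (by norm_num) (m := 3)
    (by norm_num) (zero_mem _) (map_zero _) T.α_mem (by rw [T.d_α, map_zero])
  obtain ⟨x, hx, hdx, s, hs, hfx⟩ := exists_lift_primitive hf (l := 1) (by norm_num) (m := 3)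
    (by norm_num) (zero_mem _) (map_zero _) T.x_mem (by rw [T.d_x, map_zero])
  obtain ⟨y, hy, hdy, u, hu, hfy⟩ := exists_lift_primitive hf (l := 1) (by norm_num) (m := 3)
    (by norm_num) (zero_mem _) (map_zero _) T.y_mem (by rw [T.d_y, map_zero])
  -- move `α, x, y` first, then `b` and `e`, then `p`
  set h₁ : Gauge B := ⟨r, s, u, 0, 0, 0, hr, hs, hu, zero_mem _, zero_mem _, zero_mem _⟩
  obtain ⟨b, hb, hdb, v, hv, hfb⟩ := exists_lift_primitive hf (l := 2) (by norm_num) (m := 4)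
    (by norm_num) (mul_mem' (by norm_num) hx hα)
    (by rw [leibniz_of_even even_two hx, hdx, hdα]; simp) (T.act h₁).b_mem
    (by rw [(T.act h₁).d_b, map_mul, hfx, hfα]; rfl)
  obtain ⟨e, he, hde, w, hw, hfe⟩ := exists_lift_primitive hf (l := 2) (by norm_num) (m := 4)
    (by norm_num) (mul_mem' (by norm_num) hx hy)
    (by rw [leibniz_of_even even_two hx, hdx, hdy]; simp) (T.act h₁).e_mem
    (by rw [(T.act h₁).d_e, map_mul, hfx, hfy]; rfl)
  set h₂ : Gauge B := ⟨r, s, u, v, w, 0, hr, hs, hu, hv, hw, zero_mem _⟩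
  have hfb' : Hom.toAlgHom f b = (T.act h₂).b := by rw [hfb]; simp [act, h₁, h₂]
  have hfe' : Hom.toAlgHom f e = (T.act h₂).e := by rw [hfe]; simp [act, h₁, h₂]
  obtain ⟨p, hp, hdp, q, hq, hfp⟩ := exists_lift_primitive hf (l := 3) (by norm_num) (m := 5)
    (by norm_num) (sub_mem (mul_mem' (by norm_num) hy hb) (mul_mem' (by norm_num) hα he))
    (by
      rw [map_sub, leibniz_of_even even_two hy, leibniz_of_even even_two hα, hdy, hdα, hdb, hde,
        ← mul_assoc, ← mul_assoc, mul_comm_of_even even_two hα x,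
        mul_comm_of_even even_two hy, mul_assoc x, mul_assoc x, mul_comm_of_even even_two hα y]
      simp) (T.act h₂).p_mem
    (by rw [(T.act h₂).d_p, map_sub, map_mul, map_mul, hfy, hfα, hfb', hfe']; rfl)
  refine ⟨⟨α, x, y, b, e, p, hα, hx, hy, hb, he, hp, hdα, hdx, hdy, hdb, hde, hdp⟩,
    ⟨r, s, u, v, w, q, hr, hs, hu, hv, hw, hq⟩, ?_⟩
  ext
  · exact hfα.symm
  · exact hfx.symm
  · exact hfy.symm
  · exact hfb'.symm
  · exact hfe'.symm
  · refine Eq.trans ?_ hfp.symm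
    simp [act, h₂]

end MasseySystem

end CDGA
end

noncomputable section

/-! ### Massey systems as a functor on the homotopy category -/

namespace CDGA

variable {k K : Type} [Field k] [Field K]

/-- The ring identity behind the primitive of `q` in `equiv_of_map_act`; primes stand for
differentials. -/
theorem even_mul_lift_identity {R : Type} [Ring R] {α x y : R} (hα : α ∈ Subring.center R)
    (hx : x ∈ Subring.center R) (hy : y ∈ Subring.center R)
    (b e p ρ σ υ ρ' υ' v w ν' ω' q' : R) :
    -(x * y * ρ - e * ρ') + (x * α * υ - b * υ') - x * (ρ' * υ') - y * ν' + α * ω' + q' =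
    p + e * ρ' - b * υ' - x * (ρ' * υ') + y * v - α * w + q' - p -
      y * (v + (x * ρ + α * σ) + ν') + α * (w + (x * υ + y * σ) + ω') := by
  lift α to Subring.center R using hα
  lift x to Subring.center R using hx
  lift y to Subring.center R using hy
  simp only [← Subring.coe_mul]
  simp only [center_smul]
  module

namespace MasseySystem

variable {A B : CDGA k}

/-- Homotopic images imply homotopic, for systems with the same cocycles and a homotopy that moves
these by zero. -/
theorem equiv_of_map_act {f : A ⟶ B} (hf : quasiIso k f) {S T : MasseySystem A} (hα : T.α = S.α)
    (hx : T.x = S.x) (hy : T.y = S.y) (h : Gauge B) {ρ σ υ : B.carrier} (hρ : ρ ∈ B.gr 0)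
    (hσ : σ ∈ B.gr 0) (hυ : υ ∈ B.gr 0) (hr : B.d ρ = h.r) (hs : B.d σ = h.s) (hu : B.d υ = h.u)
    (hST : (S.map (Hom.toDG f)).act h = T.map (Hom.toDG f)) : S ≈ T := by
  let F := Hom.toAlgHom f
  have hdr : B.d h.r = 0 := by rw [← hr, B.d_d]
  have hdu : B.d h.u = 0 := by rw [← hu, B.d_d]
  have hfα : F S.α ∈ B.gr 2 := Hom.map_mem f S.α_mem
  have hfx : F S.x ∈ B.gr 2 := Hom.map_mem f S.x_mem
  have hfy : F S.y ∈ B.gr 2 := Hom.map_mem f S.y_mem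
  have hfb : F S.b ∈ B.gr 3 := Hom.map_mem f S.b_mem
  have hfe : F S.e ∈ B.gr 3 := Hom.map_mem f S.e_mem
  have dfα : B.d (F S.α) = 0 := by rw [← Hom.map_d, S.d_α, map_zero]
  have dfx : B.d (F S.x) = 0 := by rw [← Hom.map_d, S.d_x, map_zero]
  have dfy : B.d (F S.y) = 0 := by rw [← Hom.map_d, S.d_y, map_zero]
  have dfb : B.d (F S.b) = F S.x * F S.α := by rw [← Hom.map_d, S.d_b, map_mul]
  have dfe : B.d (F S.e) = F S.x * F S.y := by rw [← Hom.map_d, S.d_e, map_mul]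
  have hb : F S.b + F S.x * h.r + F S.α * h.s + B.d h.r * h.s + B.d h.v = F T.b :=
    congrArg MasseySystem.b hST
  have he : F S.e + F S.x * h.u + F S.y * h.s + B.d h.u * h.s + B.d h.w = F T.e :=
    congrArg MasseySystem.e hST
  have hp : F S.p + F S.e * h.r - F S.b * h.u - F S.x * (h.r * h.u) + (F S.y + B.d h.u) * h.v -
    (F S.α + B.d h.r) * h.w + B.d h.q = F T.p := congrArg MasseySystem.p hST
  rw [hdr, zero_mul, add_zero] at hb
  rw [hdu, zero_mul, add_zero] at he
  rw [hdr, hdu, add_zero, add_zero] at hp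
  obtain ⟨v, hv, hdv, ν, hν, hfv⟩ := exists_lift_primitive hf (l := 1) (n := 2) (by norm_num)
    (by norm_num) (sub_mem T.b_mem S.b_mem) (by rw [map_sub, T.d_b, S.d_b, hα, hx, sub_self])
    (t := h.v + (F S.x * ρ + F S.α * σ))
    (add_mem h.v_mem (add_mem (mul_mem' (by norm_num) hfx hρ) (mul_mem' (by norm_num) hfα hσ)))
    (by
      change _ = F _
      rw [map_sub, ← hb, map_add, map_add, leibniz_of_even even_two hfx,
        leibniz_of_even even_two hfα, dfα, dfx, hr, hs]
      noncomm_ring)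
  obtain ⟨w, hw, hdw, ω, hω, hfw⟩ := exists_lift_primitive hf (l := 1) (n := 2) (by norm_num)
    (by norm_num) (sub_mem T.e_mem S.e_mem) (by rw [map_sub, T.d_e, S.d_e, hy, hx, sub_self])
    (t := h.w + (F S.x * υ + F S.y * σ))
    (add_mem h.w_mem (add_mem (mul_mem' (by norm_num) hfx hυ) (mul_mem' (by norm_num) hfy hσ)))
    (by
      change _ = F _
      rw [map_sub, ← he, map_add, map_add, leibniz_of_even even_two hfx,
        leibniz_of_even even_two hfy, dfy, dfx, hu, hs]
      noncomm_ring)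
  have hd : A.d (T.p - S.p - S.y * v + S.α * w) = 0 := by
    rw [map_add, map_sub, map_sub, leibniz_of_even even_two S.y_mem,
      leibniz_of_even even_two S.α_mem, S.d_y, S.d_α, hdv, hdw, T.d_p, S.d_p, hα, hy]
    noncomm_ring
  obtain ⟨q, hq, hdq, -⟩ := exists_lift_primitive hf (l := 2) (n := 3) (by norm_num) (by norm_num)
    (add_mem (sub_mem (sub_mem T.p_mem S.p_mem) (mul_mem' (by norm_num) S.y_mem hv))
      (mul_mem' (by norm_num) S.α_mem hw)) hd
    (t := -(F S.e * ρ) + F S.b * υ - F S.x * (ρ * h.u) - F S.y * ν + F S.α * ω + h.q)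
    (add_mem (add_mem (sub_mem (sub_mem (add_mem
      (neg_mem (mul_mem' (by norm_num) hfe hρ))
      (mul_mem' (by norm_num) hfb hυ))
      (mul_mem' (by norm_num) hfx (B.mul_mem hρ h.u_mem)))
      (mul_mem' (by norm_num) hfy hν)) (mul_mem' (by norm_num) hfα hω)) h.q_mem)
    (by
      change _ = F _
      rw [map_add F, map_sub F, map_sub F, map_mul F, map_mul F, ← hp]
      rw [show F v = _ from hfv, show F w = _ from hfw]
      simp only [map_add, map_sub, map_neg, leibniz_of_even even_two hfx,
        leibniz_of_even even_two hfy, leibniz_of_even even_two hfα,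
        leibniz_of_even Even.zero hρ,
        leibniz_of_odd (by decide : Odd (3 : ℤ)) hfe,
        leibniz_of_odd (by decide : Odd (3 : ℤ)) hfb, hr, hu, hdu]
      simp only [dfx, dfy, dfα, dfb, dfe, zero_mul, zero_add, mul_zero, add_zero]
      exact even_mul_lift_identity (mem_center_of_even even_two hfα)
        (mem_center_of_even even_two hfx) (mem_center_of_even even_two hfy) _ _ _ _ _ _ _ _ _ _ _
        _ _)
  refine ⟨⟨0, 0, 0, v, w, q, zero_mem _, zero_mem _, zero_mem _, hv, hw, hq⟩, ?_⟩
  ext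
  · simp [act, hα]
  · simp [act, hx]
  · simp [act, hy]
  · simp [act, hdv]
  · simp [act, hdw]
  · simp only [act, map_zero, add_zero, mul_zero, sub_zero, hdq]
    abel

/-- A quasi-isomorphism is injective on homotopy classes of Massey systems. -/
theorem equiv_of_map_equiv {f : A ⟶ B} (hf : quasiIso k f) {S T : MasseySystem A}
    (h : S.map (Hom.toDG f) ≈ T.map (Hom.toDG f)) : S ≈ T := by
  obtain ⟨h, hST⟩ := h
  -- move the cocycles of `S` to those of `T`
  obtain ⟨r, hr, hdr, ρ, hρ, hfr⟩ := exists_lift_primitive hf (l := 0) (by norm_num) (by norm_num)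
    (sub_mem T.α_mem S.α_mem) (by rw [map_sub, T.d_α, S.d_α, sub_self]) h.r_mem
    (by rw [map_sub]; exact eq_sub_of_add_eq' (congrArg MasseySystem.α hST))
  obtain ⟨s, hs, hds, σ, hσ, hfs⟩ := exists_lift_primitive hf (l := 0) (by norm_num) (by norm_num)
    (sub_mem T.x_mem S.x_mem) (by rw [map_sub, T.d_x, S.d_x, sub_self]) h.s_mem
    (by rw [map_sub]; exact eq_sub_of_add_eq' (congrArg MasseySystem.x hST))
  obtain ⟨u, hu, hdu, υ, hυ, hfu⟩ := exists_lift_primitive hf (l := 0) (by norm_num) (by norm_num)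
    (sub_mem T.y_mem S.y_mem) (by rw [map_sub, T.d_y, S.d_y, sub_self]) h.u_mem
    (by rw [map_sub]; exact eq_sub_of_add_eq' (congrArg MasseySystem.y hST))
  let h₀ : Gauge A := ⟨r, s, u, 0, 0, 0, hr, hs, hu, zero_mem _, zero_mem _, zero_mem _⟩
  refine Setoid.trans ⟨h₀, rfl⟩ (equiv_of_map_act hf (S := S.act h₀) (T := T) ?_ ?_ ?_
    ((h₀.map (Hom.toDG f)).inv.comp h) (neg_mem hρ) (neg_mem hσ) (neg_mem hυ) ?_ ?_ ?_ ?_)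
  · simp [act, h₀, hdr]
  · simp [act, h₀, hds]
  · simp [act, h₀, hdu]
  · change B.d (-ρ) = -(Hom.toAlgHom f r) + h.r
    rw [hfr, map_neg]; abel
  · change B.d (-σ) = -(Hom.toAlgHom f s) + h.s
    rw [hfs, map_neg]; abel
  · change B.d (-υ) = -(Hom.toAlgHom f u) + h.u
    rw [hfu, map_neg]; abel
  · rw [map_act, ← act_act, act_act _ _ (Gauge.inv _), Gauge.comp_inv, act_zero, hST]

/-- Homotopy classes of Massey systems, as a functor. -/
def _root_.CDGA.masseyFunctor (k : Type) [Field k] : CDGA k ⥤ Type where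
  obj A := Quotient (homotopic A)
  map f := TypeCat.ofHom (Quotient.map (map (Hom.toDG f)) fun _ _ h => map_equiv _ h)
  map_id A := by
    ext c
    induction c using Quotient.inductionOn with
    | h S => rfl
  map_comp f g := by
    ext c
    induction c using Quotient.inductionOn with
    | h S => rfl

theorem _root_.CDGA.masseyFunctor_inverts (k : Type) [Field k] :
    (quasiIso k).IsInvertedBy (masseyFunctor k) := by
  intro A B f hf
  rw [isIso_iff_bijective]
  constructor
  · intro c c'
    induction c using Quotient.inductionOn with
    | h S =>
      induction c' using Quotient.inductionOn with
      | h T => exact fun h => Quotient.sound (equiv_of_map_equiv hf (Quotient.exact h))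
  · intro c
    induction c using Quotient.inductionOn with
    | h T =>
      obtain ⟨S, hS⟩ := exists_lift hf T
      exact ⟨⟦S⟧, Quotient.sound (Setoid.symm hS)⟩

/-- Homotopy classes of Massey systems, as a functor on the homotopy category. -/
def _root_.CDGA.hoMassey (k : Type) [Field k] : Ho k ⥤ Type :=
  Localization.Construction.lift (masseyFunctor k) (masseyFunctor_inverts k)

theorem _root_.CDGA.hoMassey_map_Q {A B : CDGA k} (f : A ⟶ B) (S : MasseySystem A) :
    (hoMassey k).map ((quasiIso k).Q.map f) (⟦S⟧ : (masseyFunctor k).obj A) =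
      (⟦S.map (Hom.toDG f)⟧ : (masseyFunctor k).obj B) := rfl

end MasseySystem

end CDGA
end

noncomputable section

/-! ### The `∂∂̄`-property and the operator `dᶜ` -/

namespace RCBBA

variable {A B : RCBBA}

theorem exists_del_delbar_of_components (hA : A.DdbarProperty) {a : A.carrier}
    (ha : A.del (A.delbar a) = 0) :
    (∃ b, A.del (A.delbar b) = A.del a) ∧ ∃ b, A.del (A.delbar b) = A.delbar a := by
  -- it suffices to treat the components of `a`, which are again in the kernel of `∂∂̄`
  have hmem : a ∈ ⨆ i, A.gr i ⊓ LinearMap.ker (A.del ∘ₗ A.delbar) := by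
    refine mem_iSup_inf A.isInternal _ a ?_
    rintro ⟨p, q⟩
    rw [LinearMap.mem_ker, LinearMap.comp_apply, ← A.gproj_delbar, ← A.gproj_del, ha, map_zero]
  refine Submodule.iSup_induction _ (motive := fun a => (∃ b, A.del (A.delbar b) = A.del a) ∧
    ∃ b, A.del (A.delbar b) = A.delbar a) hmem ?_ ⟨⟨0, by simp⟩, ⟨0, by simp⟩⟩ ?_
  · rintro ⟨p, q⟩ a ⟨hpq, ha⟩
    replace ha : A.del (A.delbar a) = 0 := ha
    have hanti := A.del_delbar a
    rw [ha, zero_add] at hanti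
    obtain ⟨b, hb⟩ := (A.cls_eq_zero _).1 (hA ⟨A.del a + A.delbar a, by
      constructor <;> simp [A.del_del, A.delbar_delbar, ha, hanti]⟩ ⟨a, rfl⟩)
    replace hb : A.del (A.delbar b) = A.del a + A.delbar a := hb
    constructor
    · refine ⟨gproj A.isInternal {(p, q - 1)} b, ?_⟩
      rw [← A.gproj_delbar, ← A.gproj_del, sub_add_cancel, hb, map_add,
        gproj_of_mem _ _ (A.del_mem hpq), gproj_of_mem _ _ (A.delbar_mem hpq)]
      simp
    · refine ⟨gproj A.isInternal {(p - 1, q)} b, ?_⟩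
      rw [← A.gproj_delbar, ← A.gproj_del, sub_add_cancel, hb, map_add,
        gproj_of_mem _ _ (A.del_mem hpq), gproj_of_mem _ _ (A.delbar_mem hpq)]
      simp
  · rintro a a' ⟨⟨b, hb⟩, c, hc⟩ ⟨⟨b', hb'⟩, c', hc'⟩
    exact ⟨⟨b + b', by simp only [map_add, hb, hb']⟩, c + c', by simp only [map_add, hc, hc']⟩

/-- The `∂∂̄`-property says that the map from Bott-Chern to Aeppli cohomology is injective. -/
theorem ddbarProperty_iff : A.DdbarProperty ↔ ∀ z, A.del z = 0 → A.delbar z = 0 →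
    z ∈ LinearMap.range A.del ⊔ LinearMap.range A.delbar → ∃ a, A.del (A.delbar a) = z := by
  constructor
  · intro hA z hz hz' hmem
    obtain ⟨_, ⟨a, rfl⟩, _, ⟨b, rfl⟩, rfl⟩ := Submodule.mem_sup.1 hmem
    rw [map_add, A.del_del, zero_add] at hz
    rw [map_add, A.delbar_delbar, add_zero] at hz'
    have ha := A.del_delbar a
    rw [hz', add_zero] at ha
    obtain ⟨c, hc⟩ := (exists_del_delbar_of_components hA ha).1
    obtain ⟨c', hc'⟩ := (exists_del_delbar_of_components hA hz).2
    exact ⟨c + c', by rw [map_add, map_add, hc, hc']⟩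
  · rintro h z ⟨a, ha⟩
    refine (A.cls_eq_zero z).2 (h z (A.del_cocycle z) (A.delbar_cocycle z) ?_)
    rw [← ha]
    exact Submodule.add_mem_sup ⟨a, rfl⟩ ⟨a, rfl⟩

theorem IsPluriQuasiIso.exists_of_map {f : A ⟶ B} (hf : IsPluriQuasiIso f) {z : A.carrier}
    (hz : A.del z = 0) (hz' : A.delbar z = 0)
    (h : ∃ y, B.del (B.delbar y) = Hom.toAlgHom f z) : ∃ a, A.del (A.delbar a) = z := by
  refine (A.cls_eq_zero ⟨z, hz, hz'⟩).1 (hf.1.1 ?_)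
  rw [map_zero]
  exact (B.cls_eq_zero _).2 h

theorem IsPluriQuasiIso.exists_preimage {f : A ⟶ B} (hf : IsPluriQuasiIso f) {w : B.carrier}
    (hw : B.del w = 0) (hw' : B.delbar w = 0) : ∃ z, A.del z = 0 ∧ A.delbar z = 0 ∧
      ∃ y, B.del (B.delbar y) = Hom.toAlgHom f z - w := by
  obtain ⟨c, hc⟩ := hf.1.2 (B.cls ⟨w, hw, hw'⟩)
  obtain ⟨z, rfl⟩ := A.cls_surjective c
  refine ⟨z, z.2.1, z.2.2, ?_⟩
  replace hc : B.cls (Hom.mapCocycles f z) = B.cls ⟨w, hw, hw'⟩ := hc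
  rw [← sub_eq_zero, ← map_sub] at hc
  exact (B.cls_eq_zero _).1 hc

theorem IsPluriQuasiIso.mem_sup_of_map {f : A ⟶ B} (hf : IsPluriQuasiIso f) {z : A.carrier}
    (hz : A.del (A.delbar z) = 0)
    (h : Hom.toAlgHom f z ∈ LinearMap.range B.del ⊔ LinearMap.range B.delbar) :
    z ∈ LinearMap.range A.del ⊔ LinearMap.range A.delbar := by
  have h1 : Hom.mapAeppli f (Submodule.Quotient.mk ⟨z, hz⟩) = 0 := by
    refine (Submodule.Quotient.mk_eq_zero _).2 ?_
    exact h
  have h2 := hf.2.1 (h1.trans (map_zero _).symm)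
  have h3 : (⟨z, hz⟩ : A.aeppliCocycles) ∈ (LinearMap.range A.del ⊔
      LinearMap.range A.delbar).comap A.aeppliCocycles.subtype :=
    (Submodule.Quotient.mk_eq_zero _).1 h2
  exact h3

theorem map_mem_sup (f : A ⟶ B) {z : A.carrier}
    (h : z ∈ LinearMap.range A.del ⊔ LinearMap.range A.delbar) :
    Hom.toAlgHom f z ∈ LinearMap.range B.del ⊔ LinearMap.range B.delbar := by
  obtain ⟨_, ⟨a, rfl⟩, _, ⟨b, rfl⟩, rfl⟩ := Submodule.mem_sup.1 h
  rw [map_add, Hom.map_del, Hom.map_delbar]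
  exact Submodule.add_mem_sup ⟨_, rfl⟩ ⟨_, rfl⟩

theorem del_delbar_mem_sup (a : A.carrier) :
    A.del (A.delbar a) ∈ LinearMap.range A.del ⊔ LinearMap.range A.delbar :=
  Submodule.mem_sup_left ⟨_, rfl⟩

/-- The `∂∂̄`-property is invariant under pluripotential quasi-isomorphisms. -/
theorem IsPluriQuasiIso.ddbarProperty_iff {f : A ⟶ B} (hf : IsPluriQuasiIso f) :
    A.DdbarProperty ↔ B.DdbarProperty := by
  rw [RCBBA.ddbarProperty_iff, RCBBA.ddbarProperty_iff]
  constructor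
  · intro h w hw hw' hmem
    obtain ⟨z, hz, hz', y, hy⟩ := hf.exists_preimage hw hw'
    obtain ⟨a, ha⟩ := h z hz hz' (hf.mem_sup_of_map (by rw [hz', map_zero]) (by
      rw [← sub_add_cancel (Hom.toAlgHom f z) w, ← hy]
      exact add_mem (del_delbar_mem_sup y) hmem))
    refine ⟨Hom.toAlgHom f a - y, ?_⟩
    rw [map_sub, map_sub, hy, ← Hom.map_delbar, ← Hom.map_del, ha, sub_sub_cancel]
  · intro h z hz hz' hmem
    exact hf.exists_of_map hz hz' (h _ (by rw [← Hom.map_del, hz, map_zero])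
      (by rw [← Hom.map_delbar, hz', map_zero]) (map_mem_sup f hmem))

variable (A) in
/-- The inclusion of the fixed points of the involution. -/
def incl : A.toReal.carrier →ₐ[ℝ] A.carrier := A.realPoints.val

theorem incl_injective : Function.Injective A.incl := Subtype.val_injective

theorem conj_incl (a : A.toReal.carrier) : A.conj (A.incl a) = A.incl a := A.conj_real a

theorem exists_incl_eq {a : A.carrier} (ha : A.conj a = a) : ∃ b, A.incl b = a := ⟨⟨a, ha⟩, rfl⟩

theorem incl_d (a : A.toReal.carrier) :
    A.incl (A.toReal.d a) = A.del (A.incl a) + A.delbar (A.incl a) := rfl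

theorem mem_toReal_gr {n : ℤ} {a : A.toReal.carrier} :
    a ∈ A.toReal.gr n ↔ A.incl a ∈ A.totalGr n := Iff.rfl

variable (A) in
/-- The real operator `dᶜ = i(∂̄ - ∂)` on the fixed points of the involution. -/
def dc : A.toReal.carrier →ₗ[ℝ] A.toReal.carrier :=
  ((Complex.I • (A.delbar - A.del)).restrictScalars ℝ).restrict
    (p := Subalgebra.toSubmodule A.realPoints) (q := Subalgebra.toSubmodule A.realPoints) (by
    intro a (ha : A.conj a = a)
    change A.conj (Complex.I • (A.delbar a - A.del a)) = Complex.I • (A.delbar a - A.del a)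
    rw [A.conj.map_smulₛₗ, map_sub, A.conj_del, A.conj_delbar, ha, Complex.conj_I, neg_smul,
      ← smul_neg, neg_sub])

theorem incl_dc (a : A.toReal.carrier) :
    A.incl (A.dc a) = Complex.I • (A.delbar (A.incl a) - A.del (A.incl a)) := rfl

theorem incl_d_dc (a : A.toReal.carrier) :
    A.incl (A.toReal.d (A.dc a)) = (2 * Complex.I) • A.del (A.delbar (A.incl a)) := by
  have h := eq_neg_of_add_eq_zero_right (A.del_delbar (A.incl a))
  rw [incl_d, incl_dc, map_smul, map_smul, map_sub, map_sub, A.del_del, A.delbar_delbar, h]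
  module

theorem d_dc (a : A.toReal.carrier) : A.toReal.d (A.dc a) = -A.dc (A.toReal.d a) := by
  apply incl_injective
  rw [incl_d_dc, map_neg, incl_dc, incl_d, map_add, map_add, A.del_del, A.delbar_delbar,
    eq_neg_of_add_eq_zero_right (A.del_delbar (A.incl a))]
  module

theorem dc_dc (a : A.toReal.carrier) : A.dc (A.dc a) = 0 := by
  apply incl_injective
  rw [incl_dc, incl_dc, map_smul, map_smul, map_sub, map_sub, A.del_del, A.delbar_delbar,
    eq_neg_of_add_eq_zero_right (A.del_delbar (A.incl a)), map_zero]
  module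

theorem dc_mem {m n : ℤ} (h : n + 1 = m) {a : A.toReal.carrier} (ha : a ∈ A.toReal.gr n) :
    A.dc a ∈ A.toReal.gr m := by
  subst h
  rw [mem_toReal_gr, incl_dc]
  refine A.totalGr_induction (p := fun a => Complex.I • (A.delbar a - A.del a) ∈ A.totalGr (n + 1))
    ha (by simp) (fun x y hx hy => ?_) ?_
  · convert add_mem hx hy using 1
    simp only [map_add, smul_sub, smul_add]
    abel
  · rintro ⟨p, q⟩ rfl x hx
    have h1 := A.mem_totalGr (A.del_mem hx)
    have h2 := A.mem_totalGr (A.delbar_mem hx)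
    simp only at h1 h2 ⊢
    rw [add_right_comm] at h1
    rw [← add_assoc] at h2
    exact Submodule.smul_mem _ _ (sub_mem h2 h1)

/-- The operator `dᶜ` is linear over its kernel, acting from the right. -/
theorem dc_mul {w : A.toReal.carrier} (hw : A.dc w = 0) (a : A.toReal.carrier) :
    A.dc (a * w) = A.dc a * w := by
  have hw' : A.delbar (A.incl w) = A.del (A.incl w) := by
    have h := congrArg A.incl hw
    rw [incl_dc, map_zero, smul_eq_zero_iff_right Complex.I_ne_zero, sub_eq_zero] at h
    exact h
  apply incl_injective
  rw [incl_dc, map_mul A.incl, map_mul A.incl, incl_dc, smul_mul_assoc]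
  congr 1
  refine graded_induction A.isInternal (p := fun a => A.delbar (a * A.incl w) -
    A.del (a * A.incl w) = (A.delbar a - A.del a) * A.incl w) (A.incl a) ?_ (by simp) ?_
  · intro i x hx
    rw [A.del_leibniz hx, A.delbar_leibniz hx, hw', sub_mul]
    abel
  · intro x y hx hy
    simp only [map_add, add_mul, add_sub_add_comm, hx, hy]

theorem gproj_dc (n : ℤ) (a : A.toReal.carrier) :
    gproj A.toReal.isInternal {n + 1} (A.dc a) = A.dc (gproj A.toReal.isInternal {n} a) :=
  gproj_comm A.toReal.isInternal A.dc.toAddMonoidHom (fun n => n + 1) (fun _ _ h => dc_mem rfl h)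
    {n} {n + 1} (fun i => by simp) a

/-- A real element of the image of `∂∂̄` is in the image of `ddᶜ` on real elements. -/
theorem exists_d_dc_of_del_delbar {z : A.toReal.carrier} {c : A.carrier}
    (hc : A.del (A.delbar c) = A.incl z) : ∃ q, A.toReal.d (A.dc q) = z := by
  -- `ddᶜ = 2i∂∂̄` on real elements, so half the imaginary part of `c` works
  obtain ⟨q, hq⟩ := exists_incl_eq (a := (-(Complex.I / 4)) • (c - A.conj c)) (by
    rw [A.conj.map_smulₛₗ, map_sub, A.conj_conj, map_neg, map_div₀, Complex.conj_I,
      ← neg_sub c, smul_neg, ← neg_smul]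
    congr 1
    have : (starRingEnd ℂ) 4 = 4 := Complex.conj_ofNat 4
    rw [this]; ring)
  refine ⟨q, incl_injective ?_⟩
  have h : A.del (A.delbar (A.conj c)) = -A.incl z := by
    rw [← A.conj_del, ← A.conj_delbar, eq_neg_of_add_eq_zero_right (A.del_delbar c), hc, map_neg,
      conj_incl]
  rw [incl_d_dc, hq, map_smul, map_smul, map_sub, map_sub, hc, h, smul_smul, sub_neg_eq_add,
    ← two_smul ℂ, smul_smul]
  convert one_smul ℂ _
  linear_combination (-1 : ℂ) * Complex.I_sq

theorem del_eq_zero {z : A.toReal.carrier} (hz : A.toReal.d z = 0) (hz' : A.dc z = 0) :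
    A.del (A.incl z) = 0 ∧ A.delbar (A.incl z) = 0 := by
  have h := congrArg A.incl hz
  have h' := congrArg A.incl hz'
  rw [incl_dc, map_zero, smul_eq_zero_iff_right Complex.I_ne_zero, sub_eq_zero] at h'
  rw [incl_d, map_zero, h', ← two_smul ℂ, smul_eq_zero_iff_right two_ne_zero] at h
  exact ⟨h, h'.trans h⟩

theorem d_eq_zero_of_del {z : A.toReal.carrier} (hz : A.del (A.incl z) = 0)
    (hz' : A.delbar (A.incl z) = 0) : A.toReal.d z = 0 :=
  incl_injective (by rw [incl_d, hz, hz', map_zero, add_zero])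

theorem exists_homogeneous_d_dc {l m : ℤ} (h : l + 2 = m) {z : A.toReal.carrier}
    (hz : z ∈ A.toReal.gr m) (hq : ∃ q, A.toReal.d (A.dc q) = z) :
    ∃ q ∈ A.toReal.gr l, A.toReal.d (A.dc q) = z := by
  obtain ⟨q, rfl⟩ := hq
  refine ⟨gproj A.toReal.isInternal {l} q, gproj_mem _ _ _, ?_⟩
  rw [← gproj_dc, ← CDGA.gproj_d, add_assoc, one_add_one_eq_two, h, CDGA.gproj_of_mem_self hz]

/-- The `ddᶜ`-lemma for `d`-exact elements. -/
theorem exists_d_dc_of_d (hA : A.DdbarProperty) {l m : ℤ} (h : l + 2 = m) {z : A.toReal.carrier}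
    (hz : z ∈ A.toReal.gr m) (hdc : A.dc z = 0) (hd : ∃ a, A.toReal.d a = z) :
    ∃ q ∈ A.toReal.gr l, A.toReal.d (A.dc q) = z := by
  refine exists_homogeneous_d_dc h hz ?_
  obtain ⟨a, rfl⟩ := hd
  obtain ⟨h1, h2⟩ := del_eq_zero (A.toReal.d_d a) hdc
  obtain ⟨c, hc⟩ := (A.cls_eq_zero _).1 (hA ⟨A.incl (A.toReal.d a), h1, h2⟩ ⟨A.incl a, rfl⟩)
  exact exists_d_dc_of_del_delbar hc

/-- The `ddᶜ`-lemma for `dᶜ`-exact elements. -/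
theorem exists_d_dc_of_dc (hA : A.DdbarProperty) {l m : ℤ} (h : l + 2 = m) {z : A.toReal.carrier}
    (hz : z ∈ A.toReal.gr m) (hd : A.toReal.d z = 0) (hdc : z ∈ LinearMap.range A.dc) :
    ∃ q ∈ A.toReal.gr l, A.toReal.d (A.dc q) = z := by
  refine exists_homogeneous_d_dc h hz ?_
  obtain ⟨a, rfl⟩ := hdc
  have ha : A.del (A.delbar (A.incl a)) = 0 := by
    have := congrArg A.incl hd
    rwa [incl_d_dc, map_zero, smul_eq_zero_iff_right
      (mul_ne_zero two_ne_zero Complex.I_ne_zero)] at this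
  obtain ⟨⟨b, hb⟩, c, hc⟩ := exists_del_delbar_of_components hA ha
  refine exists_d_dc_of_del_delbar (c := Complex.I • (c - b)) ?_
  rw [map_smul, map_smul, map_sub, map_sub, hb, hc, incl_dc]

theorem incl_toRealMap (f : A ⟶ B) (a : A.toReal.carrier) :
    B.incl (CDGA.Hom.toAlgHom (toRealMap f) a) = Hom.toAlgHom f (A.incl a) := rfl

theorem toRealMap_dc (f : A ⟶ B) (a : A.toReal.carrier) :
    CDGA.Hom.toAlgHom (toRealMap f) (A.dc a) = B.dc (CDGA.Hom.toAlgHom (toRealMap f) a) := by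
  apply incl_injective
  rw [incl_toRealMap, incl_dc, incl_dc, map_smul, map_sub, Hom.map_del, Hom.map_delbar,
    incl_toRealMap]

/-- Under the `∂∂̄`-property every real class has a `dᶜ`-closed representative. -/
theorem exists_dc_closed (hA : A.DdbarProperty) {z : A.toReal.carrier} (hz : A.toReal.d z = 0) :
    ∃ q, A.dc (z + A.toReal.d q) = 0 := by
  have ha : A.del (A.delbar (A.incl (z))) = 0 := by
    have := congrArg A.incl (d_dc z)
    rwa [hz, map_zero, neg_zero, incl_d_dc, map_zero, smul_eq_zero_iff_right
      (mul_ne_zero two_ne_zero Complex.I_ne_zero)] at this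
  obtain ⟨⟨b, hb⟩, c, hc⟩ := exists_del_delbar_of_components hA ha
  obtain ⟨q, hq⟩ := exists_d_dc_of_del_delbar (z := A.dc z) (c := Complex.I • (c - b)) (by
    rw [map_smul, map_smul, map_sub, map_sub, hb, hc, incl_dc])
  refine ⟨q, ?_⟩
  rw [map_add, ← hq, d_dc, neg_add_cancel]

/-- A pluripotential quasi-isomorphism between algebras with the `∂∂̄`-property is a
quasi-isomorphism of the underlying real cdga's. -/
theorem IsPluriQuasiIso.quasiIso_toRealMap {f : A ⟶ B} (hf : IsPluriQuasiIso f)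
    (hA : A.DdbarProperty) (hB : B.DdbarProperty) : CDGA.quasiIso ℝ (toRealMap f) := by
  rw [CDGA.quasiIso_iff]
  constructor
  · rintro z hz ⟨y, hy⟩
    obtain ⟨q, hq⟩ := exists_dc_closed hA hz
    obtain ⟨h1, h2⟩ := del_eq_zero (z := z + A.toReal.d q) (by
      rw [map_add, hz, A.toReal.d_d, add_zero]) hq
    set z' := z + A.toReal.d q with hz'
    obtain ⟨c, hc⟩ := hf.exists_of_map h1 h2 ((B.cls_eq_zero ⟨Hom.toAlgHom f (A.incl z'), by
      rw [← Hom.map_del, h1, map_zero], by rw [← Hom.map_delbar, h2, map_zero]⟩).1 (hB _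
      ⟨B.incl (y + CDGA.Hom.toAlgHom (toRealMap f) q), by
        rw [← incl_d, map_add, hy, ← CDGA.Hom.map_d, ← map_add]; rfl⟩))
    obtain ⟨t, ht⟩ := exists_d_dc_of_del_delbar hc
    exact ⟨A.dc t - q, by rw [map_sub, ht, hz', add_sub_cancel_right]⟩
  · intro w hw
    obtain ⟨q, hq⟩ := exists_dc_closed hB hw
    obtain ⟨h1, h2⟩ := del_eq_zero (z := w + B.toReal.d q) (by
      rw [map_add, hw, B.toReal.d_d, add_zero]) hq
    set w' := w + B.toReal.d q with hw'
    clear_value w'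
    obtain ⟨z, hz, hz', y, hy⟩ := hf.exists_preimage h1 h2
    -- replace `z` by its real part
    obtain ⟨x, hx⟩ := exists_incl_eq (a := (1 / 2 : ℂ) • (z + A.conj z)) (by
      rw [A.conj.map_smulₛₗ, map_add, A.conj_conj, add_comm]
      congr 1
      simp [Complex.conj_ofNat])
    have hdx : A.toReal.d x = 0 := d_eq_zero_of_del
      (by rw [hx, map_smul, map_add, ← A.conj_delbar, hz, hz', map_zero, add_zero, smul_zero])
      (by rw [hx, map_smul, map_add, ← A.conj_del, hz, hz', map_zero, add_zero, smul_zero])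
    obtain ⟨t, ht⟩ := exists_d_dc_of_del_delbar (z := CDGA.Hom.toAlgHom (toRealMap f) x - w')
      (c := (1 / 2 : ℂ) • (y - B.conj y)) (by
      have hy' : B.del (B.delbar (B.conj y)) = -(Hom.toAlgHom f (A.conj z) - B.incl w') := by
        rw [← B.conj_del, ← B.conj_delbar, eq_neg_of_add_eq_zero_right (B.del_delbar y), hy,
          map_neg, map_sub, conj_incl, Hom.map_conj]
      rw [map_smul, map_smul, map_sub, map_sub, hy, hy', map_sub, incl_toRealMap, hx, map_smul,
        map_add]
      module)
    refine ⟨x, hdx, B.dc t + q, ?_⟩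
    rw [map_add, ht, hw']
    abel

end RCBBA
end

noncomputable section

/-! ### Canonical Massey systems -/

namespace RCBBA

open CDGA

variable {A B : RCBBA}

/-- A Massey system is canonical if its cocycles are `dᶜ`-closed and its primitives are
`dᶜ`-exact. Such systems become trivial along the formality quasi-isomorphisms
`A ← ker dᶜ → ker dᶜ / im dᶜ`. -/
structure IsCanonical (S : MasseySystem A.toReal) : Prop where
  dc_α : A.dc S.α = 0
  dc_x : A.dc S.x = 0
  dc_y : A.dc S.y = 0
  b_mem : S.b ∈ LinearMap.range A.dc
  e_mem : S.e ∈ LinearMap.range A.dc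
  p_mem : S.p ∈ LinearMap.range A.dc

theorem dc_eq_zero_of_mem_range {a : A.toReal.carrier} (ha : a ∈ LinearMap.range A.dc) :
    A.dc a = 0 := by
  obtain ⟨c, rfl⟩ := ha
  exact dc_dc c

theorem mul_mem_range_dc {a w : A.toReal.carrier} (ha : a ∈ LinearMap.range A.dc)
    (hw : A.dc w = 0) : a * w ∈ LinearMap.range A.dc := by
  obtain ⟨c, rfl⟩ := ha
  exact ⟨c * w, dc_mul hw c⟩

theorem mul_mem_range_dc_of_even {a w : A.toReal.carrier} (hw : A.dc w = 0)
    (hw' : w ∈ A.toReal.gr 2) (ha : a ∈ LinearMap.range A.dc) : w * a ∈ LinearMap.range A.dc := by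
  rw [mul_comm_of_even even_two hw']
  exact mul_mem_range_dc ha hw

theorem dc_d_of_mem_range {a : A.toReal.carrier} (ha : a ∈ LinearMap.range A.dc) :
    A.dc (A.toReal.d a) = 0 := by
  rw [← neg_eq_zero, ← d_dc, dc_eq_zero_of_mem_range ha, map_zero]

/-- The image of `dᶜ` is `d`-acyclic under the `∂∂̄`-property. -/
theorem exists_primitive_mem_range (hA : A.DdbarProperty) {n m : ℤ} (h : n + 1 = m)
    {z : A.toReal.carrier} (hz : z ∈ A.toReal.gr m) (hd : A.toReal.d z = 0)
    (hdc : z ∈ LinearMap.range A.dc) :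
    ∃ a ∈ A.toReal.gr n, a ∈ LinearMap.range A.dc ∧ A.toReal.d a = z := by
  obtain ⟨q, hq, rfl⟩ := exists_d_dc_of_dc hA (l := n - 1) (by omega) hz hd hdc
  exact ⟨A.dc q, dc_mem (by omega) hq, ⟨q, rfl⟩, rfl⟩

theorem exists_primitive_mem_range_of_exact (hA : A.DdbarProperty) {n m : ℤ} (h : n + 1 = m)
    {z : A.toReal.carrier} (hz : z ∈ A.toReal.gr m) (hdc : A.dc z = 0)
    (hd : ∃ a, A.toReal.d a = z) :
    ∃ a ∈ A.toReal.gr n, a ∈ LinearMap.range A.dc ∧ A.toReal.d a = z := by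
  obtain ⟨q, hq, rfl⟩ := exists_d_dc_of_d hA (l := n - 1) (by omega) hz hdc hd
  exact ⟨A.dc q, dc_mem (by omega) hq, ⟨q, rfl⟩, rfl⟩

/-- Every cohomology class has a `dᶜ`-closed representative of the same degree. -/
theorem exists_homogeneous_dc_closed (hA : A.DdbarProperty) {n m : ℤ} (h : n + 1 = m)
    {z : A.toReal.carrier} (hz : z ∈ A.toReal.gr m) (hd : A.toReal.d z = 0) :
    ∃ r ∈ A.toReal.gr n, A.dc (z + A.toReal.d r) = 0 := by
  obtain ⟨q, hq⟩ := exists_dc_closed hA hd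
  refine ⟨gproj A.toReal.isInternal {n} q, gproj_mem _ _ _, ?_⟩
  have h1 := congrArg (gproj A.toReal.isInternal {m + 1}) hq
  rw [gproj_dc, map_add, map_zero, gproj_of_mem_self hz, ← h, CDGA.gproj_d] at h1
  exact h1

/-- Two Massey systems have the same classes if their cocycles are cohomologous. -/
structure _root_.CDGA.MasseySystem.SameClasses {k : Type} [Field k] {A : CDGA k}
    (S T : MasseySystem A) : Prop where
  α : ∃ r, A.d r = T.α - S.α
  x : ∃ r, A.d r = T.x - S.x
  y : ∃ r, A.d r = T.y - S.y

/-- A canonical Massey system is determined by its classes, up to homotopy. -/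
theorem IsCanonical.equiv (hA : A.DdbarProperty) {S T : MasseySystem A.toReal}
    (hS : IsCanonical S) (hT : IsCanonical T) (h : S.SameClasses T) : S ≈ T := by
  obtain ⟨r, hr, hr', hdr⟩ := exists_primitive_mem_range_of_exact hA (n := 1) (by norm_num)
    (sub_mem T.α_mem S.α_mem) (by rw [map_sub, hT.dc_α, hS.dc_α, sub_self]) h.α
  obtain ⟨s, hs, hs', hds⟩ := exists_primitive_mem_range_of_exact hA (n := 1) (by norm_num)
    (sub_mem T.x_mem S.x_mem) (by rw [map_sub, hT.dc_x, hS.dc_x, sub_self]) h.x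
  obtain ⟨u, hu, hu', hdu⟩ := exists_primitive_mem_range_of_exact hA (n := 1) (by norm_num)
    (sub_mem T.y_mem S.y_mem) (by rw [map_sub, hT.dc_y, hS.dc_y, sub_self]) h.y
  have hα : S.α + A.toReal.d r = T.α := by rw [hdr]; abel
  have hx : S.x + A.toReal.d s = T.x := by rw [hds]; abel
  have hy : S.y + A.toReal.d u = T.y := by rw [hdu]; abel
  have hr2 : A.toReal.d r ∈ A.toReal.gr 2 := d_mem' (by norm_num) hr
  have hu2 : A.toReal.d u ∈ A.toReal.gr 2 := d_mem' (by norm_num) hu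
  let h₁ : Gauge A.toReal := ⟨r, s, u, 0, 0, 0, hr, hs, hu, zero_mem _, zero_mem _, zero_mem _⟩
  have h₁α : (S.act h₁).α = T.α := hα
  have h₁x : (S.act h₁).x = T.x := hx
  have h₁y : (S.act h₁).y = T.y := hy
  obtain ⟨v, hv, hv', hdv⟩ := exists_primitive_mem_range hA (n := 2) (by norm_num)
    (sub_mem T.b_mem (S.act h₁).b_mem) (by
      rw [map_sub, T.d_b, (S.act h₁).d_b, h₁α, h₁x, sub_self]) (by
      refine sub_mem hT.b_mem (add_mem (add_mem (add_mem (add_mem hS.b_mem ?_) ?_) ?_) ?_)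
      · exact mul_mem_range_dc_of_even hS.dc_x S.x_mem hr'
      · exact mul_mem_range_dc_of_even hS.dc_α S.α_mem hs'
      · exact mul_mem_range_dc_of_even (dc_d_of_mem_range hr') hr2 hs'
      · exact ⟨0, by simp [h₁]⟩)
  obtain ⟨w, hw, hw', hdw⟩ := exists_primitive_mem_range hA (n := 2) (by norm_num)
    (sub_mem T.e_mem (S.act h₁).e_mem) (by
      rw [map_sub, T.d_e, (S.act h₁).d_e, h₁y, h₁x, sub_self]) (by
      refine sub_mem hT.e_mem (add_mem (add_mem (add_mem (add_mem hS.e_mem ?_) ?_) ?_) ?_)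
      · exact mul_mem_range_dc_of_even hS.dc_x S.x_mem hu'
      · exact mul_mem_range_dc_of_even hS.dc_y S.y_mem hs'
      · exact mul_mem_range_dc_of_even (dc_d_of_mem_range hu') hu2 hs'
      · exact ⟨0, by simp [h₁]⟩)
  let h₂ : Gauge A.toReal := ⟨r, s, u, v, w, 0, hr, hs, hu, hv, hw, zero_mem _⟩
  have h₂α : (S.act h₂).α = T.α := hα
  have h₂y : (S.act h₂).y = T.y := hy
  have h₂b : (S.act h₂).b = T.b := by
    rw [← add_sub_cancel (S.act h₁).b T.b, ← hdv]
    simp [MasseySystem.act, h₁, h₂]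
  have h₂e : (S.act h₂).e = T.e := by
    rw [← add_sub_cancel (S.act h₁).e T.e, ← hdw]
    simp [MasseySystem.act, h₁, h₂]
  obtain ⟨q, hq, -, hdq⟩ := exists_primitive_mem_range hA (n := 3) (by norm_num)
    (sub_mem T.p_mem (S.act h₂).p_mem) (by
      rw [map_sub, T.d_p, (S.act h₂).d_p, h₂α, h₂y, h₂b, h₂e, sub_self]) (by
      refine sub_mem hT.p_mem (add_mem (sub_mem (add_mem (sub_mem (sub_mem (add_mem hS.p_mem ?_)
        ?_) ?_) ?_) ?_) ?_)
      · exact mul_mem_range_dc hS.e_mem (dc_eq_zero_of_mem_range hr')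
      · exact mul_mem_range_dc hS.b_mem (dc_eq_zero_of_mem_range hu')
      · exact mul_mem_range_dc_of_even hS.dc_x S.x_mem
          (mul_mem_range_dc hr' (dc_eq_zero_of_mem_range hu'))
      · change (S.y + A.toReal.d u) * v ∈ _
        rw [hy]
        exact mul_mem_range_dc_of_even hT.dc_y T.y_mem hv'
      · change (S.α + A.toReal.d r) * w ∈ _
        rw [hα]
        exact mul_mem_range_dc_of_even hT.dc_α T.α_mem hw'
      · exact ⟨0, by simp [h₂]⟩)
  refine ⟨⟨r, s, u, v, w, q, hr, hs, hu, hv, hw, hq⟩, ?_⟩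
  ext
  · exact hα
  · exact hx
  · exact hy
  · exact h₂b
  · exact h₂e
  · rw [← add_sub_cancel (S.act h₂).p T.p, ← hdq]
    simp [MasseySystem.act, h₂]

/-- The classes of a Massey system are the classes of a canonical one. -/
theorem exists_isCanonical (hA : A.DdbarProperty) (S : MasseySystem A.toReal) :
    ∃ T : MasseySystem A.toReal, IsCanonical T ∧ S.SameClasses T := by
  obtain ⟨r, hr, hr'⟩ := exists_homogeneous_dc_closed hA (n := 1) (by norm_num) S.α_mem S.d_α
  obtain ⟨s, hs, hs'⟩ := exists_homogeneous_dc_closed hA (n := 1) (by norm_num) S.x_mem S.d_x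
  obtain ⟨u, hu, hu'⟩ := exists_homogeneous_dc_closed hA (n := 1) (by norm_num) S.y_mem S.d_y
  set T := S.act ⟨r, s, u, 0, 0, 0, hr, hs, hu, zero_mem _, zero_mem _, zero_mem _⟩
  have hα : A.dc T.α = 0 := hr'
  have hx : A.dc T.x = 0 := hs'
  have hy : A.dc T.y = 0 := hu'
  obtain ⟨b, hb, hb', hdb⟩ := exists_primitive_mem_range_of_exact hA (n := 3) (m := 4)
    (by norm_num)
    (mul_mem' (by norm_num) T.x_mem T.α_mem) (by rw [dc_mul hα, hx, zero_mul]) ⟨T.b, T.d_b⟩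
  obtain ⟨e, he, he', hde⟩ := exists_primitive_mem_range_of_exact hA (n := 3) (m := 4)
    (by norm_num)
    (mul_mem' (by norm_num) T.x_mem T.y_mem) (by rw [dc_mul hy, hx, zero_mul]) ⟨T.e, T.d_e⟩
  obtain ⟨p, hp, hp', hdp⟩ := exists_primitive_mem_range hA (n := 4) (m := 5) (by norm_num)
    (sub_mem (mul_mem' (by norm_num) T.y_mem hb) (mul_mem' (by norm_num) T.α_mem he))
    (by
      rw [map_sub, leibniz_of_even even_two T.y_mem, leibniz_of_even even_two T.α_mem, T.d_y,
        T.d_α, hdb, hde, ← mul_assoc, ← mul_assoc, mul_comm_of_even even_two T.α_mem T.x,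
        mul_comm_of_even even_two T.y_mem, mul_assoc T.x, mul_assoc T.x,
        mul_comm_of_even even_two T.α_mem T.y]
      simp)
    (sub_mem (mul_mem_range_dc_of_even hy T.y_mem hb')
      (mul_mem_range_dc_of_even hα T.α_mem he'))
  exact ⟨⟨T.α, T.x, T.y, b, e, p, T.α_mem, T.x_mem, T.y_mem, hb, he, hp, T.d_α, T.d_x, T.d_y,
    hdb, hde, hdp⟩, ⟨hα, hx, hy, hb', he', hp'⟩,
    ⟨r, (add_sub_cancel_left _ _).symm⟩, ⟨s, (add_sub_cancel_left _ _).symm⟩,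
    ⟨u, (add_sub_cancel_left _ _).symm⟩⟩

theorem IsCanonical.map (f : A ⟶ B) {S : MasseySystem A.toReal} (hS : IsCanonical S) :
    IsCanonical (S.map (CDGA.Hom.toDG (toRealMap f))) := by
  have h0 {z : A.toReal.carrier} (hz : A.dc z = 0) :
      B.dc (CDGA.Hom.toAlgHom (toRealMap f) z) = 0 := by rw [← toRealMap_dc, hz, map_zero]
  have h1 {z : A.toReal.carrier} (hz : z ∈ LinearMap.range A.dc) :
      CDGA.Hom.toAlgHom (toRealMap f) z ∈ LinearMap.range B.dc := by
    obtain ⟨a, rfl⟩ := hz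
    exact ⟨_, (toRealMap_dc f a).symm⟩
  exact ⟨h0 hS.dc_α, h0 hS.dc_x, h0 hS.dc_y, h1 hS.b_mem, h1 hS.e_mem, h1 hS.p_mem⟩

end RCBBA

namespace CDGA.MasseySystem

variable {k K : Type} [Field k] [Field K] {A : CDGA k} {B : CDGA K}

theorem sameClasses_of_equiv {S T : MasseySystem A} (h : S ≈ T) : S.SameClasses T := by
  obtain ⟨h, rfl⟩ := h
  exact ⟨⟨h.r, (add_sub_cancel_left _ _).symm⟩, ⟨h.s, (add_sub_cancel_left _ _).symm⟩,
    ⟨h.u, (add_sub_cancel_left _ _).symm⟩⟩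

theorem SameClasses.trans {S T U : MasseySystem A} (h : S.SameClasses T) (h' : T.SameClasses U) :
    S.SameClasses U := by
  have key {a b c : A.carrier} (h : ∃ r, A.d r = b - a) (h' : ∃ r, A.d r = c - b) :
      ∃ r, A.d r = c - a := by
    obtain ⟨r, hr⟩ := h
    obtain ⟨s, hs⟩ := h'
    exact ⟨r + s, by rw [map_add, hr, hs]; abel⟩
  exact ⟨key h.α h'.α, key h.x h'.x, key h.y h'.y⟩

theorem SameClasses.map (g : DGRingHom A B) {S T : MasseySystem A} (h : S.SameClasses T) :
    (S.map g).SameClasses (T.map g) := by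
  have key {a b : A.carrier} (h : ∃ r, A.d r = b - a) :
      ∃ r, B.d r = g.toRingHom b - g.toRingHom a := by
    obtain ⟨r, hr⟩ := h
    exact ⟨g.toRingHom r, by rw [← g.map_d, hr, map_sub]⟩
  exact ⟨key h.α, key h.x, key h.y⟩

theorem SameClasses.of_map {A B : CDGA k} {f : A ⟶ B} (hf : quasiIso k f) {S T : MasseySystem A}
    (h : (S.map (Hom.toDG f)).SameClasses (T.map (Hom.toDG f))) : S.SameClasses T := by
  have key {a b : A.carrier} (ha : A.d a = 0) (hb : A.d b = 0)
      (h : ∃ r, B.d r = Hom.toAlgHom f b - Hom.toAlgHom f a) : ∃ r, A.d r = b - a := by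
    rw [← map_sub] at h
    exact ((quasiIso_iff f).1 hf).1 _ (by rw [map_sub, ha, hb, sub_self]) h
  exact ⟨key S.d_α T.d_α h.α, key S.d_x T.d_x h.x, key S.d_y T.d_y h.y⟩

end CDGA.MasseySystem
end

noncomputable section

/-! ### The invariant of cbba's with rational structure -/

/-- A morphism that becomes invertible in the homotopy category is a quasi-isomorphism. -/
theorem CDGA.quasiIso_of_isIso {k : Type} [Field k] {A B : CDGA k} (f : A ⟶ B)
    [IsIso ((CDGA.quasiIso k).Q.map f)] : CDGA.quasiIso k f := by
  have h : IsIso ((CDGA.hoCoh k).map ((CDGA.quasiIso k).Q.map f)) := inferInstance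
  replace h : IsIso ((CDGA.cohFunctor k).map f) := h
  exact (ConcreteCategory.isIso_iff_bijective _).1 h

namespace RatCBBA

open CDGA RCBBA

/-- The classes of every rational Massey system are represented by a rational Massey system that
`φ` carries to a canonical one. -/
def HasRationalCanonicalSystems (X : RatCBBA) : Prop :=
  ∀ S : MasseySystem X.Q, ∃ S' : MasseySystem X.Q, S.SameClasses S' ∧
    ∃ T : MasseySystem X.C.toReal, IsCanonical T ∧
      (hoMassey ℝ).map X.φ.hom (⟦S'.map (toExtend ℝ X.Q)⟧ : (masseyFunctor ℝ).obj _) =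
        (⟦T⟧ : (masseyFunctor ℝ).obj _)

variable {X Y : RatCBBA}

/-- The rational part of a morphism is a quasi-isomorphism if the real part is one, because it
becomes an isomorphism in the homotopy category after extension of scalars. -/
theorem Hom.quasiIso_homQ (f : Hom X Y) (hf : CDGA.quasiIso ℝ (toRealMap f.homC)) :
    CDGA.quasiIso ℚ f.homQ := by
  have h1 : IsIso ((CDGA.quasiIso ℝ).Q.map (toRealMap f.homC)) := (hoIso _ hf).isIso_hom
  have h2 : IsIso ((CDGA.quasiIso ℝ).Q.map (extendMap ℝ f.homQ) ≫ Y.φ.hom) := by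
    rw [f.comm]; infer_instance
  have h3 := IsIso.of_isIso_comp_right ((CDGA.quasiIso ℝ).Q.map (extendMap ℝ f.homQ)) Y.φ.hom
  exact (quasiIso_extendMap_iff ℝ f.homQ).1 (quasiIso_of_isIso _)

theorem map_toExtend {k : Type} [Field k] (K : Type) [Field K] [Algebra k K] {A B : CDGA k}
    (f : A ⟶ B) (S : MasseySystem A) : (S.map (Hom.toDG f)).map (toExtend K B) =
      (S.map (toExtend K A)).map (Hom.toDG (extendMap K f)) := by
  have key (a : A.carrier) : ((1 : K) ⊗ₜ[k] CDGA.Hom.toAlgHom f a : K ⊗[k] B.carrier) =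
    Algebra.TensorProduct.map (AlgHom.id K K) (CDGA.Hom.toAlgHom f) ((1 : K) ⊗ₜ[k] a) := by
    rw [Algebra.TensorProduct.map_tmul]; rfl
  ext
  · exact key S.α
  · exact key S.x
  · exact key S.y
  · exact key S.b
  · exact key S.e
  · exact key S.p

/-- Morphisms of cbba's with rational structure are compatible with the transport of Massey systems
from the rational to the complex part. -/
theorem Hom.hoMassey_map (f : Hom X Y) (S : MasseySystem X.Q) {T : MasseySystem X.C.toReal}
    (h : (hoMassey ℝ).map X.φ.hom (⟦S.map (toExtend ℝ X.Q)⟧ : (masseyFunctor ℝ).obj _) =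
      (⟦T⟧ : (masseyFunctor ℝ).obj _)) :
    (hoMassey ℝ).map Y.φ.hom
      (⟦(S.map (CDGA.Hom.toDG f.homQ)).map (toExtend ℝ Y.Q)⟧ : (masseyFunctor ℝ).obj _) =
      (⟦T.map (CDGA.Hom.toDG (toRealMap f.homC))⟧ : (masseyFunctor ℝ).obj _) := by
  have h1 := congrArg (fun g => (hoMassey ℝ).map g
    (⟦S.map (toExtend ℝ X.Q)⟧ : (masseyFunctor ℝ).obj _)) f.comm
  simp only [Functor.map_comp] at h1
  rw [map_toExtend, ← hoMassey_map_Q, ← hoMassey_map_Q, ← h]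
  exact h1

/-- The condition on canonical systems is invariant under quasi-isomorphisms. -/
theorem Hom.hasRationalCanonicalSystems_iff (f : Hom X Y) (hf : f.IsQuasiIso)
    (hX : X.C.DdbarProperty) :
    X.HasRationalCanonicalSystems ↔ Y.HasRationalCanonicalSystems := by
  have hY : Y.C.DdbarProperty := (IsPluriQuasiIso.ddbarProperty_iff hf).1 hX
  have hC := IsPluriQuasiIso.quasiIso_toRealMap hf hX hY
  have hQ := f.quasiIso_homQ hC
  constructor
  · intro h S
    obtain ⟨R, hR⟩ := MasseySystem.exists_lift hQ S
    obtain ⟨R', hR', T, hT, hRT⟩ := h R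
    exact ⟨R'.map (CDGA.Hom.toDG f.homQ), (MasseySystem.sameClasses_of_equiv hR).trans (hR'.map _),
      T.map (CDGA.Hom.toDG (toRealMap f.homC)), hT.map _, f.hoMassey_map R' hRT⟩
  · intro h S
    obtain ⟨R', hR', T, hT, hRT⟩ := h (S.map (CDGA.Hom.toDG f.homQ))
    obtain ⟨S', hS'⟩ := MasseySystem.exists_lift hQ R'
    obtain ⟨U, hU⟩ := Quotient.exists_rep
      (((hoMassey ℝ).map X.φ.hom (⟦S'.map (toExtend ℝ X.Q)⟧ : (masseyFunctor ℝ).obj _) :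
        (masseyFunctor ℝ).obj _) : Quotient _)
    -- the system `U` is canonical up to homotopy, because its image in `Y` is
    obtain ⟨V, hV, hUV⟩ := exists_isCanonical hX U
    have hTU : T ≈ U.map (CDGA.Hom.toDG (toRealMap f.homC)) := by
      refine Quotient.exact (?_ : (⟦T⟧ : (masseyFunctor ℝ).obj _) = _)
      rw [← hRT]
      refine Eq.trans ?_ (f.hoMassey_map S' hU.symm)
      congr 1
      exact Quotient.sound (MasseySystem.map_equiv _ hS')
    have hTV := hT.equiv hY (hV.map f.homC)
      ((MasseySystem.sameClasses_of_equiv hTU).trans (hUV.map _))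
    have hUV' : U ≈ V := MasseySystem.equiv_of_map_equiv hC (Setoid.trans (Setoid.symm hTU) hTV)
    exact ⟨S', MasseySystem.SameClasses.of_map hQ
      (hR'.trans (MasseySystem.sameClasses_of_equiv hS')), V, hV,
      hU.symm.trans (Quotient.sound hUV')⟩

theorem hasRationalCanonicalSystems_iff_of_chain
    (h : Relation.EqvGen (fun X Y : RatCBBA => ∃ f : Hom X Y, f.IsQuasiIso) X Y) :
    (X.C.DdbarProperty ∧ X.HasRationalCanonicalSystems) ↔
      (Y.C.DdbarProperty ∧ Y.HasRationalCanonicalSystems) := by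
  induction h with
  | rel X Y h =>
    obtain ⟨f, hf⟩ := h
    rw [← IsPluriQuasiIso.ddbarProperty_iff hf]
    exact and_congr_right fun hX => f.hasRationalCanonicalSystems_iff hf hX
  | refl X => exact Iff.rfl
  | symm X Y _ ih => exact ih.symm
  | trans X Y Z _ _ ih ih' => exact ih.trans ih'

theorem _root_.RCBBA.ddbarProperty_of_trivial {A : RCBBA} (h : A.del = 0) (h' : A.delbar = 0) :
    A.DdbarProperty := by
  rintro z ⟨a, ha⟩
  refine (A.cls_eq_zero z).2 ⟨0, ?_⟩
  rw [← ha, h, h']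
  simp

/-- In the cohomology triple the systems with zero primitives are rational and canonical. -/
theorem hasRationalCanonicalSystems_cohomology (X : RatCBBA)
    (h : X.Q.cohomology.extend ℝ ≅ X.C.bottChern.toReal) :
    (X.cohomology h).HasRationalCanonicalSystems := by
  intro (S : MasseySystem X.Q.cohomology)
  let S' : MasseySystem X.Q.cohomology := ⟨S.α, S.x, S.y, 0, 0, 0, S.α_mem, S.x_mem, S.y_mem,
    zero_mem _, zero_mem _, zero_mem _, S.d_α, S.d_x, S.d_y, S.d_b, S.d_e, by
      rw [mul_zero, mul_zero, sub_zero]; rfl⟩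
  refine ⟨S', ⟨⟨0, ?_⟩, ⟨0, ?_⟩, ⟨0, ?_⟩⟩,
    (S'.map (toExtend ℝ X.Q.cohomology)).map (CDGA.Hom.toDG h.hom), ?_, rfl⟩
  · rw [map_zero]; exact (sub_self S.α).symm
  · rw [map_zero]; exact (sub_self S.x).symm
  · rw [map_zero]; exact (sub_self S.y).symm
  have hdc (a : X.C.bottChern.toReal.carrier) : X.C.bottChern.dc a = 0 := by
    apply incl_injective
    rw [incl_dc, map_zero]
    change Complex.I • ((0 : X.C.bottChern.carrier →ₗ[ℂ] X.C.bottChern.carrier) _ -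
      (0 : X.C.bottChern.carrier →ₗ[ℂ] X.C.bottChern.carrier) _) = 0
    simp
  have h0 : (CDGA.Hom.toDG h.hom).toRingHom
      ((toExtend ℝ X.Q.cohomology).toRingHom 0) ∈ LinearMap.range X.C.bottChern.dc := by
    rw [map_zero, map_zero]
    exact zero_mem _
  exact ⟨hdc _, hdc _, hdc _, h0, h0, h0⟩

theorem StronglyFormalOverQ.hasRationalCanonicalSystems (h : X.StronglyFormalOverQ) :
    X.HasRationalCanonicalSystems := by
  obtain ⟨e, -, he⟩ := h
  exact ((hasRationalCanonicalSystems_iff_of_chain he).2 ⟨ddbarProperty_of_trivial rfl rfl,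
    hasRationalCanonicalSystems_cohomology X e⟩).2

end RatCBBA
end

noncomputable section

/-! ### The roof given by `φ` and `ψ` -/

open CDGA RCBBA

theorem algC_toReal_d (a : algC.toReal.carrier) : algC.toReal.d a = 0 := by
  apply incl_injective
  rw [incl_d, map_zero]
  exact add_zero (0 : SumAlg ℂ)

theorem algC_dc (a : algC.toReal.carrier) : algC.dc a = 0 := by
  apply incl_injective
  rw [incl_dc, map_zero]
  change Complex.I • ((0 : SumAlg ℂ) - 0) = 0
  simp

/-- An element of `to(A_ℂ)^σ = H ⊗ ℝ`, as an element of `H ⊗ ℂ`. -/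
def inclSum : algC.toReal.carrier →ₐ[ℝ] SumAlg ℂ := algC.incl

theorem c1_eq_zero_of_mem {n : ℤ} (hn : n ≠ 0) {a : algC.toReal.carrier}
    (ha : a ∈ algC.toReal.gr n) : (inclSum a).c1 = 0 := by
  refine algC.totalGr_induction (p := fun a : SumAlg ℂ => a.c1 = 0) ha rfl
    (fun x y hx hy => by
      change SumAlg.c1 x + SumAlg.c1 y = 0
      rw [hx, hy, add_zero]) ?_
  intro i hi x hx
  exact hx.1 fun h => hn (by rw [← hi, h]; rfl)

theorem algQ_eq_zero_of_mem_three {a : SumAlg ℚ} (ha : a ∈ algQ.gr 3) : a = 0 :=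
  SumAlg.eq_zero_of_mem_gr (fun n h => by omega) ha

section

variable {M : CDGA ℚ} {φ : M ⟶ algQ}

/-- The coordinates of an element of `H ⊗ ℝ`, embedded in `H ⊗ ℂ`. -/
def complexify (u : SumAlg ℝ) : SumAlg ℂ :=
  ⟨u.c1, u.cα, u.cx, u.cy, u.cβ, u.cxx, u.cyy, u.ct⟩

/-- The cocycle of `M ⊗ ℝ` with the given coordinates in cohomology. -/
def ModelGenerators.cocycle (g : ModelGenerators M φ) (u : SumAlg ℝ) : ℝ ⊗[ℚ] M.carrier :=
  u.c1 ⊗ₜ 1 + u.cα ⊗ₜ g.α + u.cx ⊗ₜ g.x + u.cy ⊗ₜ g.y + u.cβ ⊗ₜ g.β + u.cxx ⊗ₜ (g.x * g.x) +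
    u.cyy ⊗ₜ (g.y * g.y) + u.ct ⊗ₜ (g.α * g.β)

theorem ModelGenerators.d_cocycle (g : ModelGenerators M φ) (u : SumAlg ℝ) :
    M.d.baseChange ℝ (g.cocycle u) = 0 := by
  simp only [cocycle, map_add, LinearMap.baseChange_tmul, M.d_one, g.d_α, g.d_x, g.d_y, g.d_β,
    leibniz_of_even even_two g.α_mem, leibniz_of_even even_two g.x_mem,
    leibniz_of_even even_two g.y_mem, zero_mul, mul_zero, add_zero, TensorProduct.tmul_zero]

theorem psiValue_mul (ψ : M.extend ℝ ⟶ algC.toReal) (m n : M.carrier) :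
    psiValue ψ (m * n) = psiValue ψ m * psiValue ψ n := by
  have h : ((1 : ℝ) ⊗ₜ[ℚ] (m * n) : ℝ ⊗[ℚ] M.carrier) = (1 ⊗ₜ m) * (1 ⊗ₜ n) := by
    rw [Algebra.TensorProduct.tmul_mul_tmul, one_mul]
  have h' := congrArg (fun z : (M.extend ℝ).carrier => inclSum (CDGA.Hom.toAlgHom ψ z)) h
  exact h'.trans ((congrArg inclSum (map_mul (CDGA.Hom.toAlgHom ψ) _ _)).trans (map_mul _ _ _))

theorem psiValue_add (ψ : M.extend ℝ ⟶ algC.toReal) (m n : M.carrier) :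
    psiValue ψ (m + n) = psiValue ψ m + psiValue ψ n := by
  have h : ((1 : ℝ) ⊗ₜ[ℚ] (m + n) : ℝ ⊗[ℚ] M.carrier) = (1 ⊗ₜ m) + (1 ⊗ₜ n) :=
    TensorProduct.tmul_add _ _ _
  have h' := congrArg (fun z : (M.extend ℝ).carrier => inclSum (CDGA.Hom.toAlgHom ψ z)) h
  exact h'.trans ((congrArg inclSum (map_add (CDGA.Hom.toAlgHom ψ) _ _)).trans (map_add _ _ _))

theorem psiValue_one (ψ : M.extend ℝ ⟶ algC.toReal) : psiValue ψ 1 = 1 :=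
  (congrArg inclSum (map_one (CDGA.Hom.toAlgHom ψ))).trans (map_one _)

theorem real_smul_eq (r : ℝ) (u : SumAlg ℂ) : r • u = (r : ℂ) • u := by
  rw [← algebraMap_smul ℂ r u]; rfl

theorem inclSum_tmul (ψ : M.extend ℝ ⟶ algC.toReal) (r : ℝ) (m : M.carrier) :
    inclSum (CDGA.Hom.toAlgHom ψ (r ⊗ₜ[ℚ] m : ℝ ⊗[ℚ] M.carrier)) =
      (r : ℂ) • psiValue ψ m := by
  have h : (r ⊗ₜ[ℚ] m : ℝ ⊗[ℚ] M.carrier) = r • ((1 : ℝ) ⊗ₜ[ℚ] m) := by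
    rw [TensorProduct.smul_tmul', smul_eq_mul, mul_one]
  have h' := congrArg (fun z : (M.extend ℝ).carrier => inclSum (CDGA.Hom.toAlgHom ψ z)) h
  refine h'.trans ((congrArg inclSum (map_smul (CDGA.Hom.toAlgHom ψ) _ _)).trans
    ((map_smul inclSum _ _).trans ?_))
  exact real_smul_eq _ _

theorem ModelGenerators.IsPsi.inclSum_cocycle {g : ModelGenerators M φ} {l : ℝ}
    {ψ : M.extend ℝ ⟶ algC.toReal} (hg : g.IsPsi l ψ) (u : SumAlg ℝ) :
    inclSum (CDGA.Hom.toAlgHom ψ (g.cocycle u)) = complexify u := by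
  have hadd (a b : ℝ ⊗[ℚ] M.carrier) : inclSum (CDGA.Hom.toAlgHom ψ (a + b : ℝ ⊗[ℚ] M.carrier)) =
      inclSum (CDGA.Hom.toAlgHom ψ a) + inclSum (CDGA.Hom.toAlgHom ψ b) :=
    (congrArg inclSum (map_add (CDGA.Hom.toAlgHom ψ) _ _)).trans (map_add _ _ _)
  unfold ModelGenerators.cocycle
  simp only [hadd, inclSum_tmul, psiValue_mul, psiValue_one, hg.ψ_α, hg.ψ_x, hg.ψ_y, hg.ψ_β]
  ext <;> simp [complexify, SumAlg.gα, SumAlg.gx, SumAlg.gy, SumAlg.gβ, -Complex.coe_smul]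

/-- Every class of `H ⊗ ℝ` is the image of one of the cocycles `g.cocycle u`. -/
theorem ModelGenerators.exists_cocycle (g : ModelGenerators M φ) (t : ℝ ⊗[ℚ] SumAlg ℚ) :
    ∃ u, Algebra.TensorProduct.map (AlgHom.id ℝ ℝ) (CDGA.Hom.toAlgHom φ) (g.cocycle u) = t := by
  have hφ (u : SumAlg ℝ) :
      Algebra.TensorProduct.map (AlgHom.id ℝ ℝ) (CDGA.Hom.toAlgHom φ) (g.cocycle u) =
      (u.c1 ⊗ₜ[ℚ] 1 + u.cα ⊗ₜ[ℚ] SumAlg.gα + u.cx ⊗ₜ[ℚ] SumAlg.gx + u.cy ⊗ₜ[ℚ] SumAlg.gy +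
        u.cβ ⊗ₜ[ℚ] SumAlg.gβ + u.cxx ⊗ₜ[ℚ] (SumAlg.gx * SumAlg.gx) +
        u.cyy ⊗ₜ[ℚ] (SumAlg.gy * SumAlg.gy) + u.ct ⊗ₜ[ℚ] (SumAlg.gα * SumAlg.gβ) :
          ℝ ⊗[ℚ] SumAlg ℚ) := by
    simp only [ModelGenerators.cocycle, map_add, Algebra.TensorProduct.map_tmul, map_mul, map_one,
      g.φ_α, g.φ_x, g.φ_y, g.φ_β]
    rfl
  simp only [hφ]
  induction t with
  | zero => exact ⟨0, by simp; rfl⟩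
  | add a b ha hb =>
    obtain ⟨u, rfl⟩ := ha
    obtain ⟨v, rfl⟩ := hb
    refine ⟨u + v, ?_⟩
    simp only [SumAlg.add_c1, SumAlg.add_cα, SumAlg.add_cx, SumAlg.add_cy, SumAlg.add_cβ,
      SumAlg.add_cxx, SumAlg.add_cyy, SumAlg.add_ct, TensorProduct.add_tmul]
    abel
  | tmul r v =>
    refine ⟨⟨v.c1 * r, v.cα * r, v.cx * r, v.cy * r, v.cβ * r, v.cxx * r, v.cyy * r, v.ct * r⟩, ?_⟩
    have hv : v = v.c1 • 1 + v.cα • SumAlg.gα + v.cx • SumAlg.gx + v.cy • SumAlg.gy +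
        v.cβ • SumAlg.gβ + v.cxx • (SumAlg.gx * SumAlg.gx) + v.cyy • (SumAlg.gy * SumAlg.gy) +
        v.ct • (SumAlg.gα * SumAlg.gβ) := by
      ext <;> simp [SumAlg.gα, SumAlg.gx, SumAlg.gy, SumAlg.gβ]
    conv_rhs => rw [hv]
    simp only [TensorProduct.tmul_add, TensorProduct.tmul_smul, ← Rat.smul_def,
      TensorProduct.smul_tmul']
    rfl

/-- Every `ψ_λ` is a quasi-isomorphism, because it agrees with `φ` on cohomology. -/
theorem ModelGenerators.IsPsi.quasiIso (hφ : CDGA.quasiIso ℝ (extendMap ℝ φ))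
    {g : ModelGenerators M φ} {l : ℝ} {ψ : M.extend ℝ ⟶ algC.toReal} (hg : g.IsPsi l ψ) :
    CDGA.quasiIso ℝ ψ := by
  rw [CDGA.quasiIso_iff]
  constructor
  · rintro z hz ⟨y, hy⟩
    rw [algC_toReal_d] at hy
    obtain ⟨u, hu⟩ := g.exists_cocycle (CDGA.Hom.toAlgHom (extendMap ℝ φ) z)
    let c : (M.extend ℝ).carrier := g.cocycle u
    have hdc : (M.extend ℝ).d c = 0 := g.d_cocycle u
    have hu' : CDGA.Hom.toAlgHom (extendMap ℝ φ) c = CDGA.Hom.toAlgHom (extendMap ℝ φ) z := hu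
    obtain ⟨a, ha⟩ := ((CDGA.quasiIso_iff _).1 hφ).1 (z - c) (by rw [map_sub, hz, hdc, sub_zero])
      ⟨0, by rw [map_zero, map_sub, hu', sub_self]⟩
    have hc : inclSum (CDGA.Hom.toAlgHom ψ c) = complexify u := hg.inclSum_cocycle u
    have hc0 : CDGA.Hom.toAlgHom ψ c = 0 := by
      have h := congrArg (CDGA.Hom.toAlgHom ψ) ha
      rw [CDGA.Hom.map_d, algC_toReal_d, map_sub, ← hy, zero_sub] at h
      exact neg_eq_zero.1 h.symm
    rw [hc0, map_zero] at hc
    have hu0 : u = 0 := by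
      have h := congrArg (fun v : SumAlg ℂ => (⟨v.c1.re, v.cα.re, v.cx.re, v.cy.re, v.cβ.re,
        v.cxx.re, v.cyy.re, v.ct.re⟩ : SumAlg ℝ)) hc
      exact h.symm
    have hc1 : c = 0 := by
      change g.cocycle u = 0
      simp [hu0, ModelGenerators.cocycle]
    exact ⟨a, by rw [ha, hc1, sub_zero]⟩
  · intro w _
    let v : SumAlg ℂ := inclSum w
    let u : SumAlg ℝ := ⟨v.c1.re, v.cα.re, v.cx.re, v.cy.re, v.cβ.re, v.cxx.re, v.cyy.re, v.ct.re⟩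
    have hv : SumAlg.conj v = v := conj_incl w
    have huv : complexify u = v := by
      have hre (c : ℂ) (h : starRingEnd ℂ c = c) : ((c.re : ℝ) : ℂ) = c :=
        Complex.conj_eq_iff_re.1 h
      have hc {p : SumAlg ℂ → ℂ} : p (SumAlg.conj v) = p v := congrArg p hv
      ext1
      · exact hre _ (hc (p := SumAlg.c1))
      · exact hre _ (hc (p := SumAlg.cα))
      · exact hre _ (hc (p := SumAlg.cx))
      · exact hre _ (hc (p := SumAlg.cy))
      · exact hre _ (hc (p := SumAlg.cβ))
      · exact hre _ (hc (p := SumAlg.cxx))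
      · exact hre _ (hc (p := SumAlg.cyy))
      · exact hre _ (hc (p := SumAlg.ct))
    refine ⟨g.cocycle u, g.d_cocycle u, 0, ?_⟩
    rw [map_zero, eq_comm, sub_eq_zero]
    exact incl_injective ((hg.inclSum_cocycle u).trans huv)

/-- The Massey system of `M` for `⟨α, x, y⟩` whose image under `φ` has last component `t`. -/
def ModelGenerators.system (g : ModelGenerators M φ) (t : SumAlg ℚ) : MasseySystem M where
  α := g.α
  x := g.x
  y := g.y
  b := g.b
  e := g.e
  p := g.p₃ + (t.cβ • g.β + t.cxx • (g.x * g.x) + t.cyy • (g.y * g.y))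
  α_mem := g.α_mem
  x_mem := g.x_mem
  y_mem := g.y_mem
  b_mem := g.b_mem
  e_mem := g.e_mem
  p_mem := add_mem g.p₃_mem (add_mem (add_mem (Submodule.smul_mem _ _ g.β_mem)
    (Submodule.smul_mem _ _ (mul_mem' (by norm_num) g.x_mem g.x_mem)))
    (Submodule.smul_mem _ _ (mul_mem' (by norm_num) g.y_mem g.y_mem)))
  d_α := g.d_α
  d_x := g.d_x
  d_y := g.d_y
  d_b := g.d_b
  d_e := g.d_e
  d_p := by
    simp only [map_add, map_smul, g.d_p₃, g.d_β, leibniz_of_even even_two g.x_mem,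
      leibniz_of_even even_two g.y_mem, g.d_x, g.d_y, zero_mul, mul_zero, add_zero, smul_zero]

/-- A system of `H` on `(α, x, y)` is the image of a system of `M`. -/
theorem ModelGenerators.map_system (g : ModelGenerators M φ) {S : MasseySystem algQ}
    (hα : S.α = SumAlg.gα) (hx : S.x = SumAlg.gx) (hy : S.y = SumAlg.gy) :
    (g.system S.p).map (CDGA.Hom.toDG φ) = S := by
  have h3 {m : M.carrier} (hm : m ∈ M.gr 3) {s : SumAlg ℚ} (hs : s ∈ algQ.gr 3) :
      CDGA.Hom.toAlgHom φ m = s :=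
    (algQ_eq_zero_of_mem_three (CDGA.Hom.map_mem φ hm)).trans (algQ_eq_zero_of_mem_three hs).symm
  ext1
  · exact g.φ_α.trans hα.symm
  · exact g.φ_x.trans hx.symm
  · exact g.φ_y.trans hy.symm
  · exact h3 g.b_mem S.b_mem
  · exact h3 g.e_mem S.e_mem
  · obtain ⟨h0, h1, -, h3⟩ := (S.p_mem : S.p ∈ SumAlg.gr (fun n => 2 * n) 4)
    have h0 := h0 (by norm_num)
    obtain ⟨hα, hx, hy⟩ := h1 (by norm_num)
    have h3 := h3 (by norm_num)
    change CDGA.Hom.toAlgHom φ (_ + _) = _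
    simp only [map_add, map_smul, map_mul, g.φ_β, g.φ_x, g.φ_y, g.φ_p₃]
    generalize S.p = t at *
    have key (t : SumAlg ℚ) (h0 : t.c1 = 0) (hα : t.cα = 0) (hx : t.cx = 0) (hy : t.cy = 0)
        (h3 : t.ct = 0) : (0 : SumAlg ℚ) + (t.cβ • SumAlg.gβ + t.cxx • (SumAlg.gx * SumAlg.gx) +
          t.cyy • (SumAlg.gy * SumAlg.gy)) = t := by
      ext <;> simp [SumAlg.gx, SumAlg.gy, SumAlg.gβ, *]
    exact key t h0 hα hx hy h3

/-- The coefficient of `β` in the image of the last component under `ψ_λ`. -/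
theorem ModelGenerators.IsPsi.cβ_system {g : ModelGenerators M φ} {l : ℝ}
    {ψ : M.extend ℝ ⟶ algC.toReal} (hg : g.IsPsi l ψ) (t : SumAlg ℚ) :
    (psiValue ψ (g.system t).p).cβ = l + t.cβ := by
  have hsmul (q : ℚ) (m : M.carrier) : psiValue ψ (q • m) = ((q : ℝ) : ℂ) • psiValue ψ m := by
    rw [← inclSum_tmul]
    have : ((1 : ℝ) ⊗ₜ[ℚ] (q • m) : ℝ ⊗[ℚ] M.carrier) = (q : ℝ) ⊗ₜ m := by
      rw [TensorProduct.tmul_smul, TensorProduct.smul_tmul', Rat.smul_def, mul_one]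
    exact congrArg (fun z : (M.extend ℝ).carrier => inclSum (CDGA.Hom.toAlgHom ψ z)) this
  simp only [ModelGenerators.system, psiValue_add, psiValue_mul, hsmul, hg.ψ_p₃, hg.ψ_β, hg.ψ_x,
    hg.ψ_y]
  simp [SumAlg.gx, SumAlg.gy, SumAlg.gβ, -Complex.coe_smul]

/-- Homotopies in `H ⊗ ℝ` do not change the coefficient of `β` in the last component: the
differential is zero, and products of elements of nonzero degree have no `β`-component. -/
theorem cβ_act {S : MasseySystem algC.toReal} (h : Gauge algC.toReal) :
    (inclSum (S.act h).p).cβ = (inclSum S.p).cβ := by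
  have hmul {m n : ℤ} (hm : m ≠ 0) (hn : n ≠ 0) {a c : algC.toReal.carrier}
      (ha : a ∈ algC.toReal.gr m) (hc : c ∈ algC.toReal.gr n) :
      (inclSum a * inclSum c).cβ = 0 := by
    rw [SumAlg.mul_cβ, c1_eq_zero_of_mem hm ha, c1_eq_zero_of_mem hn hc, zero_mul, mul_zero,
      add_zero]
  have h1 := hmul (by norm_num) (by norm_num) S.e_mem h.r_mem
  have h2 := hmul (by norm_num) (by norm_num) S.b_mem h.u_mem
  have h3 := hmul (by norm_num) (by norm_num) S.x_mem (algC.toReal.mul_mem h.r_mem h.u_mem)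
  have h4 := hmul (by norm_num) (by norm_num) S.y_mem h.v_mem
  have h5 := hmul (by norm_num) (by norm_num) S.α_mem h.w_mem
  rw [map_mul] at h3
  simp only [MasseySystem.act, algC_toReal_d, add_zero, sub_eq_add_neg, map_add, map_neg, map_mul,
    SumAlg.add_cβ, SumAlg.neg_cβ, h1, h2, h3, h4, h5, neg_zero]

theorem SumAlg.gx_mul_gα {k : Type} [Field k] : (gx * gα : SumAlg k) = 0 := by
  ext <;> simp [gx, gα]

theorem SumAlg.gx_mul_gy {k : Type} [Field k] : (gx * gy : SumAlg k) = 0 := by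
  ext <;> simp [gx, gy]

/-- The system `(α, x, y)` of `H` transported along the roof of `φ` and `ψ_λ` gives `λβ`, up to
rational multiples of `β`. -/
theorem ModelGenerators.IsPsi.not_stronglyFormalOverQ {hφ : CDGA.quasiIso ℝ (extendMap ℝ φ)}
    {g : ModelGenerators M φ} {l : ℝ} {ψ : M.extend ℝ ⟶ algC.toReal} {hψ : CDGA.quasiIso ℝ ψ}
    (hg : g.IsPsi l ψ) (hl : Irrational l) :
    ¬ (roofTriple φ ψ hφ hψ).StronglyFormalOverQ := by
  intro h
  have mem2 (u : SumAlg ℚ) (hu : u.c1 = 0 ∧ u.cβ = 0 ∧ u.cxx = 0 ∧ u.cyy = 0 ∧ u.ct = 0) :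
      u ∈ algQ.gr 2 :=
    ⟨fun _ => hu.1, fun h => absurd rfl h, fun _ => ⟨hu.2.1, hu.2.2.1, hu.2.2.2.1⟩,
      fun _ => hu.2.2.2.2⟩
  let S₀ : MasseySystem algQ := ⟨SumAlg.gα, SumAlg.gx, SumAlg.gy, 0, 0, 0,
    mem2 _ ⟨rfl, rfl, rfl, rfl, rfl⟩, mem2 _ ⟨rfl, rfl, rfl, rfl, rfl⟩,
    mem2 _ ⟨rfl, rfl, rfl, rfl, rfl⟩, zero_mem _, zero_mem _, zero_mem _, rfl, rfl, rfl,
    SumAlg.gx_mul_gα.symm, SumAlg.gx_mul_gy.symm,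
    (sub_self (0 : SumAlg ℚ)).symm.trans
      (congrArg₂ (· - ·) (mul_zero SumAlg.gy).symm (mul_zero SumAlg.gα).symm)⟩
  obtain ⟨S, hS, T, hT, hST⟩ := h.hasRationalCanonicalSystems S₀
  have hα : S.α = SumAlg.gα := by
    obtain ⟨r, hr⟩ := hS.α
    exact sub_eq_zero.1 (hr.symm.trans rfl)
  have hx : S.x = SumAlg.gx := by
    obtain ⟨r, hr⟩ := hS.x
    exact sub_eq_zero.1 (hr.symm.trans rfl)
  have hy : S.y = SumAlg.gy := by
    obtain ⟨r, hr⟩ := hS.y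
    exact sub_eq_zero.1 (hr.symm.trans rfl)
  set N := (g.system S.p).map (toExtend ℝ M)
  have hN : S.map (toExtend ℝ algQ) = N.map (CDGA.Hom.toDG (extendMap ℝ φ)) := by
    rw [← RatCBBA.map_toExtend, g.map_system hα hx hy]
  have h1 : (hoMassey ℝ).map (roofTriple φ ψ hφ hψ).φ.hom
      (⟦S.map (toExtend ℝ algQ)⟧ : (masseyFunctor ℝ).obj _) =
      (⟦N.map (CDGA.Hom.toDG ψ)⟧ : (masseyFunctor ℝ).obj _) := by
    rw [hN]
    have hcomp {X Y Z : (CDGA.quasiIso ℝ).Localization} (e : X ≅ Y) (f : X ⟶ Z)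
        (z : (hoMassey ℝ).obj X) :
        (hoMassey ℝ).map (e.inv ≫ f) ((hoMassey ℝ).map e.hom z) = (hoMassey ℝ).map f z := by
      rw [← ConcreteCategory.comp_apply, ← Functor.map_comp, Iso.hom_inv_id_assoc]
    exact hcomp (hoIso _ hφ) (hoIso ψ hψ).hom ⟦N⟧
  obtain ⟨h2, h3⟩ : N.map (CDGA.Hom.toDG ψ) ≈ T :=
    Quotient.exact (h1.symm.trans hST : (⟦_⟧ : (masseyFunctor ℝ).obj _) = ⟦T⟧)
  have hTp : T.p = 0 := by
    obtain ⟨a, ha⟩ := hT.p_mem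
    exact ha.symm.trans (algC_dc a)
  have h4 := cβ_act (S := N.map (CDGA.Hom.toDG ψ)) h2
  rw [h3, hTp] at h4
  have h5 : (0 : ℂ) = l + S.p.cβ :=
    (congrArg SumAlg.cβ (map_zero inclSum)).symm.trans (h4.trans (hg.cβ_system S.p))
  refine hl ⟨-S.p.cβ, ?_⟩
  have h6 : (0 : ℝ) = l + S.p.cβ := by exact_mod_cast h5
  push_cast
  linarith

end

end

noncomputable section

/-! ### A finite-dimensional model of `H` -/

/-- A homogeneous basis of `SumModel`. The names of products are names of basis elements: in the
model `xx = x * x`, `αb = α * b` and so on; further `t = α * β`, `s` is `α * p₃ = α * p₄` and `τ` is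
the common value of `α * yb`, `αx * c` and the like. -/
inductive SumModel.Gen
  | one | α | x | y | a | b | c | e | αα | αx | αy | xy | xx | yy | β | p₁ | p₂ | p₃ | p₄
  | αb | αc | yb | xc | t | s | τ

open SumModel.Gen in
/-- The cohomological degree of a basis element. -/
def SumModel.Gen.deg : SumModel.Gen → ℤ
  | one => 0
  | α | x | y => 2
  | a | b | c | e => 3
  | αα | αx | αy | xy | xx | yy | β | p₁ | p₂ | p₃ | p₄ => 4
  | αb | αc | yb | xc => 5
  | t | s => 6
  | τ => 7

/-- A `26`-dimensional rational cdga with cohomology `H`, which contains elements `a, …, p₄` as in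
`ModelGenerators`. It is a quotient of the minimal model of `H` by an acyclic ideal; its elements
are given by their coordinates. -/
structure SumModel where
  /-- The coordinates. -/
  coord : SumModel.Gen → ℚ

namespace SumModel

open Gen

instance : CoeFun SumModel fun _ => Gen → ℚ := ⟨coord⟩

@[ext]
theorem ext {u v : SumModel} (h : ∀ i, u i = v i) : u = v :=
  congrArg mk (funext h)

instance : Zero SumModel := ⟨⟨fun _ => 0⟩⟩
instance : Add SumModel := ⟨fun u v => ⟨fun i => u i + v i⟩⟩
instance : Neg SumModel := ⟨fun u => ⟨fun i => -u i⟩⟩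
instance : SMul ℚ SumModel := ⟨fun q u => ⟨fun i => q * u i⟩⟩

@[simp] theorem zero_apply (i : Gen) : (0 : SumModel) i = 0 := rfl
@[simp] theorem add_apply (u v : SumModel) (i : Gen) : (u + v) i = u i + v i := rfl
@[simp] theorem neg_apply (u : SumModel) (i : Gen) : (-u) i = -u i := rfl
@[simp] theorem smul_apply (q : ℚ) (u : SumModel) (i : Gen) : (q • u) i = q * u i := rfl

/-- The contribution to a product of the products of the basis elements `i` and `j`. -/
def pair (u v : SumModel) (i j : Gen) : ℚ := u i * v j + u j * v i

/-- The coordinates of the product of the parts of positive degree of `u` and `v`. -/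
def mulPos (u v : SumModel) : Gen → ℚ
  | αα => u α * v α
  | αx => pair u v α x
  | αy => pair u v α y
  | xy => pair u v x y
  | xx => u x * v x
  | yy => u y * v y
  | αb => pair u v α b
  | αc => pair u v α c
  | yb => pair u v y b
  | xc => pair u v x c
  | t => pair u v α β + pair u v x xx + pair u v y yy
  | s => pair u v α p₃ + pair u v α p₄ - pair u v y p₁ - pair u v x p₂
  | τ => pair u v α yb + pair u v α xc + pair u v y αb + pair u v x αc + pair u v αy b +
      pair u v αx c
  | _ => 0

instance : Mul SumModel where
  mul u v :=
    ⟨fun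
      | one => u one * v one
      | i => pair u v one i + mulPos u v i⟩

instance : One SumModel where
  one :=
    ⟨fun
      | one => 1
      | _ => 0⟩

theorem one_one : (1 : SumModel) one = 1 := rfl

theorem one_apply {i : Gen} (hi : i ≠ one) : (1 : SumModel) i = 0 := by
  cases i <;> first | rfl | exact absurd rfl hi

theorem mul_one_apply (u v : SumModel) : (u * v) one = u one * v one := rfl

theorem mul_apply (u v : SumModel) {i : Gen} (hi : i ≠ one) :
    (u * v) i = pair u v one i + mulPos u v i := by
  cases i <;> first | rfl | exact absurd rfl hi

instance : CommRing SumModel where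
  add_assoc u v w := by ext i; simp [add_assoc]
  zero_add u := by ext i; simp
  add_zero u := by ext i; simp
  add_comm u v := by ext i; simp [add_comm]
  neg_add_cancel u := by ext i; simp
  nsmul := nsmulRec
  zsmul := zsmulRec
  left_distrib u v w := by
    ext i
    cases i <;> simp [mul_one_apply, mul_apply, pair, mulPos] <;> ring
  right_distrib u v w := by
    ext i
    cases i <;> simp [mul_one_apply, mul_apply, pair, mulPos] <;> ring
  zero_mul u := by ext i; cases i <;> simp [mul_one_apply, mul_apply, pair, mulPos]
  mul_zero u := by ext i; cases i <;> simp [mul_one_apply, mul_apply, pair, mulPos]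
  mul_assoc u v w := by
    ext i
    cases i <;> simp [mul_one_apply, mul_apply, pair, mulPos] <;> ring
  one_mul u := by
    ext i; cases i <;> simp [mul_one_apply, mul_apply, pair, mulPos, one_one, one_apply]
  mul_one u := by
    ext i; cases i <;> simp [mul_one_apply, mul_apply, pair, mulPos, one_one, one_apply]
  mul_comm u v := by
    ext i
    cases i <;> simp [mul_one_apply, mul_apply, pair, mulPos] <;> ring

@[simp] theorem sub_apply (u v : SumModel) (i : Gen) : (u - v) i = u i - v i :=
  (sub_eq_add_neg (u i) (v i)).symm

instance : Module ℚ SumModel where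
  one_smul u := by ext i; simp
  mul_smul q r u := by ext i; simp [mul_assoc]
  smul_zero q := by ext i; simp
  smul_add q u v := by ext i; simp [mul_add]
  add_smul q r u := by ext i; simp [add_mul]
  zero_smul u := by ext i; simp

instance : Algebra ℚ SumModel := Algebra.ofModule
  (fun q u v => by
    ext i
    cases i <;> simp [mul_one_apply, mul_apply, pair, mulPos] <;> ring)
  (fun q u v => by
    ext i
    cases i <;> simp [mul_one_apply, mul_apply, pair, mulPos] <;> ring)

/-- The component of degree `n`. -/
def gr (n : ℤ) : Submodule ℚ SumModel where
  carrier := {u | ∀ i, i.deg ≠ n → u i = 0}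
  zero_mem' _ _ := rfl
  add_mem' hu hv i hi := by rw [add_apply, hu i hi, hv i hi, add_zero]
  smul_mem' q u hu i hi := by rw [smul_apply, hu i hi, mul_zero]

/-- The projection to the component of degree `n`. -/
def proj (n : ℤ) : SumModel →ₗ[ℚ] SumModel where
  toFun u := ⟨fun i => if i.deg = n then u i else 0⟩
  map_add' u v := by ext i; simp; split_ifs <;> simp
  map_smul' q u := by ext i; simp

theorem proj_apply (n : ℤ) (u : SumModel) (i : Gen) :
    proj n u i = if i.deg = n then u i else 0 := rfl

theorem isInternal_gr : DirectSum.IsInternal gr := by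
  refine isInternal_of_proj proj ?_ ?_ ?_
  · intro n u hu
    ext i
    rw [proj_apply]
    split_ifs with h
    · rfl
    · exact (hu i h).symm
  · intro m n hmn u hu
    ext i
    rw [proj_apply]
    split_ifs with h
    · exact hu i (h.trans_ne hmn)
    · rfl
  · intro u
    have hu : u = proj 0 u + proj 2 u + proj 3 u + proj 4 u + proj 5 u + proj 6 u + proj 7 u := by
      ext i
      cases i <;> simp [proj_apply, deg]
    have hp (n : ℤ) : proj n u ∈ ⨆ n, gr n :=
      Submodule.mem_iSup_of_mem n fun i hi => if_neg hi
    rw [hu]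
    exact add_mem (add_mem (add_mem (add_mem (add_mem (add_mem (hp _) (hp _)) (hp _)) (hp _))
      (hp _)) (hp _)) (hp _)

theorem mul_mem_gr {m n : ℤ} {u v : SumModel} (hu : u ∈ gr m) (hv : v ∈ gr n) :
    u * v ∈ gr (m + n) := by
  intro i hi
  have hmul (j k : Gen) (h : j.deg + k.deg = i.deg) : u j * v k = 0 := by
    by_cases hj : j.deg = m
    · rw [hv k fun hk => hi (by rw [← h, hj, hk]), mul_zero]
    · rw [hu j hj, zero_mul]
  have hpair (j k : Gen) (h : j.deg + k.deg = i.deg) : pair u v j k = 0 := by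
    rw [pair, hmul j k h, hmul k j ((add_comm _ _).trans h), add_zero]
  have hpos : mulPos u v i = 0 := by
    cases i with
    | αα | xx | yy => exact hmul _ _ rfl
    | αx | αy | xy | αb | αc | yb | xc => exact hpair _ _ rfl
    | t => simp only [mulPos, hpair α β rfl, hpair x xx rfl, hpair y yy rfl, add_zero]
    | s => simp only [mulPos, hpair α p₃ rfl, hpair α p₄ rfl, hpair y p₁ rfl, hpair x p₂ rfl,
        add_zero, sub_zero]
    | τ => simp only [mulPos, hpair α yb rfl, hpair α xc rfl, hpair y αb rfl, hpair x αc rfl,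
        hpair αy b rfl, hpair αx c rfl, add_zero]
    | _ => rfl
  by_cases h1 : i = one
  · subst h1
    exact hmul one one rfl
  · rw [mul_apply u v h1, hpair one i (zero_add _), hpos, add_zero]

/-- The differential. -/
def d : SumModel →ₗ[ℚ] SumModel where
  toFun u :=
    ⟨fun
      | αα => u a
      | αx => u b
      | αy => u c
      | xy => u e
      | αb => -u p₁
      | αc => -u p₂
      | yb => u p₃
      | xc => u p₄
      | τ => u s
      | _ => 0⟩
  map_add' u v := by ext i; cases i <;> simp [add_comm]
  map_smul' q u := by ext i; cases i <;> simp

theorem d_mem_gr {n : ℤ} {u : SumModel} (hu : u ∈ gr n) : d u ∈ gr (n + 1) := by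
  have h (i j : Gen) (hij : j.deg = i.deg + 1) (hj : j.deg ≠ n + 1) : u i = 0 :=
    hu i fun hi => hj (by rw [hij, hi])
  intro i hi
  cases i <;> first
    | rfl
    | exact h _ _ rfl hi
    | exact neg_eq_zero.2 (h _ _ rfl hi)

theorem d_d (u : SumModel) : d (d u) = 0 := by
  ext i
  cases i <;> simp [d]

/-- The products of two elements of odd degree vanish in the model. -/
theorem mul_eq_zero_of_odd {u v : SumModel} (hu : ∀ i, Even i.deg → u i = 0)
    (hv : ∀ i, Even i.deg → v i = 0) : u * v = 0 := by
  ext i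
  cases i <;> simp [mul_one_apply, mul_apply, pair, mulPos, hu one Even.zero, hv one Even.zero,
    hu α even_two, hv α even_two, hu x even_two, hv x even_two, hu y even_two, hv y even_two,
    hu αx (by decide), hv αx (by decide), hu αy (by decide), hv αy (by decide)]

theorem apply_eq_zero_of_odd {n : ℤ} (hn : Odd n) {u : SumModel} (hu : u ∈ gr n) (i : Gen)
    (hi : Even i.deg) : u i = 0 :=
  hu i fun h => Int.not_even_iff_odd.2 hn (h ▸ hi)

theorem apply_eq_zero_of_even {n : ℤ} (hn : Even n) {u : SumModel} (hu : u ∈ gr n) (i : Gen)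
    (hi : Odd i.deg) : u i = 0 :=
  hu i fun h => Int.not_even_iff_odd.2 hi (h ▸ hn)

theorem d_mul_of_even {u : SumModel} (hu : ∀ i, Odd i.deg → u i = 0) (v : SumModel) :
    d (u * v) = d u * v + u * d v := by
  have ha := hu a (by decide)
  have hb := hu b (by decide)
  have hc := hu c (by decide)
  have he := hu e (by decide)
  have hαb := hu αb (by decide)
  have hαc := hu αc (by decide)
  have hyb := hu yb (by decide)
  have hxc := hu xc (by decide)
  ext i
  cases i <;> simp [mul_one_apply, mul_apply, pair, mulPos, d, *] <;> ring

theorem d_mul_of_odd {u : SumModel} (hu : ∀ i, Even i.deg → u i = 0) (v : SumModel) :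
    d (u * v) = d u * v - u * d v := by
  have h1 := hu one Even.zero
  have hα := hu α even_two
  have hx := hu x even_two
  have hy := hu y even_two
  have hαα := hu αα (by decide)
  have hαx := hu αx (by decide)
  have hαy := hu αy (by decide)
  have hxy := hu xy (by decide)
  have hβ := hu β (by decide)
  have hp₁ := hu p₁ (by decide)
  have hp₂ := hu p₂ (by decide)
  have hp₃ := hu p₃ (by decide)
  have hp₄ := hu p₄ (by decide)
  have hs := hu s (by decide)
  ext i
  cases i <;> simp [mul_one_apply, mul_apply, pair, mulPos, d, *]
  ring

end SumModel

/-- The cdga `SumModel`. -/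
def sumModel : CDGA ℚ where
  carrier := SumModel
  gr := SumModel.gr
  isInternal := SumModel.isInternal_gr
  one_mem i hi := SumModel.one_apply (by rintro rfl; exact hi rfl)
  mul_mem := SumModel.mul_mem_gr
  comm := by
    intro m n u v hu hv
    by_cases hm : Odd m
    · by_cases hn : Odd n
      · have hu' := SumModel.apply_eq_zero_of_odd hm hu
        have hv' := SumModel.apply_eq_zero_of_odd hn hv
        rw [SumModel.mul_eq_zero_of_odd hu' hv', SumModel.mul_eq_zero_of_odd hv' hu', smul_zero]
      · rw [Int.negOnePow_even _ ((Int.not_odd_iff_even.1 hn).mul_left m), mul_comm u v]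
        simp
    · rw [Int.negOnePow_even _ ((Int.not_odd_iff_even.1 hm).mul_right n), mul_comm u v]
      simp
  d := SumModel.d
  d_mem := SumModel.d_mem_gr
  d_d := SumModel.d_d
  leibniz := by
    intro m u hu v
    by_cases hm : Odd m
    · rw [SumModel.d_mul_of_odd (SumModel.apply_eq_zero_of_odd hm hu), Int.negOnePow_odd _ hm]
      simp [sub_eq_add_neg]
    · have hm := Int.not_odd_iff_even.1 hm
      rw [SumModel.d_mul_of_even (SumModel.apply_eq_zero_of_even hm hu), Int.negOnePow_even _ hm]
      simp

namespace SumModel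

open Gen

/-- The map `φ + lξ` from the model to `H ⊗ K`, where `ξ` is the map with `ξ(p₁) = -y²`,
`ξ(p₂) = -x²`, `ξ(p₃) = ξ(p₄) = β` and hence `ξ(s) = t`. -/
def toSum {K : Type} [Field K] [CharZero K] (l : K) : SumModel →+* SumAlg K where
  toFun u := ⟨u one, u α, u x, u y, u β + l * (u p₃ + u p₄), u xx - l * u p₂, u yy - l * u p₁,
    u t + l * u s⟩
  map_zero' := by ext <;> simp
  map_one' := by ext <;> simp [one_one, one_apply]
  map_add' u v := by ext <;> simp <;> ring
  map_mul' u v := by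
    ext <;> simp [mul_one_apply, mul_apply, pair, mulPos] <;> ring

theorem toSum_mem {K : Type} [Field K] [CharZero K] (l : K) {ι : Type} {w : ℤ → ι} {i : ι} {n : ℤ}
    (hw : ∀ k, i ≠ w k → n ≠ 2 * k) {u : SumModel} (hu : u ∈ gr n) : toSum l u ∈ SumAlg.gr w i := by
  have h (j : Gen) (k : ℤ) (hk : i ≠ w k) (hj : j.deg = 2 * k) : u j = 0 :=
    hu j fun h => hw k hk (by rw [← h, hj])
  refine ⟨fun hi => ?_, fun hi => ⟨?_, ?_, ?_⟩, fun hi => ⟨?_, ?_, ?_⟩, fun hi => ?_⟩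
  · simp [toSum, h one 0 hi rfl]
  · simp [toSum, h α 1 hi rfl]
  · simp [toSum, h x 1 hi rfl]
  · simp [toSum, h y 1 hi rfl]
  · simp [toSum, h β 2 hi rfl, h p₃ 2 hi rfl, h p₄ 2 hi rfl]
  · simp [toSum, h xx 2 hi rfl, h p₂ 2 hi rfl]
  · simp [toSum, h yy 2 hi rfl, h p₁ 2 hi rfl]
  · simp [toSum, h t 3 hi rfl, h s 3 hi rfl]

theorem toSum_d {K : Type} [Field K] [CharZero K] (l : K) (u : SumModel) : toSum l (d u) = 0 := by
  ext <;> simp [toSum, d]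

end SumModel

open SumModel in
/-- The quasi-isomorphism from the model to `(H, 0)`. -/
def sumModelMap : sumModel ⟶ algQ where
  toAlgHom := (toSum (0 : ℚ)).toRatAlgHom
  map_mem := toSum_mem 0 (fun _ => id)
  map_d := toSum_d 0

open SumModel in
theorem quasiIso_sumModelMap : CDGA.quasiIso ℚ sumModelMap := by
  rw [CDGA.quasiIso_iff]
  constructor
  · rintro (z : SumModel) (hz : d z = 0) ⟨y, hy : 0 = toSum 0 z⟩
    have hz' (i : Gen) : d z i = 0 := by rw [hz]; rfl
    have h1 : 0 = z .one := congrArg SumAlg.c1 hy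
    have hα : 0 = z .α := congrArg SumAlg.cα hy
    have hx : 0 = z .x := congrArg SumAlg.cx hy
    have hy' : 0 = z .y := congrArg SumAlg.cy hy
    have ht : 0 = z .t := by simpa [toSum] using congrArg SumAlg.ct hy
    have hβ : 0 = z .β := by simpa [toSum] using congrArg SumAlg.cβ hy
    have hxx : 0 = z .xx := by simpa [toSum] using congrArg SumAlg.cxx hy
    have hyy : 0 = z .yy := by simpa [toSum] using congrArg SumAlg.cyy hy
    have ha : z .a = 0 := hz' .αα
    have hb : z .b = 0 := hz' .αx
    have hc : z .c = 0 := hz' .αy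
    have he : z .e = 0 := hz' .xy
    have hp₁ : z .p₁ = 0 := neg_eq_zero.1 (hz' .αb)
    have hp₂ : z .p₂ = 0 := neg_eq_zero.1 (hz' .αc)
    have hp₃ : z .p₃ = 0 := hz' .yb
    have hp₄ : z .p₄ = 0 := hz' .xc
    have hs : z .s = 0 := hz' .τ
    let r : SumModel :=
      ⟨fun
        | .a => z .αα
        | .b => z .αx
        | .c => z .αy
        | .e => z .xy
        | .p₁ => -z .αb
        | .p₂ => -z .αc
        | .p₃ => z .yb
        | .p₄ => z .xc
        | .s => z .τ
        | _ => 0⟩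
    refine ⟨r, ?_⟩
    change d r = z
    ext i
    cases i <;> simp only [d, r, LinearMap.coe_mk, AddHom.coe_mk, neg_neg] <;>
      first | assumption | (symm; assumption)
  · intro (w : SumAlg ℚ) _
    let z : SumModel :=
      ⟨fun
        | .one => w.c1
        | .α => w.cα
        | .x => w.cx
        | .y => w.cy
        | .β => w.cβ
        | .xx => w.cxx
        | .yy => w.cyy
        | .t => w.ct
        | _ => 0⟩
    refine ⟨z, ?_, 0, ?_⟩
    · change d z = 0
      ext i
      cases i <;> simp [d, z]
    · change (0 : SumAlg ℚ) = toSum 0 z - w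
      refine (sub_eq_zero_of_eq ?_).symm
      ext <;> simp [toSum, z]

namespace SumModel

open Gen Classical in
/-- The basis element `i` of the model. -/
def single (i : Gen) : SumModel := ⟨fun j => if j = i then 1 else 0⟩

theorem single_apply_ne {i j : Gen} (h : j ≠ i) : single i j = 0 := if_neg h

theorem single_mem (i : Gen) : single i ∈ gr i.deg := fun _ hj =>
  single_apply_ne fun h => hj (congrArg Gen.deg h)

open Gen in
/-- The elements of the model that correspond to the generators of degree at most `4`. -/
def generators : ModelGenerators sumModel sumModelMap where
  α := single α
  x := single x
  y := single y
  a := single a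
  b := single b
  c := single c
  e := single e
  β := single β
  p₁ := single p₁
  p₂ := single p₂
  p₃ := single p₃
  p₄ := single p₄
  α_mem := single_mem α
  x_mem := single_mem x
  y_mem := single_mem y
  a_mem := single_mem a
  b_mem := single_mem b
  c_mem := single_mem c
  e_mem := single_mem e
  β_mem := single_mem β
  p₁_mem := single_mem p₁
  p₂_mem := single_mem p₂
  p₃_mem := single_mem p₃
  p₄_mem := single_mem p₄
  d_α := by
    change d _ = 0
    ext i; cases i <;> simp [d, single]
  d_x := by
    change d _ = 0
    ext i; cases i <;> simp [d, single]
  d_y := by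
    change d _ = 0
    ext i; cases i <;> simp [d, single]
  d_β := by
    change d _ = 0
    ext i; cases i <;> simp [d, single]
  d_a := by
    change d _ = single α * single α
    ext i; cases i <;> simp [d, single, mul_one_apply, mul_apply, pair, mulPos]
  d_b := by
    change d _ = single x * single α
    ext i; cases i <;> simp [d, single, mul_one_apply, mul_apply, pair, mulPos]
  d_c := by
    change d _ = single y * single α
    ext i; cases i <;> simp [d, single, mul_one_apply, mul_apply, pair, mulPos]
  d_e := by
    change d _ = single x * single y
    ext i; cases i <;> simp [d, single, mul_one_apply, mul_apply, pair, mulPos]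
  d_p₁ := by
    change d _ = single x * single a - single α * single b
    ext i; cases i <;> simp [d, single, mul_one_apply, mul_apply, pair, mulPos]
  d_p₂ := by
    change d _ = single y * single a - single α * single c
    ext i; cases i <;> simp [d, single, mul_one_apply, mul_apply, pair, mulPos]
  d_p₃ := by
    change d _ = single y * single b - single α * single e
    ext i; cases i <;> simp [d, single, mul_one_apply, mul_apply, pair, mulPos]
  d_p₄ := by
    change d _ = single x * single c - single α * single e
    ext i; cases i <;> simp [d, single, mul_one_apply, mul_apply, pair, mulPos]
  φ_α := by
    change toSum 0 _ = _
    ext <;> simp [toSum, single, SumAlg.gα]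
  φ_x := by
    change toSum 0 _ = _
    ext <;> simp [toSum, single, SumAlg.gx]
  φ_y := by
    change toSum 0 _ = _
    ext <;> simp [toSum, single, SumAlg.gy]
  φ_β := by
    change toSum 0 _ = _
    ext <;> simp [toSum, single, SumAlg.gβ]
  φ_p₁ := by
    change toSum 0 _ = _
    ext <;> simp [toSum, single]
  φ_p₂ := by
    change toSum 0 _ = _
    ext <;> simp [toSum, single]
  φ_p₃ := by
    change toSum 0 _ = _
    ext <;> simp [toSum, single]
  φ_p₄ := by
    change toSum 0 _ = _
    ext <;> simp [toSum, single]

/-- The map `φ + lξ`, for real `l`, takes values in `H ⊗ ℝ`. -/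
def toReal (l : ℝ) : SumModel →+* algC.realPoints :=
  (toSum (l : ℂ)).codRestrict algC.realPoints fun u => by
    change SumAlg.conj (toSum (l : ℂ) u) = toSum (l : ℂ) u
    ext1 <;> simp [SumAlg.conj, toSum]

theorem toReal_mem (l : ℝ) {n : ℤ} {u : SumModel} (hu : u ∈ gr n) :
    toReal l u ∈ algC.toReal.gr n := by
  change toSum (l : ℂ) u ∈ algC.totalGr n
  obtain ⟨m, rfl⟩ | hn := Int.even_or_odd n
  · refine algC.mem_totalGr (i := (m, m)) (toSum_mem _ (fun k hk h => hk ?_) hu)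
    rw [show m = k by omega]
  · have h : toSum (l : ℂ) u = 0 :=
      SumAlg.eq_zero_of_mem_gr (w := fun k => 2 * k) (fun k h => by
        rw [h] at hn
        exact Int.not_even_iff_odd.2 hn (even_two_mul k)) (toSum_mem (i := n) _ (fun _ => id) hu)
    rw [h]
    exact zero_mem _

/-- The extension of scalars of `φ + lξ`. -/
def psiHom (l : ℝ) : ℝ ⊗[ℚ] SumModel →ₐ[ℝ] algC.realPoints :=
  letI : Algebra ℚ algC.realPoints := Algebra.compHom algC.realPoints (algebraMap ℚ ℝ)
  haveI : IsScalarTower ℚ ℝ algC.realPoints := IsScalarTower.of_algebraMap_eq fun _ => rfl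
  Algebra.TensorProduct.lift (Algebra.ofId ℝ algC.realPoints) (toReal l).toRatAlgHom
    fun _ _ => Algebra.commutes _ _

theorem psiHom_tmul (l r : ℝ) (u : SumModel) : psiHom l (r ⊗ₜ u) = r • toReal l u := by
  rw [Algebra.smul_def]; rfl

/-- The morphism `ψ_l` out of the model. -/
def psi (l : ℝ) : sumModel.extend ℝ ⟶ algC.toReal where
  toAlgHom := psiHom l
  map_mem := by
    intro n a ha
    refine CDGA.baseChange_induction ℝ (p := fun a => psiHom l a ∈ algC.toReal.gr n) ha
      (by rw [map_zero]; exact zero_mem _)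
      (fun x y hx hy => by rw [map_add]; exact add_mem hx hy) ?_
    intro r u hu
    rw [psiHom_tmul]
    exact Submodule.smul_mem _ r (toReal_mem l hu)
  map_d := by
    intro (a : ℝ ⊗[ℚ] SumModel)
    refine Eq.trans ?_ (algC_toReal_d _).symm
    change psiHom l (d.baseChange ℝ a) = 0
    induction a with
    | zero => rw [map_zero, map_zero]
    | add a b ha hb => rw [map_add, map_add, ha, hb, add_zero]
    | tmul r u =>
      rw [LinearMap.baseChange_tmul, psiHom_tmul]
      have h : toReal l (d u) = 0 := Subtype.ext (toSum_d (l : ℂ) u)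
      rw [h, smul_zero]

theorem psiValue_psi (l : ℝ) (u : SumModel) : psiValue (psi l) u = toSum (l : ℂ) u := by
  have h : psiHom l (1 ⊗ₜ u) = toReal l u := by rw [psiHom_tmul, one_smul]
  exact congrArg algC.realPoints.val h

open Gen in
theorem isPsi_psi (l : ℝ) : generators.IsPsi l (psi l) where
  ψ_α := by
    refine (psiValue_psi l (single α)).trans ?_
    ext <;> simp [toSum, single, SumAlg.gα]
  ψ_x := by
    refine (psiValue_psi l (single x)).trans ?_
    ext <;> simp [toSum, single, SumAlg.gx]
  ψ_y := by
    refine (psiValue_psi l (single y)).trans ?_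
    ext <;> simp [toSum, single, SumAlg.gy]
  ψ_β := by
    refine (psiValue_psi l (single β)).trans ?_
    ext <;> simp [toSum, single, SumAlg.gβ]
  ψ_p₁ := by
    refine (psiValue_psi l (single p₁)).trans ?_
    ext <;> simp [toSum, single, SumAlg.gy, -Complex.coe_smul]
  ψ_p₂ := by
    refine (psiValue_psi l (single p₂)).trans ?_
    ext <;> simp [toSum, single, SumAlg.gx, -Complex.coe_smul]
  ψ_p₃ := by
    refine (psiValue_psi l (single p₃)).trans ?_
    ext <;> simp [toSum, single, SumAlg.gβ, -Complex.coe_smul]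
  ψ_p₄ := by
    refine (psiValue_psi l (single p₄)).trans ?_
    ext <;> simp [toSum, single, SumAlg.gβ, -Complex.coe_smul]

end SumModel

end

theorem theoremC :
    (∃ (M : CDGA ℚ) (φ : M ⟶ algQ) (_ : CDGA.quasiIso ℚ φ) (g : ModelGenerators M φ),
      ∀ l : ℝ, ∃ ψ : M.extend ℝ ⟶ algC.toReal, g.IsPsi l ψ) ∧
    (∀ (M : CDGA ℚ) (φ : M ⟶ algQ), CDGA.quasiIso ℚ φ →
      ∀ (g : ModelGenerators M φ) (l : ℝ) (ψ : M.extend ℝ ⟶ algC.toReal), g.IsPsi l ψ →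
        ∃ (hφ : CDGA.quasiIso ℝ (CDGA.extendMap ℝ φ)) (hψ : CDGA.quasiIso ℝ ψ),
          (roofTriple φ ψ hφ hψ).C.DdbarProperty ∧
          (roofTriple φ ψ hφ hψ).C.StronglyFormal ∧
          (Irrational l → ¬ (roofTriple φ ψ hφ hψ).StronglyFormalOverQ)) ∧
    ¬ ∀ T : RatCBBA, T.C.DdbarProperty → T.C.StronglyFormal → T.StronglyFormalOverQ := by
  have hmodel : ∃ (M : CDGA ℚ) (φ : M ⟶ algQ) (_ : CDGA.quasiIso ℚ φ) (g : ModelGenerators M φ),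
      ∀ l : ℝ, ∃ ψ : M.extend ℝ ⟶ algC.toReal, g.IsPsi l ψ :=
    ⟨sumModel, sumModelMap, quasiIso_sumModelMap, SumModel.generators,
      fun l => ⟨SumModel.psi l, SumModel.isPsi_psi l⟩⟩
  have hroof : ∀ (M : CDGA ℚ) (φ : M ⟶ algQ), CDGA.quasiIso ℚ φ →
      ∀ (g : ModelGenerators M φ) (l : ℝ) (ψ : M.extend ℝ ⟶ algC.toReal), g.IsPsi l ψ →
        ∃ (hφ : CDGA.quasiIso ℝ (CDGA.extendMap ℝ φ)) (hψ : CDGA.quasiIso ℝ ψ),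
          (roofTriple φ ψ hφ hψ).C.DdbarProperty ∧
          (roofTriple φ ψ hφ hψ).C.StronglyFormal ∧
          (Irrational l → ¬ (roofTriple φ ψ hφ hψ).StronglyFormalOverQ) := by
    intro M φ hφ g l ψ hg
    have hφ' := (CDGA.quasiIso_extendMap_iff ℝ φ).2 hφ
    exact ⟨hφ', hg.quasiIso hφ', RCBBA.ddbarProperty_of_trivial rfl rfl,
      ⟨algC, rfl, rfl, .refl _⟩, hg.not_stronglyFormalOverQ⟩
  refine ⟨hmodel, hroof, fun h => ?_⟩
  obtain ⟨M, φ, hφ, g, hψ⟩ := hmodel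
  obtain ⟨ψ, hg⟩ := hψ (√2)
  obtain ⟨h₁, h₂, hd, hs, hn⟩ := hroof M φ hφ g _ ψ hg
  exact hn irrational_sqrt_two (h _ hd hs)
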